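/- Smooth manifolds are paracompact, Hausdorff, modelled on Hausdorff locally convex topological vector spaces, and admit smooth partitions of unity. Let $\mathbb{T}\subset\mathbb{C}$ be the unit circle. A bundle gerbe $\mathcal{G}=(Y,P,s)$ over a manifold $M$ consists of a surjective submersion $\pi:Y\to M$, a principal $\mathbb{T}$-bundle $P\to Y^{[2]}=Y\times_M Y$, and a section $s$ of $\delta P=\pi_1^*P\otimes\pi_2^*P^{\otimes-1}\otimes\pi_3^*P$ over $Y^{[3]}$ with $\delta s=1$, where $\pi_i$ omits the $i$-th factor and $\delta=\sum_i(-1)^{i-1}\pi_i^*$ on forms. A connection on $\mathcal{G}$ is a connection $\nabla$ on $P$ with $s^*(\delta\nabla)=0$; a curving for $\nabla$ is an imaginary 2-form $f$ on $Y$ with $\delta f=F(\nabla)$, the curvature of $\nabla$. A stable isomorphism from $(\mathcal{G},\nabla,f)$ to $(\mathcal{G}',\nabla',f')$, with $\mathcal{G}'=(Y',P',s')$, is a principal $\mathbb{T}$-bundle $R\to Y\times_M Y'$ with connection $\eta$ and a section $v$ of $\delta R^{\otimes -1}\otimes(P^{\otimes-1}\otimes P')$ over $(Y\times_M Y')^{[2]}$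 such that $\delta v=s^{\otimes-1}\otimes s'$, $v^*(\delta\eta^{\otimes-1}\otimes\nabla^{\otimes-1}\otimes\nabla')=0$ and $F(\eta)=f'-f$. Let $G$ be a Lie group with Lie algebra $\mathfrak{g}$ acting (on the left) on a manifold $M$, and let $(\mathcal{G},\nabla,f)$, $\mathcal{G}=(Y,P,s)$, be a strongly $G$-equivariant bundle gerbe with invariant connection and curving over $M$: the action of $G$ on $M$ is lifted to $Y$ and the induced action on $Y^{[2]}$ to $P$ by bundle isomorphisms, and $s$, $\nabla$, $f$ are $G$-invariant. Suppose that $G$ acts freely and locally trivially on $M$ and on $Y$, and that $M/G$ and $Y/G$ are smooth manifolds such that the projections $q:M\to M/G$ and $Y\to Y/G$ are smooth. Let $\bar{\mathcal{G}}=(Y/G,P/G,\bar s)$ be the quotient bundle gerbe over $M/G$, and fix a connection $\Xi\in A^1(M,\mathfrak{g})$ on the principal $G$-bundle $q:M\to M/G$. For a $G$-equivariant principal $\mathbb{T}$-bundle with $G$-invariant connection $\Theta$, the moment is the function $\mu$ on the base with values in $\mathfrak{g}^\dagger=\mathrm{Hom}(\mathfrak{g},\sqrt{-1}\,\mathbb{R})$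 given by $\langle X|\mu(x)\rangle=\Theta(p;X^*)$ for $p$ in the fibre over $x$, where $X^*$ is the tangent vector generated by $X\in\mathfrak{g}$. Let $\tilde\lambda:Y^{[2]}\to\mathfrak{g}^\dagger$ be the moment of $(P,\nabla)$. A smooth map $\lambda:Y\to\mathfrak{g}^\dagger$ is called admissible if $\delta\lambda=\tilde\lambda$ and $$\langle X|d\lambda\rangle+\iota_{X^*}f=0,\qquad \langle X|\lambda(gy)\rangle=\langle \mathrm{Ad}_{g^{-1}}X|\lambda(y)\rangle\qquad (X\in\mathfrak{g},\ g\in G,\ y\in Y).$$ For an admissible $\lambda$ put $\kappa=\langle\pi^*\Xi|\lambda\rangle$. Then $\nabla-\delta\kappa$ and $f-d\kappa$ descend to a connection $\bar\nabla$ and a curving $\bar f$ on $\bar{\mathcal{G}}$; the triple $(\bar{\mathcal{G}},\bar\nabla,\bar f)$ is called the reduction of $(\mathcal{G},\nabla,f)$ with respect to $\lambda$. Theorem. Let $\lambda$ and $\lambda'$ be admissible, and let $(\bar{\mathcal{G}},\bar\nabla,\bar f)$ and $(\bar{\mathcal{G}},\bar\nabla',\bar f')$ be the reductions of $(\mathcal{G},\nabla,f)$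 with respect to $\lambda$ and $\lambda'$. Then $\bar\nabla'=\bar\nabla$. Moreover, $(\bar{\mathcal{G}},\bar\nabla,\bar f)$ and $(\bar{\mathcal{G}},\bar\nabla',\bar f')$ are stably isomorphic if and only if $\lambda'-\lambda$ is (the pull-back under $\pi$ of) the moment of a $G$-equivariant principal $\mathbb{T}$-bundle over $M$ with $G$-invariant flat connection. -/

import Mathlib

open Set Filter Topology

universe u v

/-! ## Smooth calculus on locally convex spaces -/

/-- A Hausdorff locally convex real topological vector space. -/
structure LCS : Type (u + 1) where
  carrier : Type u
  [grp : AddCommGroup carrier]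
  [mod : Module ℝ carrier]
  [top : TopologicalSpace carrier]
  [topGrp : IsTopologicalAddGroup carrier]
  [contSMul : ContinuousSMul ℝ carrier]
  [locConv : LocallyConvexSpace ℝ carrier]
  [t2 : T2Space carrier]

instance : CoeSort LCS.{u} (Type u) := ⟨LCS.carrier⟩

attribute [instance] LCS.grp LCS.mod LCS.top LCS.topGrp LCS.contSMul LCS.locConv LCS.t2

/-- The product of two locally convex spaces. -/
abbrev LCS.prod (E F : LCS.{u}) : LCS.{u} := ⟨E × F⟩

section Calculus

variable {E : Type u} [AddCommGroup E] [Module ℝ E]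
variable {F : Type v} [AddCommGroup F] [Module ℝ F] [TopologicalSpace F]

/-- `w` is the derivative of `f` at `x` in the direction `v`. -/
def HasDirDeriv (f : E → F) (x v : E) (w : F) : Prop :=
  Tendsto (fun t : ℝ => t⁻¹ • (f (x + t • v) - f x)) (𝓝[≠] 0) (𝓝 w)

/-- The derivative of `f` at `x` in the direction `v` (meaningful when it exists). -/
noncomputable def dirDeriv (f : E → F) (x v : E) : F :=
  limUnder (𝓝[≠] (0 : ℝ)) (fun t : ℝ => t⁻¹ • (f (x + t • v) - f x))

/-- `f` is of class `C^n` on the open set `U` in the sense of Michal and Bastiani: it is continuous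
and, for `n > 0`, its directional derivatives `df(x, v)` exist for `x ∈ U` and all `v`, and `df` is
of class `C^(n-1)` on `U × E`. -/
def CnOn (F : Type v) [AddCommGroup F] [Module ℝ F] [TopologicalSpace F] :
    ℕ → ∀ (E : Type u) [AddCommGroup E] [Module ℝ E] [TopologicalSpace E],
      Set E → (E → F) → Prop
  | 0, _, _, _, _, U, f => ContinuousOn f U
  | n + 1, E, _, _, _, U, f =>
      ContinuousOn f U ∧ (∀ x ∈ U, ∀ v : E, ∃ w : F, HasDirDeriv f x v w) ∧
        CnOn F n (E × E) (U ×ˢ univ) (fun p => dirDeriv f p.1 p.2)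

/-- `f` is smooth on the open set `U`. -/
def IsSmoothOn [TopologicalSpace E] (U : Set E) (f : E → F) : Prop :=
  ∀ n : ℕ, CnOn F n E U f

/-- The exterior derivative of a `k`-form given on an open subset of a locally convex space:
`dα(v₀, …, v_k) = ∑ i, (-1)^i D_{v_i} α(v₀, …, v̂_i, …, v_k)`. -/
noncomputable def extD {k : ℕ} (α : E → (Fin k → E) → F) (x : E) (w : Fin (k + 1) → E) : F :=
  ∑ i : Fin (k + 1), (-1 : ℝ) ^ (i : ℕ) • dirDeriv (fun y => α y (i.removeNth w)) x (w i)

/-- The logarithmic derivative `(√-1)⁻¹ z⁻¹ dz` of a circle valued function `z`. -/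
noncomputable def dlog (z : E → Circle) (x v : E) : ℝ :=
  (dirDeriv (fun y => (z y : ℂ)) x v / (z x : ℂ)).im

/-- A circle valued function is smooth on `U`. -/
def IsCircleSmoothOn [TopologicalSpace E] (U : Set E) (z : E → Circle) : Prop :=
  IsSmoothOn U (fun y => (z y : ℂ))

end Calculus

/-! ## Smooth spaces and manifolds modelled on locally convex spaces

The smooth structure of a manifold is recorded by its plots, that is, by the collection of all smooth
maps from open subsets of locally convex spaces into it. In this way manifolds form a full
subcategory of smooth spaces: those which are locally isomorphic to open subsets of locally convex
spaces. Products, fibre products along submersions, and base spaces of locally trivial bundles have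
the same smooth structure in both categories. -/

/-- A smooth structure on a set, given by its plots `c : U → X`. A map on an open set `U` is written
as a total function, of which only the restriction to `U` matters. -/
class SmoothSpace (X : Type u) : Type (u + 1) where
  IsPlot : ∀ {E : LCS.{u}}, Set E → (E → X) → Prop
  isOpen_dom : ∀ {E : LCS.{u}} {U : Set E} {c : E → X}, IsPlot U c → IsOpen U
  const : ∀ {E : LCS.{u}} {U : Set E} (x : X), IsOpen U → IsPlot U (fun _ => x)
  comp : ∀ {E E' : LCS.{u}} {U : Set E} {V : Set E'} {c : E → X} {h : E' → E},
    IsPlot U c → IsOpen V → IsSmoothOn V h → MapsTo h V U → IsPlot V (c ∘ h)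
  glue : ∀ {E : LCS.{u}} {U : Set E} {c : E → X}, IsOpen U →
    (∀ x ∈ U, ∃ (V : Set E) (c' : E → X), x ∈ V ∧ V ⊆ U ∧ IsPlot V c' ∧ EqOn c c' V) →
    IsPlot U c

open SmoothSpace (IsPlot)

/-- The product of smooth spaces. -/
instance SmoothSpace.instProd (X Y : Type u) [SmoothSpace X] [SmoothSpace Y] :
    SmoothSpace (X × Y) where
  IsPlot U c := SmoothSpace.IsPlot U (fun x => (c x).1) ∧ SmoothSpace.IsPlot U (fun x => (c x).2)
  isOpen_dom h := SmoothSpace.isOpen_dom h.1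
  const x hU := ⟨SmoothSpace.const x.1 hU, SmoothSpace.const x.2 hU⟩
  comp hc hV hh hm := ⟨SmoothSpace.comp hc.1 hV hh hm, SmoothSpace.comp hc.2 hV hh hm⟩
  glue hU H := by
    constructor
    · refine SmoothSpace.glue hU fun x hx => ?_
      obtain ⟨V, c', h1, h2, h3, h4⟩ := H x hx
      exact ⟨V, _, h1, h2, h3.1, fun y hy => by simp only [h4 hy]⟩
    · refine SmoothSpace.glue hU fun x hx => ?_
      obtain ⟨V, c', h1, h2, h3, h4⟩ := H x hx
      exact ⟨V, _, h1, h2, h3.2, fun y hy => by simp only [h4 hy]⟩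

/-- The smooth structure on a subset. -/
instance SmoothSpace.instSubtype (X : Type u) [SmoothSpace X] (p : X → Prop) :
    SmoothSpace {x // p x} where
  IsPlot U c := SmoothSpace.IsPlot U (fun x => (c x).1)
  isOpen_dom h := SmoothSpace.isOpen_dom h
  const x hU := SmoothSpace.const x.1 hU
  comp hc hV hh hm := SmoothSpace.comp hc hV hh hm
  glue hU H := by
    refine SmoothSpace.glue hU fun x hx => ?_
    obtain ⟨V, c', h1, h2, h3, h4⟩ := H x hx
    exact ⟨V, _, h1, h2, h3, fun y hy => by simp only [h4 hy]⟩

/-- The topology of a smooth space: `A` is open when its preimages under all plots are. For a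
manifold this is the usual topology. -/
@[reducible] def smoothTopology (X : Type u) [SmoothSpace X] : TopologicalSpace X where
  IsOpen A := ∀ (E : LCS.{u}) (U : Set E) (c : E → X), IsPlot U c → IsOpen (U ∩ c ⁻¹' A)
  isOpen_univ E U c h := by simpa using SmoothSpace.isOpen_dom h
  isOpen_inter A B hA hB E U c h := by
    have := (hA E U c h).inter (hB E U c h)
    rwa [← inter_inter_distrib_left, ← preimage_inter] at this
  isOpen_sUnion S hS E U c h := by
    rw [preimage_sUnion, inter_iUnion₂]
    exact isOpen_biUnion fun A hA => hS A hA E U c h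

/-- Openness of a subset of a smooth space. -/
def IsSmoothOpen {X : Type u} [SmoothSpace X] (A : Set X) : Prop :=
  IsOpen[smoothTopology X] A

/-- A map is smooth on a subset if it takes the plots in that subset to plots. -/
def IsSmoothMapOn {X Y : Type u} [SmoothSpace X] [SmoothSpace Y] (A : Set X) (f : X → Y) : Prop :=
  ∀ (E : LCS.{u}) (U : Set E) (c : E → X), IsPlot U c → MapsTo c U A → IsPlot U (f ∘ c)

/-- A map between smooth spaces is smooth. -/
def IsSmoothMap {X Y : Type u} [SmoothSpace X] [SmoothSpace Y] (f : X → Y) : Prop :=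
  IsSmoothMapOn univ f

/-- A function on a smooth space with values in a topological vector space is smooth on a
subset. -/
def IsSmoothFunOn {X : Type u} [SmoothSpace X] {F : Type v} [AddCommGroup F] [Module ℝ F]
    [TopologicalSpace F] (A : Set X) (f : X → F) : Prop :=
  ∀ (E : LCS.{u}) (U : Set E) (c : E → X), IsPlot U c → MapsTo c U A → IsSmoothOn U (f ∘ c)

/-- `φ : U → X` is a diffeomorphism from an open subset `U` of the locally convex space `E` onto an
open subset of `X`, with inverse `ψ`. -/
structure IsChart {X : Type u} [SmoothSpace X] {E : LCS.{u}} (U : Set E) (φ : E → X)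
    (ψ : X → E) : Prop where
  isPlot : IsPlot U φ
  isOpen_image : IsSmoothOpen (φ '' U)
  leftInv : ∀ x ∈ U, ψ (φ x) = x
  smooth_inv : IsSmoothFunOn (φ '' U) ψ

/-- A smooth manifold: a paracompact Hausdorff space, locally diffeomorphic to open subsets of
Hausdorff locally convex spaces, which admits smooth partitions of unity. -/
structure IsLCManifold (X : Type u) [SmoothSpace X] : Prop where
  t2 : @T2Space X (smoothTopology X)
  paracompact : @ParacompactSpace X (smoothTopology X)
  exists_chart : ∀ x : X, ∃ (E : LCS.{u}) (U : Set E) (φ : E → X) (ψ : X → E),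
    IsChart U φ ψ ∧ x ∈ φ '' U
  exists_partition : ∀ (ι : Type u) (O : ι → Set X), (∀ i, IsSmoothOpen (O i)) →
    (⋃ i, O i) = univ →
    ∃ ρ : ι → X → ℝ, (∀ i, IsSmoothFunOn univ (ρ i)) ∧ (∀ i x, 0 ≤ ρ i x) ∧
      @LocallyFinite ι X (smoothTopology X) (fun i => Function.support (ρ i)) ∧
      (∀ i, @closure X (smoothTopology X) (Function.support (ρ i)) ⊆ O i) ∧
      ∀ x, ∑ᶠ i, ρ i x = 1

/-- A surjective submersion: a smooth surjection which in suitable charts around each point is a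
projection `(a, b) ↦ a`. In particular it has a smooth local section through every point. -/
structure IsSurjSubmersion {Y M : Type u} [SmoothSpace Y] [SmoothSpace M] (π : Y → M) :
    Prop where
  smooth : IsSmoothMap π
  surjective : Function.Surjective π
  locally_proj : ∀ y : Y, ∃ (A B : LCS.{u}) (U : Set (A.prod B)) (φ : A.prod B → Y)
    (φ' : Y → A.prod B) (V : Set A) (χ : A → M) (χ' : M → A),
    IsChart U φ φ' ∧ IsChart V χ χ' ∧ y ∈ φ '' U ∧
      ∀ a b, (a, b) ∈ U → a ∈ V ∧ π (φ (a, b)) = χ a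

/-- A differential `k`-form on a smooth space, given by its pull-backs along all plots. For a
manifold, where it is determined by its expressions in charts, this is a smooth differential form
in the usual sense. The value at `U c x` is the pull-back of the form along the plot `c : U → X` at
the point `x ∈ U`; it is set to zero when `c` is not a plot on `U` or `x ∉ U`. -/
@[ext]
structure SmoothForm (k : ℕ) (X : Type u) [SmoothSpace X] (V : Type v) [AddCommGroup V]
    [Module ℝ V] [TopologicalSpace V] : Type (max (u + 1) v) where
  toFun : ∀ (E : LCS.{u}), Set E → (E → X) → E → (E [⋀^Fin k]→ₗ[ℝ] V)
  eq_zero : ∀ (E : LCS.{u}) (U : Set E) (c : E → X) (x : E), ¬ (IsPlot U c ∧ x ∈ U) →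
    toFun E U c x = 0
  smooth : ∀ (E : LCS.{u}) (U : Set E) (c : E → X), IsPlot U c →
    IsSmoothOn (U ×ˢ (univ : Set (Fin k → E))) (fun p => toFun E U c p.1 p.2)
  natural : ∀ (E E' : LCS.{u}) (U : Set E) (U' : Set E') (c : E → X) (c' : E' → X) (h : E' → E),
    IsPlot U c → IsPlot U' c' → IsSmoothOn U' h → MapsTo h U' U → EqOn c' (c ∘ h) U' →
    ∀ x ∈ U', ∀ w : Fin k → E',
      toFun E' U' c' x w = toFun E U c (h x) (fun i => dirDeriv h x (w i))

/-- The value at `x` on the vectors `w` of the pull-back `c^*ω` of a form along a plot `c`. -/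
def SmoothForm.at {k : ℕ} {X : Type u} [SmoothSpace X] {V : Type v} [AddCommGroup V] [Module ℝ V]
    [TopologicalSpace V] (ω : SmoothForm k X V) {E : LCS.{u}} (U : Set E) (c : E → X) (x : E)
    (w : Fin k → E) : V :=
  ω.toFun E U c x w

/-! ## Lie groups, actions and principal bundles -/

/-- A Lie group. -/
structure IsLieGrp (G : Type u) [Group G] [SmoothSpace G] : Prop where
  manifold : IsLCManifold G
  smooth_mul : IsSmoothMap (fun p : G × G => p.1 * p.2)
  smooth_inv : IsSmoothMap (fun g : G => g⁻¹)

/-- The Lie algebra `𝔤 = T_e G`, realized by means of a chart `exp` around the identity: `X ∈ 𝔤`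
corresponds to the velocity at `t = 0` of the curve `t ↦ exp (t X)`. (The chart need not be the
exponential map.) -/
structure LieAlg (G : Type u) [Group G] [SmoothSpace G] : Type (u + 1) where
  𝔤 : LCS.{u}
  dom : Set 𝔤
  exp : 𝔤 → G
  log : G → 𝔤
  isChart : IsChart dom exp log
  zero_mem : (0 : 𝔤) ∈ dom
  exp_zero : exp 0 = 1

/-- The adjoint action of `G` on its Lie algebra: the derivative at the identity of
`h ↦ g h g⁻¹`. -/
noncomputable def LieAlg.Ad {G : Type u} [Group G] [SmoothSpace G] (L : LieAlg G) (g : G)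
    (X : L.𝔤) : L.𝔤 :=
  dirDeriv (fun ξ : L.𝔤 => L.log (g * L.exp ξ * g⁻¹)) 0 X

/-- A left action is smooth. -/
def IsSmoothAction (G X : Type u) [Group G] [SmoothSpace G] [SmoothSpace X] [MulAction G X] :
    Prop :=
  IsSmoothMap (fun p : G × X => p.1 • p.2)

/-- The form `ω` is invariant under the action of `G`. -/
def SmoothForm.IsInvariant (G : Type u) [Group G] {k : ℕ} {X : Type u} [SmoothSpace X]
    [MulAction G X] (ω : SmoothForm k X ℝ) : Prop :=
  ∀ (g : G) (E : LCS.{u}) (U : Set E) (c : E → X), IsPlot U c → ∀ x ∈ U, ∀ w : Fin k → E,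
    ω.at U (fun y => g • c y) x w = ω.at U c x w

/-- The value `ω(p; X^*)` of a 1-form on the tangent vector `X^*` at `p` generated by the
infinitesimal action of `X ∈ 𝔤`. For an invariant connection on an equivariant principal
`𝕋`-bundle this is the moment. -/
def SmoothForm.moment {G : Type u} [Group G] [SmoothSpace G] (L : LieAlg G) {X : Type u}
    [SmoothSpace X] [MulAction G X] {V : Type v} [AddCommGroup V] [Module ℝ V]
    [TopologicalSpace V] (ω : SmoothForm 1 X V) (p : X) (ξ : L.𝔤) : V :=
  ω.at L.dom (fun η => L.exp η • p) 0 ![ξ]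

/-- The value on the vector `w` of the pull-back of `ι_{X^*} ω` along a plot `c` of `X`, for a
2-form `ω`. -/
def SmoothForm.contract {G : Type u} [Group G] [SmoothSpace G] (L : LieAlg G) {X : Type u}
    [SmoothSpace X] [MulAction G X] (ω : SmoothForm 2 X ℝ) (ξ : L.𝔤) {E : LCS.{u}} (U : Set E)
    (c : E → X) (x w : E) : ℝ :=
  ω.at (E := L.𝔤.prod E) (L.dom ×ˢ U) (fun p => L.exp p.1 • c p.2) (0, x) ![(ξ, 0), (0, w)]

/-- `q : X → X'` exhibits the smooth space `X'` as the orbit space `X/G`: the fibres of `q` are the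
orbits, and the smooth structure of `X'` is the quotient structure. -/
structure IsOrbitSpace (G : Type u) [Group G] {X X' : Type u} [SmoothSpace X] [SmoothSpace X']
    [MulAction G X] (q : X → X') : Prop where
  smooth : IsSmoothMap q
  surjective : Function.Surjective q
  fiber : ∀ x y : X, q x = q y ↔ ∃ g : G, g • x = y
  lift : ∀ (E : LCS.{u}) (U : Set E) (c : E → X'), IsPlot U c → ∀ x ∈ U,
    ∃ (V : Set E) (c' : E → X), x ∈ V ∧ V ⊆ U ∧ IsPlot V c' ∧ EqOn c (q ∘ c') V

/-- The action of `G` on `X` is free and locally trivial, with quotient the smooth space `X'`: every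
point of `X'` has an open neighbourhood `W` with a smooth section `σ`, such that `(x', g) ↦ g σ(x')`
is a diffeomorphism from `W × G` to the preimage of `W`, with inverse `x ↦ (q x, τ x)`. -/
structure IsPrincipalQuotient (G : Type u) [Group G] [SmoothSpace G] {X X' : Type u}
    [SmoothSpace X] [SmoothSpace X'] [MulAction G X] (q : X → X') : Prop where
  smoothAction : IsSmoothAction G X
  smooth : IsSmoothMap q
  surjective : Function.Surjective q
  fiber : ∀ x y : X, q x = q y ↔ ∃ g : G, g • x = y
  free : ∀ (g : G) (x : X), g • x = x → g = 1
  locTriv : ∀ x' : X', ∃ (W : Set X') (σ : X' → X) (τ : X → G), IsSmoothOpen W ∧ x' ∈ W ∧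
    (∀ y ∈ W, q (σ y) = y) ∧ IsSmoothMapOn W σ ∧
    (∀ x, q x ∈ W → τ x • σ (q x) = x) ∧ IsSmoothMapOn (q ⁻¹' W) τ

/-- `Ξ` is a connection on the principal `G`-bundle `M → M/G`: a `𝔤`-valued 1-form on `M` with
`Ξ(X^*) = X` and `g^*Ξ = Ad_g Ξ`. -/
structure IsGConnection {G : Type u} [Group G] [SmoothSpace G] (L : LieAlg G) {M : Type u}
    [SmoothSpace M] [MulAction G M] (Ξ : SmoothForm 1 M L.𝔤) : Prop where
  vertical : ∀ (m : M) (ξ : L.𝔤), Ξ.moment L m ξ = ξ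
  equivariant : ∀ (g : G) (E : LCS.{u}) (U : Set E) (c : E → M), IsPlot U c → ∀ x ∈ U,
    ∀ w : Fin 1 → E, Ξ.at U (fun y => g • c y) x w = L.Ad g (Ξ.at U c x w)

/-! ## Principal `𝕋`-bundles with connection

Forms with values in `√-1 ℝ` are written as `√-1` times real valued forms throughout. -/

/-- A principal `𝕋`-bundle over a smooth space. -/
structure TBundle (X : Type u) [SmoothSpace X] : Type (u + 1) where
  Tot : Type u
  [smoothTot : SmoothSpace Tot]
  [act : MulAction Circle Tot]
  proj : Tot → X
  smooth_proj : IsSmoothMap proj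
  smooth_act : ∀ (E : LCS.{u}) (U : Set E) (c : E → Tot) (z : E → Circle), IsPlot U c →
    IsCircleSmoothOn U z → IsPlot U (fun x => z x • c x)
  fiber : ∀ p p' : Tot, proj p = proj p' ↔ ∃ z : Circle, z • p = p'
  free : ∀ (z : Circle) (p : Tot), z • p = p → z = 1
  locTriv : ∀ x : X, ∃ (W : Set X) (σ : X → Tot) (τ : Tot → Circle), IsSmoothOpen W ∧ x ∈ W ∧
    (∀ y ∈ W, proj (σ y) = y) ∧ IsSmoothMapOn W σ ∧
    (∀ p, proj p ∈ W → τ p • σ (proj p) = p) ∧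
    IsSmoothFunOn (proj ⁻¹' W) (fun p => (τ p : ℂ))

attribute [instance] TBundle.smoothTot TBundle.act

/-- `√-1 θ` is a connection on the principal `𝕋`-bundle `P`: it is `𝕋`-invariant and restricts to
the Maurer–Cartan form on the orbits, that is, its pull-back under the action `𝕋 × P → P` is the sum
of `z⁻¹ dz` and `√-1 θ`. -/
def TBundle.IsConnection {X : Type u} [SmoothSpace X] (P : TBundle X)
    (θ : SmoothForm 1 P.Tot ℝ) : Prop :=
  ∀ (E : LCS.{u}) (U : Set E) (c : E → P.Tot) (z : E → Circle), IsPlot U c →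
    IsCircleSmoothOn U z → ∀ x ∈ U, ∀ w : E,
      θ.at U (fun y => z y • c y) x ![w] = θ.at U c x ![w] + dlog z x w

/-- The structure of a `G`-equivariant principal `𝕋`-bundle on `P`, where `G` acts on the base:
a lift of the action to `P` by bundle isomorphisms. -/
structure TBundle.IsEquivariant (G : Type u) [Group G] [SmoothSpace G] {X : Type u}
    [SmoothSpace X] [MulAction G X] (P : TBundle X) [MulAction G P.Tot] : Prop where
  smoothAction : IsSmoothAction G P.Tot
  proj_smul : ∀ (g : G) (p : P.Tot), P.proj (g • p) = g • P.proj p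
  smul_comm : ∀ (g : G) (z : Circle) (p : P.Tot), g • (z • p) = z • (g • p)

/-! ## Bundle gerbes -/

/-- The fibre product of two maps. -/
abbrev FibProd {Y Y' M : Type u} (π : Y → M) (π' : Y' → M) : Type u :=
  {y : Y × Y' // π y.1 = π' y.2}

/-- A bundle gerbe `(Y, P, s)` over `M`.

A section of the tensor product `P₁^{±1} ⊗ ⋯ ⊗ P_n^{±1}` of pulled back `𝕋`-bundles is given as a
circle valued function `ŝ` on tuples `(p₁, …, p_n)` of points in the corresponding fibres, with
`p₁^{±1} ⊗ ⋯ ⊗ p_n^{±1} = s · ŝ(p₁, …, p_n)`. Thus for `p₂₃`, `p₁₃`, `p₁₂` in the fibres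
of `P` over `(y₂, y₃)`, `(y₁, y₃)`, `(y₁, y₂)`, the section
`s` of `δP = π₁^*P ⊗ π₂^*P⁻¹ ⊗ π₃^*P` is given by `p₂₃ ⊗ p₁₃⁻¹ ⊗ p₁₂ = s · ŝ(p₂₃, p₁₃, p₁₂)`. Only the
values of `ŝ` on such triples matter. -/
structure BundleGerbe (M : Type u) [SmoothSpace M] : Type (u + 1) where
  Y : Type u
  [smoothY : SmoothSpace Y]
  manifoldY : IsLCManifold Y
  π : Y → M
  submersion : IsSurjSubmersion π
  P : TBundle (FibProd π π)
  s : P.Tot → P.Tot → P.Tot → Circle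
  s_smul : ∀ y₁ y₂ y₃ (p₂₃ p₁₃ p₁₂ : P.Tot), (P.proj p₂₃).1 = (y₂, y₃) →
    (P.proj p₁₃).1 = (y₁, y₃) → (P.proj p₁₂).1 = (y₁, y₂) → ∀ z₂₃ z₁₃ z₁₂ : Circle,
      s (z₂₃ • p₂₃) (z₁₃ • p₁₃) (z₁₂ • p₁₂) = z₂₃ * z₁₃⁻¹ * z₁₂ * s p₂₃ p₁₃ p₁₂
  s_smooth : ∀ (E : LCS.{u}) (U : Set E) (y₁ y₂ y₃ : E → Y) (p₂₃ p₁₃ p₁₂ : E → P.Tot),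
    IsPlot U p₂₃ → IsPlot U p₁₃ → IsPlot U p₁₂ →
    (∀ x ∈ U, (P.proj (p₂₃ x)).1 = (y₂ x, y₃ x)) →
    (∀ x ∈ U, (P.proj (p₁₃ x)).1 = (y₁ x, y₃ x)) →
    (∀ x ∈ U, (P.proj (p₁₂ x)).1 = (y₁ x, y₂ x)) →
    IsCircleSmoothOn U (fun x => s (p₂₃ x) (p₁₃ x) (p₁₂ x))
  /-- The condition `δs = 1`. -/
  δs_eq_one : ∀ y₁ y₂ y₃ y₄ (p₁₂ p₁₃ p₁₄ p₂₃ p₂₄ p₃₄ : P.Tot), (P.proj p₁₂).1 = (y₁, y₂) →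
    (P.proj p₁₃).1 = (y₁, y₃) → (P.proj p₁₄).1 = (y₁, y₄) → (P.proj p₂₃).1 = (y₂, y₃) →
    (P.proj p₂₄).1 = (y₂, y₄) → (P.proj p₃₄).1 = (y₃, y₄) →
      s p₃₄ p₂₄ p₂₃ * (s p₃₄ p₁₄ p₁₃)⁻¹ * s p₂₄ p₁₄ p₁₂ * (s p₂₃ p₁₃ p₁₂)⁻¹ = 1

attribute [instance] BundleGerbe.smoothY

namespace BundleGerbe

variable {M : Type u} [SmoothSpace M]

/-- The first component of the base point of `p ∈ P` in `Y^[2]`. -/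
def fst (𝒢 : BundleGerbe M) (p : 𝒢.P.Tot) : 𝒢.Y := (𝒢.P.proj p).1.1

/-- The second component of the base point of `p ∈ P` in `Y^[2]`. -/
def snd (𝒢 : BundleGerbe M) (p : 𝒢.P.Tot) : 𝒢.Y := (𝒢.P.proj p).1.2

/-- A connection `√-1 ∇` on the bundle gerbe together with a curving `√-1 f`. -/
structure ConnCurv (𝒢 : BundleGerbe M) : Type (u + 1) where
  nabla : SmoothForm 1 𝒢.P.Tot ℝ
  isConnection : 𝒢.P.IsConnection nabla
  /-- The condition `s^*(δ∇) = 0`. -/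
  s_parallel : ∀ (E : LCS.{u}) (U : Set E) (y₁ y₂ y₃ : E → 𝒢.Y) (p₂₃ p₁₃ p₁₂ : E → 𝒢.P.Tot),
    IsPlot U p₂₃ → IsPlot U p₁₃ → IsPlot U p₁₂ →
    (∀ x ∈ U, (𝒢.P.proj (p₂₃ x)).1 = (y₂ x, y₃ x)) →
    (∀ x ∈ U, (𝒢.P.proj (p₁₃ x)).1 = (y₁ x, y₃ x)) →
    (∀ x ∈ U, (𝒢.P.proj (p₁₂ x)).1 = (y₁ x, y₂ x)) → ∀ x ∈ U, ∀ w : E,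
      nabla.at U p₂₃ x ![w] - nabla.at U p₁₃ x ![w] + nabla.at U p₁₂ x ![w] =
        dlog (fun y => 𝒢.s (p₂₃ y) (p₁₃ y) (p₁₂ y)) x w
  curv : SmoothForm 2 𝒢.Y ℝ
  /-- The condition `δf = F(∇)`. -/
  δcurv : ∀ (E : LCS.{u}) (U : Set E) (p : E → 𝒢.P.Tot), IsPlot U p → ∀ x ∈ U,
    ∀ w : Fin 2 → E, curv.at U (𝒢.snd ∘ p) x w - curv.at U (𝒢.fst ∘ p) x w =
      extD (nabla.at U p) x w

/-- A stable isomorphism from `(𝒢, ∇, f)` to `(𝒢', ∇', f')`: a pseudo `𝕋`-bundle `(R, v)` with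
connection `√-1 η` for `(𝒢, ∇, f)⁻¹ ⊗ (𝒢', ∇', f')` such that `F(η) = f' - f`.

For `r₁`, `r₂` in the fibres of `R` over points `(y₁, y₁')`, `(y₂, y₂')` of `Y ×_M Y'` lying over the
same point of `M`, and `p`, `p'` in the fibres of `P`, `P'` over `(y₁, y₂)`, `(y₁', y₂')`, the
section `v` of `δR⁻¹ ⊗ (P⁻¹ ⊗ P')` is given by
`r₂⁻¹ ⊗ r₁ ⊗ p⁻¹ ⊗ p' = v · v̂(r₁, r₂, p, p')`. -/
structure StableIso {𝒢 𝒢' : BundleGerbe M} (𝒟 : 𝒢.ConnCurv) (𝒟' : 𝒢'.ConnCurv) :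
    Type (u + 1) where
  R : TBundle (FibProd 𝒢.π 𝒢'.π)
  v : R.Tot → R.Tot → 𝒢.P.Tot → 𝒢'.P.Tot → Circle
  v_smul : ∀ y₁ y₂ y₁' y₂' (r₁ r₂ : R.Tot) (p : 𝒢.P.Tot) (p' : 𝒢'.P.Tot),
    (R.proj r₁).1 = (y₁, y₁') → (R.proj r₂).1 = (y₂, y₂') →
    (𝒢.P.proj p).1 = (y₁, y₂) → (𝒢'.P.proj p').1 = (y₁', y₂') → ∀ a₁ a₂ b b' : Circle,
      v (a₁ • r₁) (a₂ • r₂) (b • p) (b' • p') = a₂⁻¹ * a₁ * b⁻¹ * b' * v r₁ r₂ p p'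
  v_smooth : ∀ (E : LCS.{u}) (U : Set E) (y₁ y₂ : E → 𝒢.Y) (y₁' y₂' : E → 𝒢'.Y)
    (r₁ r₂ : E → R.Tot) (p : E → 𝒢.P.Tot) (p' : E → 𝒢'.P.Tot),
    IsPlot U r₁ → IsPlot U r₂ → IsPlot U p → IsPlot U p' →
    (∀ x ∈ U, (R.proj (r₁ x)).1 = (y₁ x, y₁' x)) → (∀ x ∈ U, (R.proj (r₂ x)).1 = (y₂ x, y₂' x)) →
    (∀ x ∈ U, (𝒢.P.proj (p x)).1 = (y₁ x, y₂ x)) →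
    (∀ x ∈ U, (𝒢'.P.proj (p' x)).1 = (y₁' x, y₂' x)) →
    IsCircleSmoothOn U (fun x => v (r₁ x) (r₂ x) (p x) (p' x))
  /-- The condition `δv = s⁻¹ ⊗ s'`. -/
  δv_eq : ∀ y₁ y₂ y₃ y₁' y₂' y₃' (r₁ r₂ r₃ : R.Tot) (p₂₃ p₁₃ p₁₂ : 𝒢.P.Tot)
    (p₂₃' p₁₃' p₁₂' : 𝒢'.P.Tot),
    (R.proj r₁).1 = (y₁, y₁') → (R.proj r₂).1 = (y₂, y₂') → (R.proj r₃).1 = (y₃, y₃') →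
    (𝒢.P.proj p₂₃).1 = (y₂, y₃) → (𝒢.P.proj p₁₃).1 = (y₁, y₃) → (𝒢.P.proj p₁₂).1 = (y₁, y₂) →
    (𝒢'.P.proj p₂₃').1 = (y₂', y₃') → (𝒢'.P.proj p₁₃').1 = (y₁', y₃') →
    (𝒢'.P.proj p₁₂').1 = (y₁', y₂') →
      v r₂ r₃ p₂₃ p₂₃' * (v r₁ r₃ p₁₃ p₁₃')⁻¹ * v r₁ r₂ p₁₂ p₁₂' =
        (𝒢.s p₂₃ p₁₃ p₁₂)⁻¹ * 𝒢'.s p₂₃' p₁₃' p₁₂'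
  η : SmoothForm 1 R.Tot ℝ
  isConnection : R.IsConnection η
  /-- The condition `v^*(δη⁻¹ ⊗ ∇⁻¹ ⊗ ∇') = 0`. -/
  v_parallel : ∀ (E : LCS.{u}) (U : Set E) (y₁ y₂ : E → 𝒢.Y) (y₁' y₂' : E → 𝒢'.Y)
    (r₁ r₂ : E → R.Tot) (p : E → 𝒢.P.Tot) (p' : E → 𝒢'.P.Tot),
    IsPlot U r₁ → IsPlot U r₂ → IsPlot U p → IsPlot U p' →
    (∀ x ∈ U, (R.proj (r₁ x)).1 = (y₁ x, y₁' x)) → (∀ x ∈ U, (R.proj (r₂ x)).1 = (y₂ x, y₂' x)) →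
    (∀ x ∈ U, (𝒢.P.proj (p x)).1 = (y₁ x, y₂ x)) →
    (∀ x ∈ U, (𝒢'.P.proj (p' x)).1 = (y₁' x, y₂' x)) → ∀ x ∈ U, ∀ w : E,
      - η.at U r₂ x ![w] + η.at U r₁ x ![w] - 𝒟.nabla.at U p x ![w] + 𝒟'.nabla.at U p' x ![w] =
        dlog (fun y => v (r₁ y) (r₂ y) (p y) (p' y)) x w
  /-- The condition `F(η) = f' - f`. -/
  curvature : ∀ (E : LCS.{u}) (U : Set E) (r : E → R.Tot), IsPlot U r → ∀ x ∈ U,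
    ∀ w : Fin 2 → E, extD (η.at U r) x w =
      𝒟'.curv.at U (fun y => (R.proj (r y)).1.2) x w - 𝒟.curv.at U (fun y => (R.proj (r y)).1.1) x w

/-! ### Strongly equivariant bundle gerbes -/

variable (G : Type u) [Group G] [SmoothSpace G] [MulAction G M]

/-- The structure of a strongly `G`-equivariant bundle gerbe on `𝒢`. -/
class StronglyEquivariant (𝒢 : BundleGerbe M) where
  [actY : MulAction G 𝒢.Y]
  [actP : MulAction G 𝒢.P.Tot]
  smoothY : IsSmoothAction G 𝒢.Y
  π_smul : ∀ (g : G) (y : 𝒢.Y), 𝒢.π (g • y) = g • 𝒢.π y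
  smoothP : IsSmoothAction G 𝒢.P.Tot
  proj_smul : ∀ (g : G) (p : 𝒢.P.Tot), 𝒢.fst (g • p) = g • 𝒢.fst p ∧ 𝒢.snd (g • p) = g • 𝒢.snd p
  smul_comm : ∀ (g : G) (z : Circle) (p : 𝒢.P.Tot), g • (z • p) = z • (g • p)
  s_invariant : ∀ (g : G) (y₁ y₂ y₃ : 𝒢.Y) (p₂₃ p₁₃ p₁₂ : 𝒢.P.Tot),
    (𝒢.P.proj p₂₃).1 = (y₂, y₃) → (𝒢.P.proj p₁₃).1 = (y₁, y₃) → (𝒢.P.proj p₁₂).1 = (y₁, y₂) →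
      𝒢.s (g • p₂₃) (g • p₁₃) (g • p₁₂) = 𝒢.s p₂₃ p₁₃ p₁₂

attribute [reducible, instance] StronglyEquivariant.actY StronglyEquivariant.actP

/-- The connection and the curving are `G`-invariant. -/
def ConnCurv.IsInvariant {𝒢 : BundleGerbe M} [StronglyEquivariant G 𝒢] (𝒟 : 𝒢.ConnCurv) : Prop :=
  𝒟.nabla.IsInvariant G ∧ 𝒟.curv.IsInvariant G

variable {G}

/-- An admissible choice for the reduction: a smooth map `√-1 lam : Y → Hom(𝔤, √-1 ℝ)` such that
`δ lam` is the moment of `(P, ∇)` and such that `(E, ζ) = 0`, where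
`2π ⟨X | π^*E⟩ = ⟨X | d lam⟩ + ι_{X^*} f` and
`2π ⟨X | π^*ζ(g)⟩ = ⟨X | g^*lam - Ad_g lam⟩`, with
`⟨X | Ad_g lam⟩ = ⟨Ad_{g⁻¹} X | lam⟩`. -/
structure IsAdmissible (L : LieAlg G) {𝒢 : BundleGerbe M} [StronglyEquivariant G 𝒢]
    (𝒟 : 𝒢.ConnCurv) (lam : 𝒢.Y → (L.𝔤 →ₗ[ℝ] ℝ)) : Prop where
  smooth : ∀ (E : LCS.{u}) (U : Set E) (c : E → 𝒢.Y), IsPlot U c →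
    IsSmoothOn (U ×ˢ (univ : Set L.𝔤)) (fun p => lam (c p.1) p.2)
  δlam : ∀ (p : 𝒢.P.Tot) (X : L.𝔤),
    lam (𝒢.snd p) X - lam (𝒢.fst p) X = 𝒟.nabla.moment L p X
  E_eq_zero : ∀ (E : LCS.{u}) (U : Set E) (c : E → 𝒢.Y), IsPlot U c → ∀ x ∈ U, ∀ (w : E) (X : L.𝔤),
    dirDeriv (fun y => lam (c y) X) x w + 𝒟.curv.contract L X U c x w = 0
  ζ_eq_zero : ∀ (g : G) (y : 𝒢.Y) (X : L.𝔤), lam (g • y) X - lam y (L.Ad g⁻¹ X) = 0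

/-- The 1-form `κ = ⟨π^*Ξ | lam⟩` on `Y`, pulled back along a plot `c` of `Y`. -/
def kappa (L : LieAlg G) (𝒢 : BundleGerbe M) (Ξ : SmoothForm 1 M L.𝔤)
    (lam : 𝒢.Y → (L.𝔤 →ₗ[ℝ] ℝ)) {E : LCS.{u}} (U : Set E) (c : E → 𝒢.Y) (x : E)
    (w : Fin 1 → E) : ℝ :=
  lam (c x) (Ξ.at U (𝒢.π ∘ c) x w)

variable (G)

/-- The bundle gerbe `𝒢' = (Y/G, P/G, s')` over `M' = M/G` is the quotient of the strongly
equivariant bundle gerbe `𝒢 = (Y, P, s)`, with quotient maps `q`, `qY`, `qP`. The action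
on `Y` is free and locally trivial, `P/G` is the orbit space of `P`, and the projections, the
`𝕋`-action and the section of `𝒢'` are induced from those of `𝒢`. -/
structure IsQuotient {M' : Type u} [SmoothSpace M'] (q : M → M') (𝒢 : BundleGerbe M)
    [StronglyEquivariant G 𝒢] (𝒢' : BundleGerbe M') (qY : 𝒢.Y → 𝒢'.Y)
    (qP : 𝒢.P.Tot → 𝒢'.P.Tot) : Prop where
  quotY : IsPrincipalQuotient G qY
  π_qY : ∀ y, 𝒢'.π (qY y) = q (𝒢.π y)
  quotP : IsOrbitSpace G qP
  proj_qP : ∀ p, (𝒢'.P.proj (qP p)).1 = (qY (𝒢.fst p), qY (𝒢.snd p))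
  qP_smul : ∀ (z : Circle) (p : 𝒢.P.Tot), qP (z • p) = z • qP p
  s_qP : ∀ y₁ y₂ y₃ (p₂₃ p₁₃ p₁₂ : 𝒢.P.Tot), (𝒢.P.proj p₂₃).1 = (y₂, y₃) →
    (𝒢.P.proj p₁₃).1 = (y₁, y₃) → (𝒢.P.proj p₁₂).1 = (y₁, y₂) →
      𝒢'.s (qP p₂₃) (qP p₁₃) (qP p₁₂) = 𝒢.s p₂₃ p₁₃ p₁₂

variable {G}

/-- `(𝒢', ∇', f')` is the reduction of `(𝒢, ∇, f)` with respect to `lam`: the connection `∇'` and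
the curving `f'` on the quotient `𝒢'` are those to which `∇ - δκ` and `f - dκ` descend. -/
structure IsReduction (L : LieAlg G) {M' : Type u} [SmoothSpace M'] {𝒢 : BundleGerbe M}
    {𝒢' : BundleGerbe M'} (qY : 𝒢.Y → 𝒢'.Y) (qP : 𝒢.P.Tot → 𝒢'.P.Tot)
    (Ξ : SmoothForm 1 M L.𝔤) (𝒟 : 𝒢.ConnCurv) (lam : 𝒢.Y → (L.𝔤 →ₗ[ℝ] ℝ))
    (𝒟' : 𝒢'.ConnCurv) : Prop where
  nabla_eq : ∀ (E : LCS.{u}) (U : Set E) (p : E → 𝒢.P.Tot), IsPlot U p → ∀ x ∈ U,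
    ∀ w : Fin 1 → E, 𝒟'.nabla.at U (qP ∘ p) x w =
      𝒟.nabla.at U p x w -
        (kappa L 𝒢 Ξ lam U (𝒢.snd ∘ p) x w - kappa L 𝒢 Ξ lam U (𝒢.fst ∘ p) x w)
  curv_eq : ∀ (E : LCS.{u}) (U : Set E) (c : E → 𝒢.Y), IsPlot U c → ∀ x ∈ U,
    ∀ w : Fin 2 → E, 𝒟'.curv.at U (qY ∘ c) x w =
      𝒟.curv.at U c x w - extD (kappa L 𝒢 Ξ lam U c) x w

end BundleGerbe

/-- A `G`-equivariant flat principal `𝕋`-bundle over `M`: an equivariant principal `𝕋`-bundle with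
a `G`-invariant connection `√-1 η` of vanishing curvature. -/
structure EquivariantFlatTBundle (G : Type u) [Group G] [SmoothSpace G] (M : Type u)
    [SmoothSpace M] [MulAction G M] : Type (u + 1) where
  R : TBundle M
  [actR : MulAction G R.Tot]
  equivariant : R.IsEquivariant G
  η : SmoothForm 1 R.Tot ℝ
  isConnection : R.IsConnection η
  invariant : η.IsInvariant G
  flat : ∀ (E : LCS.{u}) (U : Set E) (c : E → R.Tot), IsPlot U c → ∀ x ∈ U,
    ∀ w : Fin 2 → E, extD (η.at U c) x w = 0

attribute [instance] EquivariantFlatTBundle.actR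

/-- The moment of an equivariant flat `𝕋`-bundle over `M` is the function `μ` on `M`. -/
def EquivariantFlatTBundle.IsMoment {G : Type u} [Group G] [SmoothSpace G] (L : LieAlg G)
    {M : Type u} [SmoothSpace M] [MulAction G M] (𝓡 : EquivariantFlatTBundle G M)
    (μ : M → (L.𝔤 →ₗ[ℝ] ℝ)) : Prop :=
  ∀ (r : 𝓡.R.Tot) (X : L.𝔤), μ (𝓡.R.proj r) X = 𝓡.η.moment L r X

-- Since δλ = δλ' is the moment of `(P, ∇)`, the difference λ' − λ is constant along the fibres of
-- π, hence of the form π^*μ (`exists_moment`). Both maps have derivative −ι_{X^*} f, so μ is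
-- locally constant (`exists_nhds_sub_eq`); the equivariance of λ and λ' passes to μ. Therefore β =
-- ⟨Ξ|μ⟩ is a G-invariant 1-form on M with moment μ, and κ' − κ = π^*β. Because δπ^* = 0, the
-- reduced connections coincide (`nabla_unique`), and the reduced curvings differ by −dβ once
-- everything is pulled back over M (`curv_sub`). The question becomes whether a 𝕋-bundle on M/G
-- with curvature f̄' − f̄ exists; pulling it back to M and adding β to the connection turns it into
-- a flat equivariant bundle with moment μ.
--
-- Given a stable isomorphism (R, v, η), restrict R to the diagonal of Y/G. There v is evaluated on
-- P⁻¹ ⊗ P, which is canonically trivial, and δv = s⁻¹ ⊗ s = 1, so v is a descent datum. It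
-- preserves η because the two connections on P/G agree. The bundle descends to M/G with curvature
-- f̄' − f̄; on its pull-back to M the connection η + β is flat, and its moment is that of β, since
-- G moves only the factor M (`exists_equivariantFlatTBundle`).
--
-- Conversely, let (R, η) be flat and equivariant over M with moment μ. Then η − β is invariant and
-- has zero moment, so it descends to R/G, with curvature −dβ. Tensoring the identity stable
-- isomorphism of the quotient gerbe, namely P/G itself with a section built from s̄, with R/G gives
-- the required stable isomorphism (`nonempty_stableIso`).
--
-- Both bundles are constructed as quotients of explicit fibre products by a descent datum
-- (`IsDescentDatum`), and forms descend along maps through which plots lift locally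
-- (`exists_descend`). The group enters through the Leibniz formula for a 1-form along `g • c`
-- (`SmoothForm.at_smul`), whose group part is a moment.

universe w

/-! ## Directional derivatives -/

section DirDeriv

variable {E : Type*} [AddCommGroup E] [Module ℝ E]
  {F : Type*} [AddCommGroup F] [Module ℝ F] [TopologicalSpace F]

theorem HasDirDeriv.dirDeriv [T2Space F] {f : E → F} {x v : E} {w : F}
    (h : HasDirDeriv f x v w) : dirDeriv f x v = w :=
  Tendsto.limUnder_eq h

theorem eventually_add_smul_mem [TopologicalSpace E] [IsTopologicalAddGroup E]
    [ContinuousSMul ℝ E] {U : Set E} {x : E} (hU : U ∈ 𝓝 x) (v : E) :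
    ∀ᶠ t : ℝ in 𝓝[≠] 0, x + t • v ∈ U := by
  have : Tendsto (fun t : ℝ => x + t • v) (𝓝 0) (𝓝 (x + (0 : ℝ) • v)) :=
    Continuous.tendsto (by fun_prop) 0
  rw [zero_smul, add_zero] at this
  exact (this.mono_left nhdsWithin_le_nhds) hU

theorem eventually_diffQuot_eq {F : Type*} [AddCommGroup F] [Module ℝ F] [TopologicalSpace E] [IsTopologicalAddGroup E]
    [ContinuousSMul ℝ E] {U : Set E} {f g : E → F} {x : E} (hU : U ∈ 𝓝 x) (h : EqOn f g U)
    (v : E) : (fun t : ℝ => t⁻¹ • (f (x + t • v) - f x)) =ᶠ[𝓝[≠] 0]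
      fun t : ℝ => t⁻¹ • (g (x + t • v) - g x) := by
  filter_upwards [eventually_add_smul_mem hU v] with t ht
  rw [h ht, h (mem_of_mem_nhds hU)]

theorem dirDeriv_congr [TopologicalSpace E] [IsTopologicalAddGroup E]
    [ContinuousSMul ℝ E] {U : Set E} {f g : E → F} {x : E} (hU : U ∈ 𝓝 x) (h : EqOn f g U)
    (v : E) : dirDeriv f x v = dirDeriv g x v := by
  unfold dirDeriv limUnder
  rw [Filter.map_congr (eventually_diffQuot_eq hU h v)]

theorem HasDirDeriv.congr [TopologicalSpace E] [IsTopologicalAddGroup E]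
    [ContinuousSMul ℝ E] {U : Set E} {f g : E → F} {x v : E} {w : F} (hf : HasDirDeriv f x v w)
    (hU : U ∈ 𝓝 x) (h : EqOn f g U) : HasDirDeriv g x v w :=
  Tendsto.congr' (eventually_diffQuot_eq hU h v) hf

theorem hasDirDeriv_const (a : F) (x v : E) : HasDirDeriv (fun _ => a) x v 0 := by
  simpa [HasDirDeriv] using tendsto_const_nhds

/-- The restriction of `f` to a line through `x` is differentiable at `x`. -/
theorem HasDirDeriv.tendsto [TopologicalSpace E] [IsTopologicalAddGroup F] [ContinuousSMul ℝ F]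
    {f : E → F} {x v : E} {w : F} (h : HasDirDeriv f x v w) :
    Tendsto (fun t : ℝ => f (x + t • v)) (𝓝[≠] 0) (𝓝 (f x)) := by
  have h1 : Tendsto (fun t : ℝ => t • (t⁻¹ • (f (x + t • v) - f x)) + f x) (𝓝[≠] 0)
      (𝓝 ((0 : ℝ) • w + f x)) :=
    ((tendsto_id.mono_left nhdsWithin_le_nhds).smul h).add_const _
  rw [zero_smul, zero_add] at h1
  refine h1.congr' ?_
  filter_upwards [self_mem_nhdsWithin] with t ht
  rw [smul_inv_smul₀ ht, sub_add_cancel]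

/-- An affine substitution carries difference quotients to difference quotients exactly, so no
remainder has to be estimated. For general smooth substitutions the axioms of plots and forms supply
what is needed. -/
theorem HasDirDeriv.comp_affine {E' : Type*} [AddCommGroup E'] [Module ℝ E'] {f : E → F}
    (ℓ : E' →ₗ[ℝ] E) (b : E) {x v : E'} {w : F} (h : HasDirDeriv f (ℓ x + b) (ℓ v) w) :
    HasDirDeriv (fun y => f (ℓ y + b)) x v w := by
  unfold HasDirDeriv at *
  simpa only [map_add, map_smul, add_right_comm] using h

theorem dirDeriv_comp_affine {E' : Type*} [AddCommGroup E'] [Module ℝ E'] (f : E → F)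
    (ℓ : E' →ₗ[ℝ] E) (b : E) (x v : E') :
    dirDeriv (fun y => f (ℓ y + b)) x v = dirDeriv f (ℓ x + b) (ℓ v) := by
  unfold dirDeriv
  simp only [map_add, map_smul, add_right_comm]

theorem HasDirDeriv.clm_comp {F' : Type*} [AddCommGroup F'] [Module ℝ F'] [TopologicalSpace F']
    {f : E → F} {x v : E} {w : F} (h : HasDirDeriv f x v w) (ℓ : F →L[ℝ] F') :
    HasDirDeriv (fun y => ℓ (f y)) x v (ℓ w) := by
  have := (ℓ.continuous.tendsto w).comp h
  simpa only [HasDirDeriv, Function.comp_def, map_smul, map_sub] using this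

theorem HasDirDeriv.prodMk {F' : Type*} [AddCommGroup F'] [Module ℝ F'] [TopologicalSpace F']
    {f : E → F} {g : E → F'} {x v : E} {w : F} {w' : F'} (hf : HasDirDeriv f x v w)
    (hg : HasDirDeriv g x v w') : HasDirDeriv (fun y => (f y, g y)) x v (w, w') := by
  simpa only [HasDirDeriv, nhds_prod_eq, Prod.mk_sub_mk, Prod.smul_mk] using Tendsto.prodMk hf hg

theorem HasDirDeriv.add [ContinuousAdd F] {f g : E → F} {x v : E} {w w' : F}
    (hf : HasDirDeriv f x v w) (hg : HasDirDeriv g x v w') :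
    HasDirDeriv (fun y => f y + g y) x v (w + w') := by
  refine (Tendsto.add hf hg).congr fun t => ?_
  rw [← smul_add, add_sub_add_comm]

theorem HasDirDeriv.sub [IsTopologicalAddGroup F] {f g : E → F} {x v : E} {w w' : F}
    (hf : HasDirDeriv f x v w) (hg : HasDirDeriv g x v w') :
    HasDirDeriv (fun y => f y - g y) x v (w - w') := by
  refine (Tendsto.sub hf hg).congr fun t => ?_
  rw [← smul_sub, sub_sub_sub_comm]

theorem HasDirDeriv.mul [TopologicalSpace E] {f g : E → ℂ} {x v : E} {w w' : ℂ}
    (hf : HasDirDeriv f x v w) (hg : HasDirDeriv g x v w') :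
    HasDirDeriv (fun y => f y * g y) x v (f x * w' + w * g x) := by
  -- Leibniz splitting f(x + tv)·Δg + Δf·g(x): only continuity of `f` along the line is needed.
  refine ((hf.tendsto.mul hg).add (Tendsto.mul hf (tendsto_const_nhds (x := g x)))).congr
    fun t => ?_
  simp only [Complex.real_smul]
  ring

theorem dlog_const (a : Circle) (x v : E) : dlog (fun _ => a) x v = 0 := by
  unfold dlog
  rw [(hasDirDeriv_const (a : ℂ) x v).dirDeriv]
  simp

end DirDeriv

/-! ## Maps of class `C^n` -/

section CnOn

variable {F : Type v} [AddCommGroup F] [Module ℝ F] [TopologicalSpace F]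

/-- The space `E` is quantified after `n` here and in the inductions below, because the inductive
step passes from `E` to `E × E`. -/
theorem CnOn.mono {n : ℕ} : ∀ {E : Type u} [AddCommGroup E] [Module ℝ E] [TopologicalSpace E]
    {U V : Set E} {f : E → F}, CnOn F n E U f → V ⊆ U → CnOn F n E V f := by
  induction n with
  | zero => intro E _ _ _ U V f h hV; exact ContinuousOn.mono h hV
  | succ n ih =>
    intro E _ _ _ U V f h hV
    exact ⟨h.1.mono hV, fun x hx => h.2.1 x (hV hx), ih h.2.2 (prod_mono hV Subset.rfl)⟩

theorem CnOn.continuousOn {n : ℕ} {E : Type u} [AddCommGroup E] [Module ℝ E] [TopologicalSpace E]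
    {U : Set E} {f : E → F} (h : CnOn F n E U f) : ContinuousOn f U := by
  cases n with
  | zero => exact h
  | succ n => exact h.1

theorem CnOn.of_succ {n : ℕ} : ∀ {E : Type u} [AddCommGroup E] [Module ℝ E] [TopologicalSpace E]
    {U : Set E} {f : E → F}, CnOn F (n + 1) E U f → CnOn F n E U f := by
  induction n with
  | zero => intro E _ _ _ U f h; exact h.1
  | succ n ih => intro E _ _ _ U f h; exact ⟨h.1, h.2.1, ih h.2.2⟩

theorem CnOn.congr {n : ℕ} : ∀ {E : Type u} [AddCommGroup E] [Module ℝ E] [TopologicalSpace E]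
    [IsTopologicalAddGroup E] [ContinuousSMul ℝ E] {U : Set E} {f g : E → F}, CnOn F n E U f →
    IsOpen U → EqOn f g U → CnOn F n E U g := by
  induction n with
  | zero => intro E _ _ _ _ _ U f g h _ hfg; exact ContinuousOn.congr h hfg.symm
  | succ n ih =>
    intro E _ _ _ _ _ U f g h hU hfg
    refine ⟨h.1.congr hfg.symm, fun x hx v => ?_, ih h.2.2 (hU.prod isOpen_univ) ?_⟩
    · obtain ⟨w, hw⟩ := h.2.1 x hx v
      exact ⟨w, hw.congr (hU.mem_nhds hx) hfg⟩
    · intro p hp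
      exact dirDeriv_congr (hU.mem_nhds hp.1) hfg _

/-- The function `dirDeriv f` does not refer to the open set, so the local hypotheses concern the
same derivative as the conclusion and the induction hypothesis applies directly. -/
theorem CnOn.of_local {n : ℕ} : ∀ {E : Type u} [AddCommGroup E] [Module ℝ E] [TopologicalSpace E]
    {U : Set E} {f : E → F}, (∀ x ∈ U, ∃ V, IsOpen V ∧ x ∈ V ∧ CnOn F n E V f) →
    CnOn F n E U f := by
  induction n with
  | zero =>
    intro E _ _ _ U f h x hx
    obtain ⟨V, hV, hxV, hf⟩ := h x hx
    exact (ContinuousOn.continuousAt hf (hV.mem_nhds hxV)).continuousWithinAt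
  | succ n ih =>
    intro E _ _ _ U f h
    refine ⟨fun x hx => ?_, fun x hx v => ?_, ih fun p hp => ?_⟩
    · obtain ⟨V, hV, hxV, hf⟩ := h x hx
      exact (hf.1.continuousAt (hV.mem_nhds hxV)).continuousWithinAt
    · obtain ⟨V, hV, hxV, hf⟩ := h x hx
      exact hf.2.1 x hxV v
    · obtain ⟨V, hV, hxV, hf⟩ := h p.1 hp.1
      exact ⟨V ×ˢ univ, hV.prod isOpen_univ, ⟨hxV, trivial⟩, hf.2.2⟩

/-- The derivative of f ∘ (ℓ + b) is df precomposed with the affine map ℓ × ℓ + (b, 0), so the class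
of such compositions is closed under differentiation. -/
theorem CnOn.comp_affine {n : ℕ} : ∀ {E E' : Type u} [AddCommGroup E] [Module ℝ E]
    [TopologicalSpace E] [AddCommGroup E'] [Module ℝ E'] [TopologicalSpace E'] [ContinuousAdd E]
    {U : Set E} {V : Set E'} {f : E → F} (_ : CnOn F n E U f) (ℓ : E' →L[ℝ] E) (b : E)
    (_ : MapsTo (fun y => ℓ y + b) V U), CnOn F n E' V (fun y => f (ℓ y + b)) := by
  induction n with
  | zero =>
    intro E E' _ _ _ _ _ _ _ U V f h ℓ b hm
    exact ContinuousOn.comp h (by fun_prop) hm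
  | succ n ih =>
    intro E E' _ _ _ _ _ _ _ U V f h ℓ b hm
    refine ⟨h.1.comp (by fun_prop) hm, fun x hx v => ?_, ?_⟩
    · obtain ⟨w, hw⟩ := h.2.1 _ (hm hx) (ℓ v)
      exact ⟨w, hw.comp_affine (ℓ : E' →ₗ[ℝ] E) b⟩
    · have := ih h.2.2 (ℓ.prodMap ℓ) (b, 0) (V := V ×ˢ univ) fun p hp => ⟨hm hp.1, trivial⟩
      convert this using 2 with p
      have := dirDeriv_comp_affine f (ℓ : E' →ₗ[ℝ] E) b p.1 p.2
      simpa using this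

theorem CnOn.clm_comp [T2Space F] {F' : Type w} [AddCommGroup F'] [Module ℝ F']
    [TopologicalSpace F'] [T2Space F'] (ℓ : F →L[ℝ] F') {n : ℕ} :
    ∀ {E : Type u} [AddCommGroup E] [Module ℝ E] [TopologicalSpace E]
    [IsTopologicalAddGroup E] [ContinuousSMul ℝ E] {U : Set E} {f : E → F} (_ : IsOpen U),
    CnOn F n E U f → CnOn F' n E U (fun y => ℓ (f y)) := by
  induction n with
  | zero => intro E _ _ _ _ _ U f hU h; exact ℓ.continuous.comp_continuousOn h
  | succ n ih =>
    intro E _ _ _ _ _ U f hU h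
    refine ⟨ℓ.continuous.comp_continuousOn h.1, fun x hx v => ?_,
      (ih (hU.prod isOpen_univ) h.2.2).congr (hU.prod isOpen_univ) fun p hp => ?_⟩
    · obtain ⟨w, hw⟩ := h.2.1 x hx v
      exact ⟨_, hw.clm_comp ℓ⟩
    · obtain ⟨w, hw⟩ := h.2.1 p.1 hp.1 p.2
      simp only [hw.dirDeriv, (hw.clm_comp ℓ).dirDeriv]

theorem CnOn.prodMk [T2Space F] {F' : Type v} [AddCommGroup F'] [Module ℝ F']
    [TopologicalSpace F'] [T2Space F'] {n : ℕ} :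
    ∀ {E : Type u} [AddCommGroup E] [Module ℝ E] [TopologicalSpace E]
    [IsTopologicalAddGroup E] [ContinuousSMul ℝ E] {U : Set E} {f : E → F} {g : E → F'}
    (_ : IsOpen U), CnOn F n E U f → CnOn F' n E U g →
      CnOn (F × F') n E U (fun y => (f y, g y)) := by
  induction n with
  | zero => intro E _ _ _ _ _ U f g hU h h'; exact ContinuousOn.prodMk h h'
  | succ n ih =>
    intro E _ _ _ _ _ U f g hU h h'
    refine ⟨h.1.prodMk h'.1, fun x hx v => ?_,
      (ih (hU.prod isOpen_univ) h.2.2 h'.2.2).congr (hU.prod isOpen_univ) fun p hp => ?_⟩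
    · obtain ⟨w, hw⟩ := h.2.1 x hx v
      obtain ⟨w', hw'⟩ := h'.2.1 x hx v
      exact ⟨_, hw.prodMk hw'⟩
    · obtain ⟨w, hw⟩ := h.2.1 p.1 hp.1 p.2
      obtain ⟨w', hw'⟩ := h'.2.1 p.1 hp.1 p.2
      simp only [hw.dirDeriv, hw'.dirDeriv, (hw.prodMk hw').dirDeriv]

theorem CnOn.add [T2Space F] [ContinuousAdd F] {n : ℕ}
    {E : Type u} [AddCommGroup E] [Module ℝ E] [TopologicalSpace E]
    [IsTopologicalAddGroup E] [ContinuousSMul ℝ E] {U : Set E} {f g : E → F}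
    (hU : IsOpen U) (hf : CnOn F n E U f) (hg : CnOn F n E U g) :
    CnOn F n E U (fun y => f y + g y) :=
  (hf.prodMk hU hg).clm_comp (ContinuousLinearMap.fst ℝ F F + ContinuousLinearMap.snd ℝ F F) hU

theorem CnOn.mul {n : ℕ} :
    ∀ {E : Type u} [AddCommGroup E] [Module ℝ E] [TopologicalSpace E]
    [IsTopologicalAddGroup E] [ContinuousSMul ℝ E] {U : Set E} {f g : E → ℂ}
    (_ : IsOpen U), CnOn ℂ n E U f → CnOn ℂ n E U g → CnOn ℂ n E U (fun y => f y * g y) := by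
  induction n with
  | zero => intro E _ _ _ _ _ U f g hU h h'; exact ContinuousOn.mul h h'
  | succ n ih =>
    intro E _ _ _ _ _ U f g hU h h'
    have hU' : IsOpen (U ×ˢ (univ : Set E)) := hU.prod isOpen_univ
    -- The undifferentiated factor in the product rule, read on `E × E` through the first
    -- projection; one order of differentiability is given up.
    have key : ∀ {k : E → ℂ}, CnOn ℂ (n + 1) E U k →
        CnOn ℂ n (E × E) (U ×ˢ univ) (fun p => k p.1) := fun {k} hk => by
      simpa using hk.of_succ.comp_affine (ContinuousLinearMap.fst ℝ E E) 0
        (V := U ×ˢ univ) (fun p hp => by simpa using hp.1)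
    refine ⟨h.1.mul h'.1, fun x hx v => ?_,
      ((ih hU' (key h) h'.2.2).add hU' (ih hU' h.2.2 (key h'))).congr hU' fun p hp => ?_⟩
    · obtain ⟨w, hw⟩ := h.2.1 x hx v
      obtain ⟨w', hw'⟩ := h'.2.1 x hx v
      exact ⟨_, hw.mul hw'⟩
    · obtain ⟨w, hw⟩ := h.2.1 p.1 hp.1 p.2
      obtain ⟨w', hw'⟩ := h'.2.1 p.1 hp.1 p.2
      simp only [hw.dirDeriv, hw'.dirDeriv, (hw.mul hw').dirDeriv]

theorem hasDirDeriv_affine [IsTopologicalAddGroup F] {E : Type u} [AddCommGroup E] [Module ℝ E]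
    (ℓ : E →ₗ[ℝ] F) (b : F) (x v : E) :
    HasDirDeriv (fun y => ℓ y + b) x v (ℓ v) := by
  refine tendsto_const_nhds.congr' ?_
  filter_upwards [self_mem_nhdsWithin] with t ht
  rw [map_add, map_smul]
  have : ℓ x + t • ℓ v + b - (ℓ x + b) = t • ℓ v := by abel
  rw [this, inv_smul_smul₀ ht]

/-- The derivative is (x, v) ↦ ℓ v, again affine. -/
theorem cnOn_affine [IsTopologicalAddGroup F] [T2Space F] {n : ℕ} :
    ∀ {E : Type u} [AddCommGroup E] [Module ℝ E] [TopologicalSpace E] (U : Set E)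
    (ℓ : E →L[ℝ] F) (b : F), CnOn F n E U (fun y => ℓ y + b) := by
  induction n with
  | zero => intro E _ _ _ U ℓ b; exact Continuous.continuousOn (by fun_prop)
  | succ n ih =>
    intro E _ _ _ U ℓ b
    refine ⟨Continuous.continuousOn (by fun_prop), fun x hx v =>
      ⟨_, hasDirDeriv_affine (ℓ : E →ₗ[ℝ] F) b x v⟩, ?_⟩
    convert ih (U ×ˢ univ) (ℓ.comp (ContinuousLinearMap.snd ℝ E E)) 0 using 2 with p
    have := (hasDirDeriv_affine (ℓ : E →ₗ[ℝ] F) b p.1 p.2).dirDeriv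
    simpa using this

end CnOn

/-! ## Smooth maps -/

section IsSmoothOn

variable {E : Type u} [AddCommGroup E] [Module ℝ E] [TopologicalSpace E]
  {F : Type v} [AddCommGroup F] [Module ℝ F] [TopologicalSpace F]

theorem IsSmoothOn.continuousOn {U : Set E} {f : E → F} (h : IsSmoothOn U f) :
    ContinuousOn f U := (h 0).continuousOn

theorem IsSmoothOn.exists_hasDirDeriv {U : Set E} {f : E → F} (h : IsSmoothOn U f) {x : E}
    (hx : x ∈ U) (v : E) : ∃ w, HasDirDeriv f x v w := (h 1).2.1 x hx v

theorem IsSmoothOn.hasDirDeriv [T2Space F] {U : Set E} {f : E → F} (h : IsSmoothOn U f) {x : E}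
    (hx : x ∈ U) (v : E) : HasDirDeriv f x v (dirDeriv f x v) := by
  obtain ⟨w, hw⟩ := h.exists_hasDirDeriv hx v
  rwa [hw.dirDeriv]

theorem IsSmoothOn.mono {U V : Set E} {f : E → F} (h : IsSmoothOn U f) (hV : V ⊆ U) :
    IsSmoothOn V f := fun n => (h n).mono hV

theorem isSmoothOn_affine [IsTopologicalAddGroup F] [T2Space F] (U : Set E) (ℓ : E →L[ℝ] F)
    (b : F) : IsSmoothOn U (fun y => ℓ y + b) := fun _ => cnOn_affine U ℓ b

theorem isSmoothOn_clm [IsTopologicalAddGroup F] [T2Space F] (U : Set E) (ℓ : E →L[ℝ] F) :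
    IsSmoothOn U (fun y => ℓ y) := by
  simpa using isSmoothOn_affine U ℓ 0

theorem isSmoothOn_const [IsTopologicalAddGroup F] [T2Space F] (U : Set E)
    (b : F) : IsSmoothOn U (fun _ => b) := by
  simpa using isSmoothOn_affine U (0 : E →L[ℝ] F) b

theorem IsSmoothOn.comp_affine {E' : Type u} [AddCommGroup E'] [Module ℝ E'] [TopologicalSpace E']
    [ContinuousAdd E] {U : Set E} {V : Set E'} {f : E → F} (h : IsSmoothOn U f) (ℓ : E' →L[ℝ] E)
    (b : E) (hm : MapsTo (fun y => ℓ y + b) V U) : IsSmoothOn V (fun y => f (ℓ y + b)) :=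
  fun n => (h n).comp_affine ℓ b hm

theorem IsSmoothOn.of_local {U : Set E} {f : E → F}
    (h : ∀ x ∈ U, ∃ V, IsOpen V ∧ x ∈ V ∧ IsSmoothOn V f) : IsSmoothOn U f := fun n =>
  CnOn.of_local fun x hx => let ⟨V, h1, h2, h3⟩ := h x hx; ⟨V, h1, h2, h3 n⟩

theorem dlog_mul {U : Set E} {z z' : E → Circle} (h : IsCircleSmoothOn U z)
    (h' : IsCircleSmoothOn U z') {x : E} (hx : x ∈ U) (v : E) :
    dlog (fun y => z y * z' y) x v = dlog z x v + dlog z' x v := by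
  have h1 := (IsSmoothOn.hasDirDeriv h hx v).mul (IsSmoothOn.hasDirDeriv h' hx v)
  unfold dlog
  simp only [Circle.coe_mul]
  rw [h1.dirDeriv, ← Complex.add_im]
  congr 1
  have := (z x).coe_ne_zero
  have := (z' x).coe_ne_zero
  field_simp
  ring

variable [IsTopologicalAddGroup E] [ContinuousSMul ℝ E]

theorem IsSmoothOn.congr {U : Set E} {f g : E → F} (h : IsSmoothOn U f) (hU : IsOpen U)
    (hfg : EqOn f g U) : IsSmoothOn U g := fun n => (h n).congr hU hfg

theorem IsSmoothOn.clm_comp [T2Space F] {F' : Type w} [AddCommGroup F'] [Module ℝ F']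
    [TopologicalSpace F'] [T2Space F'] {U : Set E} {f : E → F} (h : IsSmoothOn U f)
    (hU : IsOpen U) (ℓ : F →L[ℝ] F') : IsSmoothOn U (fun y => ℓ (f y)) :=
  fun n => (h n).clm_comp ℓ hU

theorem IsSmoothOn.prodMk [T2Space F] {F' : Type v} [AddCommGroup F'] [Module ℝ F']
    [TopologicalSpace F'] [T2Space F'] {U : Set E} {f : E → F} {g : E → F'} (h : IsSmoothOn U f)
    (hU : IsOpen U) (h' : IsSmoothOn U g) : IsSmoothOn U (fun y => (f y, g y)) :=
  fun n => (h n).prodMk hU (h' n)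

theorem IsSmoothOn.add [T2Space F] [ContinuousAdd F] {U : Set E} {f g : E → F}
    (h : IsSmoothOn U f) (hU : IsOpen U) (h' : IsSmoothOn U g) :
    IsSmoothOn U (fun y => f y + g y) := fun n => (h n).add hU (h' n)

theorem IsCircleSmoothOn.mul {U : Set E} {z z' : E → Circle} (hU : IsOpen U)
    (h : IsCircleSmoothOn U z) (h' : IsCircleSmoothOn U z') :
    IsCircleSmoothOn U (fun y => z y * z' y) := fun n => by
  simpa using (h n).mul hU (h' n)

/-- On the unit circle inversion is conjugation, which is real linear; smoothness of inversion on
the nonzero complex numbers is not needed. -/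
theorem IsCircleSmoothOn.inv {U : Set E} {z : E → Circle} (hU : IsOpen U)
    (h : IsCircleSmoothOn U z) : IsCircleSmoothOn U (fun y => (z y)⁻¹) := by
  have := IsSmoothOn.clm_comp h hU (Complex.conjCLE : ℂ →L[ℝ] ℂ)
  refine this.congr hU fun y _ => ?_
  simp [-Circle.coe_inv, Circle.coe_inv_eq_conj]

theorem dlog_inv {U : Set E} {z : E → Circle} (hU : IsOpen U) (h : IsCircleSmoothOn U z) {x : E}
    (hx : x ∈ U) (v : E) : dlog (fun y => (z y)⁻¹) x v = - dlog z x v := by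
  have := dlog_mul h (h.inv hU) hx v
  simp only [mul_inv_cancel, dlog_const] at this
  linarith

theorem dlog_congr {U : Set E} {z z' : E → Circle} {x : E} (hU : U ∈ 𝓝 x) (h : EqOn z z' U)
    (v : E) : dlog z x v = dlog z' x v := by
  unfold dlog
  rw [dirDeriv_congr hU (fun y hy => by rw [h hy]), h (mem_of_mem_nhds hU)]

end IsSmoothOn

/-! ## Plots and smooth maps -/

section Plots

variable {X Y Z : Type u} [SmoothSpace X] [SmoothSpace Y] [SmoothSpace Z] {E : LCS.{u}}

theorem SmoothSpace.IsPlot.isOpen {U : Set E} {c : E → X} (h : IsPlot U c) : IsOpen U :=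
  SmoothSpace.isOpen_dom h

/-- Gluing over the one-member cover `U` shows that the values of the total function off `U` are
irrelevant. -/
theorem SmoothSpace.IsPlot.congr {U : Set E} {c c' : E → X} (h : IsPlot U c) (hc : EqOn c' c U) :
    IsPlot U c' :=
  SmoothSpace.glue h.isOpen fun _ hx => ⟨U, c, hx, Subset.rfl, h, hc⟩

theorem SmoothSpace.IsPlot.mono {U V : Set E} {c : E → X} (h : IsPlot U c) (hV : IsOpen V)
    (hVU : V ⊆ U) : IsPlot V c :=
  SmoothSpace.comp (h := id) h hV (isSmoothOn_clm V (ContinuousLinearMap.id ℝ E)) hVU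

theorem SmoothSpace.IsPlot.comp_affine {E' : LCS.{u}} {U : Set E} {V : Set E'} {c : E → X}
    (h : IsPlot U c) (hV : IsOpen V) (ℓ : E' →L[ℝ] E) (b : E)
    (hm : MapsTo (fun y => ℓ y + b) V U) : IsPlot V (fun y => c (ℓ y + b)) :=
  SmoothSpace.comp h hV (isSmoothOn_affine V ℓ b) hm

theorem IsSmoothMap.comp_plot {f : X → Y} (hf : IsSmoothMap f) {U : Set E} {c : E → X}
    (hc : IsPlot U c) : IsPlot U (fun x => f (c x)) :=
  hf E U c hc (mapsTo_univ _ _)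

theorem IsSmoothMapOn.comp_plot {A : Set X} {f : X → Y} (hf : IsSmoothMapOn A f) {U : Set E}
    {c : E → X} (hc : IsPlot U c) (hm : ∀ x ∈ U, c x ∈ A) : IsPlot U (fun x => f (c x)) :=
  hf E U c hc hm

theorem IsSmoothOpen.isOpen_inter {A : Set X} (hA : IsSmoothOpen A) {U : Set E} {c : E → X}
    (hc : IsPlot U c) : IsOpen (U ∩ c ⁻¹' A) :=
  hA E U c hc

theorem IsSmoothOpen.preimage {A : Set Y} (hA : IsSmoothOpen A) {f : X → Y} (hf : IsSmoothMap f) :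
    IsSmoothOpen (f ⁻¹' A) :=
  fun _ _ _ hc => hA.isOpen_inter (hf.comp_plot hc)

theorem IsSmoothOpen.inter_preimage {A : Set X} (hA : IsSmoothOpen A) {B : Set Y}
    (hB : IsSmoothOpen B) {f : X → Y} (hf : IsSmoothMapOn A f) : IsSmoothOpen (A ∩ f ⁻¹' B) := by
  intro E U c hc
  have h1 : IsPlot (U ∩ c ⁻¹' A) c := hc.mono (hA.isOpen_inter hc) inter_subset_left
  have := hB.isOpen_inter (hf.comp_plot h1 fun x hx => hx.2)
  rwa [inter_assoc] at this

theorem IsSmoothMap.comp {f : Y → Z} {g : X → Y} (hf : IsSmoothMap f) (hg : IsSmoothMap g) :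
    IsSmoothMap (fun x => f (g x)) :=
  fun _ _ _ hc _ => hf.comp_plot (hg.comp_plot hc)

theorem isSmoothMap_fst : IsSmoothMap (Prod.fst : X × Y → X) := fun _ _ _ hc _ => hc.1

theorem isSmoothMap_snd : IsSmoothMap (Prod.snd : X × Y → Y) := fun _ _ _ hc _ => hc.2

theorem isSmoothMap_val (p : X → Prop) : IsSmoothMap (Subtype.val : {x // p x} → X) :=
  fun _ _ _ hc _ => hc

theorem IsCircleSmoothOn.of_local {E : LCS.{u}} {U : Set E} {z : E → Circle}
    (h : ∀ x ∈ U, ∃ (V : Set E) (z' : E → Circle), IsOpen V ∧ x ∈ V ∧ IsCircleSmoothOn V z' ∧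
      EqOn z' z V) : IsCircleSmoothOn U z := by
  refine IsSmoothOn.of_local fun x hx => ?_
  obtain ⟨V, z', h1, h2, h3, h4⟩ := h x hx
  exact ⟨V, h1, h2, IsSmoothOn.congr h3 h1 fun y hy => by rw [h4 hy]⟩

theorem IsCircleSmoothOn.mono {E : LCS.{u}} {U V : Set E} {z : E → Circle}
    (h : IsCircleSmoothOn U z) (hV : V ⊆ U) : IsCircleSmoothOn V z :=
  IsSmoothOn.mono h hV

end Plots

/-! ## Maps with local sections, and quotient maps -/

section Sections

variable {X Y Z : Type u} [SmoothSpace X] [SmoothSpace Y] [SmoothSpace Z]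

/-- A smooth map with a smooth local section near each point of the target. -/
structure HasLocalSections (k : X → Y) : Prop where
  smooth : IsSmoothMap k
  exists_section : ∀ y : Y, ∃ (W : Set Y) (σ : Y → X), IsSmoothOpen W ∧ y ∈ W ∧
    (∀ y' ∈ W, k (σ y') = y') ∧ IsSmoothMapOn W σ

/-- A smooth map along which all plots of the target lift locally. -/
structure IsSubduction (k : X → Y) : Prop where
  smooth : IsSmoothMap k
  surjective : Function.Surjective k
  lift : ∀ (E : LCS.{u}) (U : Set E) (c : E → Y), IsPlot U c → ∀ x ∈ U,
    ∃ (V : Set E) (c' : E → X), x ∈ V ∧ V ⊆ U ∧ IsPlot V c' ∧ EqOn c (k ∘ c') V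

theorem HasLocalSections.isSubduction {k : X → Y} (h : HasLocalSections k) : IsSubduction k where
  smooth := h.smooth
  surjective y := by
    obtain ⟨W, σ, -, hy, hσ, -⟩ := h.exists_section y
    exact ⟨σ y, hσ y hy⟩
  lift E U c hc x hx := by
    obtain ⟨W, σ, hW, hy, hσ, hs⟩ := h.exists_section (c x)
    refine ⟨U ∩ c ⁻¹' W, fun y => σ (c y), ⟨hx, hy⟩, inter_subset_left,
      hs.comp_plot (hc.mono (hW.isOpen_inter hc) inter_subset_left) fun y hy => hy.2,
      fun y hy => (hσ _ hy.2).symm⟩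

theorem HasLocalSections.comp {k : X → Y} {l : Y → Z} (hl : HasLocalSections l)
    (hk : HasLocalSections k) : HasLocalSections (fun x => l (k x)) where
  smooth := hl.smooth.comp hk.smooth
  exists_section z := by
    obtain ⟨W, σ, hW, hz, hσ, hs⟩ := hl.exists_section z
    obtain ⟨W', σ', hW', hz', hσ', hs'⟩ := hk.exists_section (σ z)
    refine ⟨W ∩ σ ⁻¹' W', fun y => σ' (σ y), hW.inter_preimage hW' hs, ⟨hz, hz'⟩,
      fun y hy => by rw [hσ' _ hy.2, hσ _ hy.1], fun E U c hc hm => ?_⟩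
    exact hs'.comp_plot (hs.comp_plot hc fun x hx => (hm hx).1) fun x hx => (hm hx).2

theorem HasLocalSections.pullback {k : X → Z} (hk : HasLocalSections k) {f : Y → Z}
    (hf : IsSmoothMap f) : HasLocalSections (fun p : FibProd f k => p.1.1) where
  smooth := isSmoothMap_fst.comp (isSmoothMap_val _)
  exists_section y := by
    classical
    obtain ⟨W, σ, hW, hy, hσ, hs⟩ := hk.exists_section (f y)
    -- A total function into the fibre product must have a value off f⁻¹(W) as well; the point over
    -- the fixed `y` serves.
    let σ' : Y → FibProd f k := fun y' =>
      if h : f y' ∈ W then ⟨(y', σ (f y')), (hσ _ h).symm⟩ else ⟨(y, σ (f y)), (hσ _ hy).symm⟩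
    have h1 : ∀ y' (h : f y' ∈ W), (σ' y').1 = (y', σ (f y')) := fun y' h => by simp [σ', h]
    refine ⟨f ⁻¹' W, σ', hW.preimage hf, hy, fun y' hy' => by rw [h1 y' hy'],
      fun E U c hc hm => ⟨?_, ?_⟩⟩
    · exact hc.congr fun x hx => by simp [h1 _ (hm hx)]
    · exact (hs.comp_plot (hf.comp_plot hc) hm).congr fun x hx => by simp [h1 _ (hm hx)]

theorem TBundle.hasLocalSections (P : TBundle X) : HasLocalSections P.proj where
  smooth := P.smooth_proj
  exists_section x := by
    obtain ⟨W, σ, τ, h1, h2, h3, h4, -⟩ := P.locTriv x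
    exact ⟨W, σ, h1, h2, h3, h4⟩

theorem IsPrincipalQuotient.hasLocalSections {G : Type u} [Group G] [SmoothSpace G]
    [MulAction G X] {q : X → Y} (h : IsPrincipalQuotient G q) : HasLocalSections q where
  smooth := h.smooth
  exists_section x := by
    obtain ⟨W, σ, τ, h1, h2, h3, h4, -⟩ := h.locTriv x
    exact ⟨W, σ, h1, h2, h3, h4⟩

theorem IsOrbitSpace.isSubduction {G : Type u} [Group G]
    [MulAction G X] {q : X → Y} (h : IsOrbitSpace G q) : IsSubduction q :=
  ⟨h.smooth, h.surjective, h.lift⟩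

/-- In adapted charts the map is (a, b) ↦ a, and freezing `b` gives the section a ↦ (a, b). It is
defined on those points of χ(V) whose coordinate, paired with `b`, lies in `U`. -/
theorem IsSurjSubmersion.hasLocalSections {π : X → Y} (h : IsSurjSubmersion π) :
    HasLocalSections π where
  smooth := h.smooth
  exists_section y := by
    obtain ⟨x, rfl⟩ := h.surjective y
    obtain ⟨A, B, U, φ, φ', V, χ, χ', hφ, hχ, ⟨⟨a, b⟩, hab, rfl⟩, hproj⟩ := h.locally_proj x
    have hcont : ∀ (E : LCS.{u}) (O : Set E) (c : E → Y), IsPlot O c → (∀ x ∈ O, c x ∈ χ '' V) →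
        IsSmoothOn O (fun x => ((χ' (c x), b) : A × B)) := fun E O c hc hm => by
      have := (hχ.smooth_inv E O c hc hm).prodMk hc.isOpen (isSmoothOn_const O b)
      exact this
    have hχ' : ∀ a' b', (a', b') ∈ U → χ' (χ a') = a' := fun a' b' h =>
      hχ.leftInv _ (hproj a' b' h).1
    refine ⟨χ '' V ∩ {y | (χ' y, b) ∈ U}, fun y => φ (χ' y, b), fun E O c hc => ?_, ?_, ?_, ?_⟩
    · have hO : IsOpen (O ∩ c ⁻¹' (χ '' V)) := hχ.isOpen_image.isOpen_inter hc
      have := (hcont E _ c (hc.mono hO inter_subset_left) fun x hx => hx.2).continuousOn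
      have := this.isOpen_inter_preimage hO hφ.isPlot.isOpen
      rwa [inter_assoc] at this
    · rw [(hproj a b hab).2]
      refine ⟨⟨a, (hproj a b hab).1, rfl⟩, ?_⟩
      change (χ' (χ a), b) ∈ U
      rwa [hχ' a b hab]
    · rintro _ ⟨⟨a', ha', rfl⟩, h2⟩
      have h2' : (χ' (χ a'), b) ∈ U := h2
      rw [(hproj _ _ h2').2, hχ.leftInv _ ha']
    · intro E O c hc hm
      exact SmoothSpace.comp (E := A.prod B) hφ.isPlot hc.isOpen
        (hcont E O c hc fun x hx => (hm hx).1) fun x hx => (hm hx).2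

end Sections

/-! ## Differential forms -/

section Forms

variable {X Y Z : Type u} [SmoothSpace X] [SmoothSpace Y] [SmoothSpace Z]
  {V : Type v} [AddCommGroup V] [Module ℝ V] [TopologicalSpace V] {k : ℕ}

theorem dirDeriv_affine {E E' : LCS.{u}} (ℓ : E →L[ℝ] E') (b : E') (x v : E) :
    dirDeriv (fun y => ℓ y + b) x v = ℓ v :=
  (hasDirDeriv_affine (ℓ : E →ₗ[ℝ] E') b x v).dirDeriv

namespace SmoothForm

theorem at_affine (ω : SmoothForm k X V) {E E' : LCS.{u}} {U : Set E} {U' : Set E'} {c : E → X}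
    {c' : E' → X} (hc : IsPlot U c) (hc' : IsPlot U' c') (ℓ : E' →L[ℝ] E) (b : E)
    (hm : MapsTo (fun y => ℓ y + b) U' U) (h : ∀ y ∈ U', c' y = c (ℓ y + b)) {x : E'}
    (hx : x ∈ U') (w : Fin k → E') :
    ω.at U' c' x w = ω.at U c (ℓ x + b) (fun i => ℓ (w i)) := by
  have := ω.natural E E' U U' c c' _ hc hc' (isSmoothOn_affine U' ℓ b) hm h x hx w
  simpa only [dirDeriv_affine, SmoothForm.at] using this

/-- Naturality along the inclusion of `U'`: the value at a point depends only on the germ of the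
plot. Passing to smaller domains, as all local lifting arguments do, rests on this. -/
theorem toFun_mono (ω : SmoothForm k X V) {E : LCS.{u}} {U U' : Set E} {c c' : E → X}
    (hc : IsPlot U c) (hc' : IsPlot U' c') (hU : U' ⊆ U) (h : EqOn c' c U') {x : E} (hx : x ∈ U') :
    ω.toFun E U' c' x = ω.toFun E U c x := by
  ext w
  have := ω.at_affine hc hc' (ContinuousLinearMap.id ℝ E) 0 (fun y hy => by simpa using hU hy)
    (fun y hy => by simpa using h hy) hx w
  simpa [SmoothForm.at] using this

theorem at_mono (ω : SmoothForm k X V) {E : LCS.{u}} {U U' : Set E} {c c' : E → X}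
    (hc : IsPlot U c) (hc' : IsPlot U' c') (hU : U' ⊆ U) (h : EqOn c' c U') {x : E} (hx : x ∈ U')
    (w : Fin k → E) : ω.at U' c' x w = ω.at U c x w := by
  unfold SmoothForm.at
  rw [ω.toFun_mono hc hc' hU h hx]

theorem at_congr (ω : SmoothForm k X V) {E : LCS.{u}} {U : Set E} {c c' : E → X}
    (hc : IsPlot U c) (h : EqOn c' c U) {x : E} (hx : x ∈ U) (w : Fin k → E) :
    ω.at U c' x w = ω.at U c x w :=
  ω.at_mono hc (hc.congr h) Subset.rfl h hx w

/-- A constant plot factors through the zero linear map, which kills every tangent vector, and there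
is at least one slot. -/
theorem at_const [IsTopologicalAddGroup V] (ω : SmoothForm (k + 1) X V) {E : LCS.{u}} {U : Set E}
    (hU : IsOpen U) (a : X) {x : E} (hx : x ∈ U) (w : Fin (k + 1) → E) :
    ω.at U (fun _ => a) x w = 0 := by
  have := ω.at_affine (SmoothSpace.const (E := E) a isOpen_univ) (SmoothSpace.const a hU)
    0 x (mapsTo_univ _ _) (fun _ _ => rfl) hx w
  rw [this]
  exact (ω.toFun _ _ _ _).map_coord_zero 0 (by simp)

theorem at_one_add (ω : SmoothForm 1 X V) {E : LCS.{u}} (U : Set E) (c : E → X) (x v w : E) :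
    ω.at U c x ![v + w] = ω.at U c x ![v] + ω.at U c x ![w] := by
  have := (ω.toFun E U c x).map_update_add ![v] 0 v w
  have h1 : ∀ a : E, Function.update ![v] 0 a = ![a] := fun a => by
    ext i; fin_cases i; simp
  simpa only [h1, SmoothForm.at] using this

theorem isSmoothOn_at [IsTopologicalAddGroup V] [T2Space V] (ω : SmoothForm k X V) {E : LCS.{u}}
    {U : Set E} {c : E → X} (hc : IsPlot U c) (w : Fin k → E) :
    IsSmoothOn U (fun x => ω.at U c x w) := by
  have := (ω.smooth E U c hc).comp_affine (ContinuousLinearMap.inl ℝ E (Fin k → E)) (0, w)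
    (V := U) (fun y hy => by simpa using hy)
  simpa [SmoothForm.at] using this

/-- The pull-back of a form along a smooth map. -/
noncomputable def pullback (ω : SmoothForm k Y V) (f : X → Y) (hf : IsSmoothMap f) : SmoothForm k X V where
  -- The composite `f ∘ c` may be a plot when `c` is not, whereas a form must vanish on non-plots;
  -- hence the case distinction.
  toFun E U c x := open Classical in if IsPlot U c then ω.toFun E U (fun y => f (c y)) x else 0
  eq_zero E U c x h := by
    split_ifs with hc
    · exact ω.eq_zero _ _ _ _ fun h' => h ⟨hc, h'.2⟩
    · rfl
  smooth E U c hc := by simpa only [if_pos hc] using ω.smooth E U _ (hf.comp_plot hc)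
  natural E E' U U' c c' h hc hc' hh hm heq x hx w := by
    simp only [if_pos hc, if_pos hc']
    exact ω.natural E E' U U' _ _ h (hf.comp_plot hc) (hf.comp_plot hc') hh hm
      (fun y hy => by simp [heq hy]) x hx w

theorem pullback_at (ω : SmoothForm k Y V) (f : X → Y) (hf : IsSmoothMap f) {E : LCS.{u}}
    {U : Set E} {c : E → X} (hc : IsPlot U c) (x : E) (w : Fin k → E) :
    (ω.pullback f hf).at U c x w = ω.at U (fun y => f (c y)) x w := by
  simp only [SmoothForm.at, pullback, if_pos hc]

/-- The sum of two forms. -/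
def add [IsTopologicalAddGroup V] [T2Space V] (ω ω' : SmoothForm k X V) : SmoothForm k X V where
  toFun E U c x := ω.toFun E U c x + ω'.toFun E U c x
  eq_zero E U c x h := by rw [ω.eq_zero _ _ _ _ h, ω'.eq_zero _ _ _ _ h, add_zero]
  smooth E U c hc := (ω.smooth E U c hc).add (hc.isOpen.prod isOpen_univ) (ω'.smooth E U c hc)
  natural E E' U U' c c' h hc hc' hh hm heq x hx w := by
    simp only [AlternatingMap.add_apply]
    rw [ω.natural E E' U U' c c' h hc hc' hh hm heq x hx w,
      ω'.natural E E' U U' c c' h hc hc' hh hm heq x hx w]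

theorem add_at [IsTopologicalAddGroup V] [T2Space V] (ω ω' : SmoothForm k X V) {E : LCS.{u}}
    (U : Set E) (c : E → X) (x : E) (w : Fin k → E) :
    (ω.add ω').at U c x w = ω.at U c x w + ω'.at U c x w := rfl

/-- The negative of a form. -/
def neg [IsTopologicalAddGroup V] [T2Space V] (ω : SmoothForm k X V) : SmoothForm k X V where
  toFun E U c x := - ω.toFun E U c x
  eq_zero E U c x h := by rw [ω.eq_zero _ _ _ _ h, neg_zero]
  smooth E U c hc :=
    (ω.smooth E U c hc).clm_comp (hc.isOpen.prod isOpen_univ) (-ContinuousLinearMap.id ℝ V)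
  natural E E' U U' c c' h hc hc' hh hm heq x hx w := by
    simp only [AlternatingMap.neg_apply]
    rw [ω.natural E E' U U' c c' h hc hc' hh hm heq x hx w]

theorem neg_at [IsTopologicalAddGroup V] [T2Space V] (ω : SmoothForm k X V) {E : LCS.{u}}
    (U : Set E) (c : E → X) (x : E) (w : Fin k → E) :
    (ω.neg).at U c x w = - ω.at U c x w := rfl

/-- A form is determined by its pull-back along a subduction. -/
theorem ext_of_subduction {ω ω' : SmoothForm k Y V} {f : X → Y} (hf : IsSubduction f)
    (h : ∀ (E : LCS.{u}) (U : Set E) (c : E → X), IsPlot U c → ∀ x ∈ U, ∀ w : Fin k → E,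
      ω.at U (f ∘ c) x w = ω'.at U (f ∘ c) x w) : ω = ω' := by
  refine SmoothForm.ext ?_
  funext E U c x
  by_cases hx : IsPlot U c ∧ x ∈ U
  · obtain ⟨V, c', h1, h2, h3, h4⟩ := hf.lift E U c hx.1 x hx.2
    ext w
    have h5 : IsPlot V (f ∘ c') := hf.smooth.comp_plot h3
    have := h E V c' h3 x h1 w
    rwa [ω.at_mono hx.1 h5 h2 h4.symm h1, ω'.at_mono hx.1 h5 h2 h4.symm h1] at this
  · rw [ω.eq_zero _ _ _ _ hx, ω'.eq_zero _ _ _ _ hx]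

/-- A form is basic with respect to `f` if its pull-backs along plots with the same image under `f`
agree. -/
def IsBasic (ω : SmoothForm k X V) (f : X → Y) : Prop :=
  ∀ (E : LCS.{u}) (U : Set E) (c c' : E → X), IsPlot U c → IsPlot U c' →
    (∀ x ∈ U, f (c x) = f (c' x)) → ∀ x ∈ U, ∀ w : Fin k → E, ω.at U c x w = ω.at U c' x w

/-- Evaluate on a plot of `Y` by lifting it locally to `X`. Basicness makes the value independent of
the lift, and smoothness and naturality are inherited from `ω` on lifts. -/
theorem exists_descend (ω : SmoothForm k X V) {f : X → Y} (hf : IsSubduction f)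
    (hω : ω.IsBasic f) : ∃ ω' : SmoothForm k Y V, ∀ (E : LCS.{u}) (U U' : Set E) (c : E → Y)
      (c' : E → X), IsPlot U c → IsPlot U' c' → U' ⊆ U → (∀ x ∈ U', c x = f (c' x)) →
      ∀ x ∈ U', ∀ w : Fin k → E, ω'.at U c x w = ω.at U' c' x w := by
  classical
  choose O L h1 h2 h3 h4 using hf.lift
  have basic : ∀ (E : LCS.{u}) (U U' : Set E) (c c' : E → X), IsPlot U c → IsPlot U' c' → ∀ x,
      x ∈ U → x ∈ U' → (∀ y ∈ U ∩ U', f (c y) = f (c' y)) →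
      ω.toFun E U c x = ω.toFun E U' c' x := by
    intro E U U' c c' hc hc' x hx hx' h
    have hc1 := hc.mono (hc.isOpen.inter hc'.isOpen) inter_subset_left
    have hc1' := hc'.mono (hc.isOpen.inter hc'.isOpen) inter_subset_right
    rw [← ω.toFun_mono hc hc1 inter_subset_left (eqOn_refl _ _) ⟨hx, hx'⟩,
      ← ω.toFun_mono hc' hc1' inter_subset_right (eqOn_refl _ _) ⟨hx, hx'⟩]
    ext w
    exact hω E _ c c' hc1 hc1' h x ⟨hx, hx'⟩ w
  let F : ∀ (E : LCS.{u}), Set E → (E → Y) → E → (E [⋀^Fin k]→ₗ[ℝ] V) := fun E U c x =>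
    if h : IsPlot U c ∧ x ∈ U then ω.toFun E (O E U c h.1 x h.2) (L E U c h.1 x h.2) x else 0
  -- In `F` the chosen lift varies with the point `x`. Near a given point any single lift computes
  -- the same values, and this is what makes `F` smooth and natural.
  have hF : ∀ (E : LCS.{u}) (U U' : Set E) (c : E → Y)
      (c' : E → X), IsPlot U c → IsPlot U' c' → U' ⊆ U → (∀ x ∈ U', c x = f (c' x)) →
      ∀ x ∈ U', F E U c x = ω.toFun E U' c' x := by
    intro E U U' c c' hc hc' hU h x hx
    have hx' : IsPlot U c ∧ x ∈ U := ⟨hc, hU hx⟩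
    simp only [F, dif_pos hx']
    exact basic _ _ _ _ _ (h3 ..) hc' x (h1 ..) hx fun y hy =>
      (h4 E U c hc x (hU hx) hy.1).symm.trans (h y hy.2)
  refine ⟨⟨F, fun E U c x h => dif_neg h, fun E U c hc => IsSmoothOn.of_local fun p hp => ?_,
    fun E E' U U' c c' h hc hc' hh hm heq x hx w => ?_⟩, fun E U U' c c' hc hc' hU h x hx w => ?_⟩
  · have hp' := h1 E U c hc p.1 hp.1
    have hplot := h3 E U c hc p.1 hp.1
    have hopen := hplot.isOpen.prod (isOpen_univ (X := Fin k → E))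
    refine ⟨O E U c hc p.1 hp.1 ×ˢ univ, hopen, ⟨hp', trivial⟩,
      (ω.smooth E _ _ hplot).congr hopen fun p' hp'' => ?_⟩
    rw [hF E U _ c _ hc hplot (h2 ..) (fun y hy => h4 E U c hc _ hp.1 hy) _ hp''.1]
  · have hx1 := hm hx
    have hplot := h3 E U c hc (h x) hx1
    have hO : IsOpen (U' ∩ h ⁻¹' O E U c hc (h x) hx1) :=
      hh.continuousOn.isOpen_inter_preimage hc'.isOpen hplot.isOpen
    have hplot' := SmoothSpace.comp hplot hO (hh.mono inter_subset_left) fun y hy => hy.2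
    rw [hF E' U' _ c' _ hc' hplot' inter_subset_left (fun y hy => (heq hy.1).trans
        (h4 E U c hc _ hx1 hy.2)) x ⟨hx, h1 ..⟩,
      hF E U _ c _ hc hplot (h2 ..) (fun y hy => h4 E U c hc _ hx1 hy) _ (h1 ..)]
    exact ω.natural _ _ _ _ _ _ h hplot hplot' (hh.mono inter_subset_left) (fun y hy => hy.2)
      (fun _ _ => rfl) x ⟨hx, h1 ..⟩ w
  · change F E U c x w = _
    rw [hF E U U' c c' hc hc' hU h x hx]
    rfl

end SmoothForm

/-! ## The exterior derivative -/

theorem extD_congr {E : LCS.{u}} {α β : E → (Fin k → E) → V} {O : Set E} {x : E} (hO : O ∈ 𝓝 x)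
    (h : ∀ y ∈ O, ∀ w, α y w = β y w) (w : Fin (k + 1) → E) : extD α x w = extD β x w := by
  unfold extD
  exact Finset.sum_congr rfl fun i _ => by
    rw [dirDeriv_congr hO fun y hy => h y hy _]

/-- Only directional derivatives are assumed, since one summand will be `kappa`, which is given as
an expression along plots and not as a `SmoothForm`. -/
theorem extD_add [T2Space V] [IsTopologicalAddGroup V] {E : LCS.{u}} {α β : E → (Fin k → E) → V}
    {x : E} (hα : ∀ w v, ∃ a, HasDirDeriv (fun y => α y w) x v a)
    (hβ : ∀ w v, ∃ a, HasDirDeriv (fun y => β y w) x v a) (w : Fin (k + 1) → E) :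
    extD (fun y w => α y w + β y w) x w = extD α x w + extD β x w := by
  unfold extD
  rw [← Finset.sum_add_distrib]
  refine Finset.sum_congr rfl fun i _ => ?_
  obtain ⟨a, ha⟩ := hα (i.removeNth w) (w i)
  obtain ⟨b, hb⟩ := hβ (i.removeNth w) (w i)
  rw [(ha.add hb).dirDeriv, ha.dirDeriv, hb.dirDeriv, smul_add]

theorem SmoothForm.exists_hasDirDeriv [T2Space V] [IsTopologicalAddGroup V] (ω : SmoothForm k X V)
    {E : LCS.{u}} {U : Set E} {c : E → X} (hc : IsPlot U c) {x : E} (hx : x ∈ U) (w : Fin k → E)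
    (v : E) : ∃ a, HasDirDeriv (fun y => ω.at U c y w) x v a :=
  (ω.isSmoothOn_at hc w).exists_hasDirDeriv hx v

theorem SmoothForm.extD_add [T2Space V] [IsTopologicalAddGroup V] (ω ω' : SmoothForm k X V)
    {E : LCS.{u}} {U : Set E} {c : E → X} (hc : IsPlot U c) {x : E} (hx : x ∈ U)
    (w : Fin (k + 1) → E) :
    extD ((ω.add ω').at U c) x w = extD (ω.at U c) x w + extD (ω'.at U c) x w :=
  _root_.extD_add (ω.exists_hasDirDeriv hc hx) (ω'.exists_hasDirDeriv hc hx) w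

theorem SmoothForm.extD_neg [T2Space V] [IsTopologicalAddGroup V]
    (ω : SmoothForm k X V) {E : LCS.{u}} {U : Set E} {c : E → X} (hc : IsPlot U c) {x : E}
    (hx : x ∈ U) (w : Fin (k + 1) → E) : extD (ω.neg.at U c) x w = - extD (ω.at U c) x w := by
  unfold extD
  rw [← Finset.sum_neg_distrib]
  refine Finset.sum_congr rfl fun i _ => ?_
  obtain ⟨a, ha⟩ := ω.exists_hasDirDeriv hc hx (i.removeNth w) (w i)
  have := ha.clm_comp (-ContinuousLinearMap.id ℝ V)
  rw [ha.dirDeriv, ← smul_neg]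
  exact congrArg _ this.dirDeriv

end Forms

/-! ## Quotients of smooth spaces -/

/-- The quotient smooth structure: a plot is a map which lifts locally to a plot. -/
instance SmoothSpace.instQuotient (X : Type u) [SmoothSpace X] (S : Setoid X) :
    SmoothSpace (Quotient S) where
  IsPlot {E} U c := IsOpen U ∧ ∀ x ∈ U, ∃ (V : Set E) (c' : E → X), x ∈ V ∧ V ⊆ U ∧
    SmoothSpace.IsPlot V c' ∧ EqOn c (Quotient.mk S ∘ c') V
  isOpen_dom h := h.1
  const {E U} a hU := by
    obtain ⟨a, rfl⟩ := Quotient.exists_rep a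
    exact ⟨hU, fun x hx => ⟨U, fun _ => a, hx, Subset.rfl, SmoothSpace.const a hU, fun _ _ => rfl⟩⟩
  comp {E E' U V c h} hc hV hh hm := by
    refine ⟨hV, fun x hx => ?_⟩
    obtain ⟨O, c', h1, h2, h3, h4⟩ := hc.2 (h x) (hm hx)
    have hO := hh.continuousOn.isOpen_inter_preimage hV (SmoothSpace.isOpen_dom h3)
    exact ⟨V ∩ h ⁻¹' O, c' ∘ h, ⟨hx, h1⟩, inter_subset_left,
      SmoothSpace.comp h3 hO (hh.mono inter_subset_left) fun y hy => hy.2, fun y hy => h4 hy.2⟩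
  glue {E U c} hU H := by
    refine ⟨hU, fun x hx => ?_⟩
    obtain ⟨V, c', h1, h2, h3, h4⟩ := H x hx
    obtain ⟨O, c'', h1', h2', h3', h4'⟩ := h3.2 x h1
    exact ⟨O, c'', h1', h2'.trans h2, h3', (h4.mono h2').trans h4'⟩

theorem isSubduction_quotientMk {X : Type u} [SmoothSpace X] (S : Setoid X) :
    IsSubduction (Quotient.mk S) where
  smooth _ U c hc _ := ⟨hc.isOpen, fun _ hx => ⟨U, c, hx, Subset.rfl, hc, fun _ _ => rfl⟩⟩
  surjective := Quotient.exists_rep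
  lift _ _ _ hc := hc.2

/-! ## Principal `𝕋`-bundles -/

namespace TBundle

variable {X : Type u} [SmoothSpace X] (P : TBundle X)

theorem smul_left_cancel {z z' : Circle} {p : P.Tot} (h : z • p = z' • p) : z = z' := by
  have : (z'⁻¹ * z) • p = p := by rw [mul_smul, h, inv_smul_smul]
  exact (inv_mul_eq_one.1 (P.free _ _ this)).symm

theorem proj_smul (z : Circle) (p : P.Tot) : P.proj (z • p) = P.proj p :=
  ((P.fiber p (z • p)).2 ⟨z, rfl⟩).symm

/-- In a local trivialization with fibre coordinate τ one has z = τ(c') τ(c)⁻¹. -/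
theorem isCircleSmoothOn_of_smul_eq {E : LCS.{u}} {U : Set E} {c c' : E → P.Tot} {z : E → Circle}
    (hc : IsPlot U c) (hc' : IsPlot U c') (h : ∀ x ∈ U, z x • c x = c' x) :
    IsCircleSmoothOn U z := by
  refine IsCircleSmoothOn.of_local fun x hx => ?_
  obtain ⟨W, σ, τ, hW, hxW, hσ, hσs, hτ, hτs⟩ := P.locTriv (P.proj (c x))
  have hO := hW.isOpen_inter (P.smooth_proj.comp_plot hc)
  have hproj : ∀ y ∈ U, P.proj (c' y) = P.proj (c y) := fun y hy => by
    rw [← h y hy, P.proj_smul]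
  have h1 : IsCircleSmoothOn (U ∩ (fun x => P.proj (c x)) ⁻¹' W) (fun y => τ (c y)) :=
    hτs E _ c (hc.mono hO inter_subset_left) fun y hy => hy.2
  have h2 : IsCircleSmoothOn (U ∩ (fun x => P.proj (c x)) ⁻¹' W) (fun y => τ (c' y)) :=
    hτs E _ c' (hc'.mono hO inter_subset_left) fun y hy => by
      rw [mem_preimage, hproj y hy.1]; exact hy.2
  refine ⟨_, _, hO, ⟨hx, hxW⟩, h2.mul hO (h1.inv hO), fun y hy => ?_⟩
  have h3 := hτ (c y) hy.2
  have h4 := hτ (c' y) (by rw [hproj y hy.1]; exact hy.2)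
  rw [hproj y hy.1, ← h y hy.1] at h4
  conv_rhs at h4 => rw [← h3]
  rw [← mul_smul] at h4
  have := P.smul_left_cancel h4
  rw [← h y hy.1, this, mul_inv_cancel_right]

/-- The quotient `z` of two points of a fibre, `p = z p'`. -/
noncomputable def ratio (p p' : P.Tot) : Circle :=
  Classical.epsilon fun z : Circle => z • p' = p

theorem ratio_smul {p p' : P.Tot} (h : P.proj p = P.proj p') : P.ratio p p' • p' = p :=
  Classical.epsilon_spec ((P.fiber p' p).1 h.symm)

theorem ratio_eq {p p' : P.Tot} {z : Circle} (h : z • p' = p) : P.ratio p p' = z :=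
  P.smul_left_cancel ((P.ratio_smul (by rw [← h, P.proj_smul])).trans h.symm)

theorem ratio_trans {p p' p'' : P.Tot} (h : P.proj p = P.proj p') (h' : P.proj p' = P.proj p'') :
    P.ratio p p' * P.ratio p' p'' = P.ratio p p'' :=
  (P.ratio_eq (by rw [mul_smul, P.ratio_smul h', P.ratio_smul h])).symm

theorem ratio_smul_left {p p' : P.Tot} (h : P.proj p = P.proj p') (z : Circle) :
    P.ratio (z • p) p' = z * P.ratio p p' :=
  P.ratio_eq (by rw [mul_smul, P.ratio_smul h])

theorem ratio_smooth {E : LCS.{u}} {U : Set E} {c c' : E → P.Tot}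
    (hc : IsPlot U c) (hc' : IsPlot U c') (h : ∀ x ∈ U, P.proj (c x) = P.proj (c' x)) :
    IsCircleSmoothOn U (fun x => P.ratio (c x) (c' x)) :=
  P.isCircleSmoothOn_of_smul_eq hc' hc fun x hx => P.ratio_smul (h x hx)

theorem proj_surjective : Function.Surjective P.proj :=
  P.hasLocalSections.isSubduction.surjective

end TBundle

/-- Data from which a principal `𝕋`-bundle over `B` arises as the quotient of `X` by the
relation `S`. -/
structure IsTBundlePresentation {X B : Type u} [SmoothSpace X] [SmoothSpace B] (S : Setoid X)
    (act : Circle → X → X) (proj : X → B) : Prop where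
  sections : HasLocalSections proj
  act_one : ∀ x, act 1 x = x
  act_mul : ∀ z z' x, act (z * z') x = act z (act z' x)
  smooth_act : ∀ (E : LCS.{u}) (U : Set E) (c : E → X) (z : E → Circle), IsPlot U c →
    IsCircleSmoothOn U z → IsPlot U (fun x => act (z x) (c x))
  act_rel : ∀ z x x', S x x' → S (act z x) (act z x')
  fiber : ∀ x x', proj x = proj x' ↔ ∃ z, S (act z x) x'
  free : ∀ z x, S (act z x) x → z = 1
  ratio : ∀ (E : LCS.{u}) (U : Set E) (c c' : E → X) (z : E → Circle), IsPlot U c → IsPlot U c' →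
    (∀ x ∈ U, S (act (z x) (c x)) (c' x)) → IsCircleSmoothOn U z

/-- The bundle `R` is the quotient, via `k`, of `X` by the relation `S`. -/
structure IsTBundleQuotient {X B : Type u} [SmoothSpace X] [SmoothSpace B] (S : Setoid X)
    (act : Circle → X → X) (proj : X → B) (R : TBundle B) (k : X → R.Tot) : Prop where
  subduction : IsSubduction k
  proj_eq : ∀ x, R.proj (k x) = proj x
  act_eq : ∀ z x, k (act z x) = z • k x
  eq_iff : ∀ x x', k x = k x' ↔ S x x'

/-! ### Quotient bundles, descent data and descended connections. -/

section Quotient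

variable {X B : Type u} [SmoothSpace X] [SmoothSpace B] {S : Setoid X}
  {act : Circle → X → X} {proj : X → B}

/-- The total space is `Quotient S` with the quotient smooth structure. Local sections of `proj`
induce sections of the quotient, and the fibre coordinate relative to such a section is smooth by
the `ratio` axiom applied to local lifts. -/
theorem IsTBundlePresentation.exists_quotient (h : IsTBundlePresentation S act proj) :
    ∃ (R : TBundle B) (k : X → R.Tot), IsTBundleQuotient S act proj R k := by
  classical
  have hk := isSubduction_quotientMk S
  have hS : ∀ x x' : X, Quotient.mk S x = Quotient.mk S x' ↔ S x x' := fun x x' => Quotient.eq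
  have hrel : ∀ x x', S x x' → proj x = proj x' := fun x x' hx =>
    (h.fiber x x').2 ⟨1, by rwa [h.act_one]⟩
  let act' : MulAction Circle (Quotient S) :=
    { smul := fun z => Quotient.map (act z) (fun x x' hx => h.act_rel z x x' hx)
      one_smul := by
        rintro ⟨x⟩; exact congrArg (Quotient.mk S) (h.act_one x)
      mul_smul := by
        rintro z z' ⟨x⟩; exact congrArg (Quotient.mk S) (h.act_mul z z' x) }
  have hsmul : ∀ z x, z • (Quotient.mk S x) = Quotient.mk S (act z x) := fun z x => rfl
  let p : Quotient S → B := Quotient.lift proj hrel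
  have hp : ∀ x, p (Quotient.mk S x) = proj x := fun x => rfl
  have hfib : ∀ a b : Quotient S, p a = p b ↔ ∃ z : Circle, z • a = b := by
    rintro ⟨x⟩ ⟨x'⟩
    refine (h.fiber x x').trans (exists_congr fun z => ?_)
    exact (hS _ _).symm
  have hfree : ∀ (z : Circle) (a : Quotient S), z • a = a → z = 1 := by
    rintro z ⟨x⟩ hz
    exact h.free z x ((hS _ _).1 hz)
  refine ⟨⟨Quotient S, p, ?_, ?_, hfib, hfree, ?_⟩, Quotient.mk S, hk, hp, fun _ _ => rfl, hS⟩
  · refine fun E U c hc _ => SmoothSpace.glue hc.isOpen fun x hx => ?_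
    obtain ⟨V, c', h1, h2, h3, h4⟩ := hk.lift E U c hc x hx
    exact ⟨V, _, h1, h2, h.sections.smooth.comp_plot h3, fun y hy => by
      simp only [Function.comp, h4 hy, hp]⟩
  · refine fun E U c z hc hz => SmoothSpace.glue hc.isOpen fun x hx => ?_
    obtain ⟨V, c', h1, h2, h3, h4⟩ := hk.lift E U c hc x hx
    exact ⟨V, _, h1, h2, hk.smooth.comp_plot (h.smooth_act E V c' z h3 (hz.mono h2)),
      fun y hy => by simp only [h4 hy, Function.comp, hsmul]⟩
  · intro b
    obtain ⟨W, σ, hW, hb, hσ, hσs⟩ := h.sections.exists_section b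
    let τ : Quotient S → Circle := fun a =>
      if ha : ∃ z : Circle, z • Quotient.mk S (σ (p a)) = a then ha.choose else 1
    have hτ : ∀ a, p a ∈ W → τ a • Quotient.mk S (σ (p a)) = a := fun a ha => by
      have : ∃ z : Circle, z • Quotient.mk S (σ (p a)) = a :=
        (hfib _ _).1 (by rw [hp, hσ _ ha])
      simp only [τ, dif_pos this]
      exact this.choose_spec
    refine ⟨W, fun y => Quotient.mk S (σ y), τ, hW, hb, fun y hy => by rw [hp, hσ y hy],
      fun E U c hc hm => hk.smooth.comp_plot (hσs.comp_plot hc hm), hτ, fun E U c hc hm => ?_⟩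
    refine IsSmoothOn.of_local fun x hx => ?_
    obtain ⟨V, c', h1, h2, h3, h4⟩ := hk.lift E U c hc x hx
    have h5 : ∀ y ∈ V, p (c y) = proj (c' y) := fun y hy => by
      rw [h4 hy]; rfl
    refine ⟨V, h3.isOpen, h1, h.ratio E V (fun y => σ (proj (c' y))) c' (fun y => τ (c y))
      (hσs.comp_plot (h.sections.smooth.comp_plot h3) fun y hy => ?_) h3 fun y hy => ?_⟩
    · rw [← h5 y hy]; exact hm (h2 hy)
    · rw [← hS, ← hsmul, ← h5 y hy, hτ _ (hm (h2 hy)), h4 hy]; rfl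

/-- A descent datum with respect to `proj` for the trivial `𝕋`-bundle over `X`, compatible with an
action of `𝕋` on `X`. -/
structure IsDescentDatum (act : Circle → X → X) (proj : X → B) (t : X → X → Circle) : Prop where
  sections : HasLocalSections proj
  act_one : ∀ x, act 1 x = x
  act_mul : ∀ z z' x, act (z * z') x = act z (act z' x)
  smooth_act : ∀ (E : LCS.{u}) (U : Set E) (c : E → X) (z : E → Circle), IsPlot U c →
    IsCircleSmoothOn U z → IsPlot U (fun x => act (z x) (c x))
  proj_act : ∀ z x, proj (act z x) = proj x
  trans : ∀ x x' x'', proj x = proj x' → proj x' = proj x'' → t x x' * t x' x'' = t x x''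
  act_left : ∀ z x x', proj x = proj x' → t (act z x) x' = z * t x x'
  smooth : ∀ (E : LCS.{u}) (U : Set E) (c c' : E → X), IsPlot U c → IsPlot U c' →
    (∀ x ∈ U, proj (c x) = proj (c' x)) → IsCircleSmoothOn U (fun x => t (c x) (c' x))

namespace IsDescentDatum

variable {t : X → X → Circle} (h : IsDescentDatum act proj t)
include h

theorem self (x : X) : t x x = 1 := by
  simpa using h.trans x x x rfl rfl

theorem act_right (z : Circle) (x x' : X) (hx : proj x = proj x') :
    t x (act z x') = z⁻¹ * t x x' := by
  have h1 := h.trans x (act z x') x' (hx.trans (h.proj_act z x').symm) (h.proj_act z x')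
  rw [h.act_left z x' x' rfl, h.self, mul_one] at h1
  rw [← h1, mul_comm, mul_inv_cancel_right]

/-- The equivalence relation of a descent datum. -/
def setoid : Setoid X where
  r x x' := proj x = proj x' ∧ t x x' = 1
  iseqv :=
    { refl := fun x => ⟨rfl, h.self x⟩
      symm := fun {x x'} hx => ⟨hx.1.symm, by
        have := h.trans _ _ _ hx.1 hx.1.symm
        rwa [hx.2, one_mul, h.self] at this⟩
      trans := fun {x x' x''} hx hx' => ⟨hx.1.trans hx'.1, by
        rw [← h.trans _ _ _ hx.1 hx'.1, hx.2, hx'.2, one_mul]⟩ }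

/-- Two points of a fibre become related after acting by z exactly when z = t(x, x')⁻¹. Fibres,
freeness and smoothness of ratios all follow from this formula. -/
theorem isTBundlePresentation : IsTBundlePresentation h.setoid act proj where
  sections := h.sections
  act_one := h.act_one
  act_mul := h.act_mul
  smooth_act := h.smooth_act
  act_rel z x x' hx := ⟨by rw [h.proj_act, h.proj_act, hx.1], by
    rw [h.act_left _ _ _ (by rw [h.proj_act, hx.1]), h.act_right _ _ _ hx.1, hx.2]; simp⟩
  fiber x x' := ⟨fun hx => ⟨(t x x')⁻¹, by rw [h.proj_act, hx], by
      rw [h.act_left _ _ _ hx, inv_mul_cancel]⟩,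
    fun ⟨z, hz⟩ => (h.proj_act z x).symm.trans hz.1⟩
  free z x hx := by
    have := hx.2
    rwa [h.act_left _ _ _ rfl, h.self, mul_one] at this
  ratio E U c c' z hc hc' hcc' := by
    have hbase : ∀ x ∈ U, proj (c x) = proj (c' x) := fun x hx =>
      (h.proj_act _ _).symm.trans (hcc' x hx).1
    refine IsSmoothOn.congr ((h.smooth E U c c' hc hc' hbase).inv hc.isOpen) hc.isOpen
      fun x hx => ?_
    have := (hcc' x hx).2
    rw [h.act_left _ _ _ (hbase x hx)] at this
    simp only [eq_inv_of_mul_eq_one_left this]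

end IsDescentDatum

/-- Invariance under `S` says that `θ` is basic for `k`, so it descends; the connection property can
then be tested on local lifts, where it is the second condition on `θ`. -/
theorem IsTBundleQuotient.exists_connection {R : TBundle B} {k : X → R.Tot}
    (h : IsTBundleQuotient S act proj R k)
    (hs : ∀ (E : LCS.{u}) (U : Set E) (c : E → X) (z : E → Circle), IsPlot U c →
      IsCircleSmoothOn U z → IsPlot U (fun x => act (z x) (c x)))
    (θ : SmoothForm 1 X ℝ)
    (hθ : ∀ (E : LCS.{u}) (U : Set E) (c c' : E → X), IsPlot U c → IsPlot U c' →
      (∀ x ∈ U, S (c x) (c' x)) → ∀ x ∈ U, ∀ w : E, θ.at U c x ![w] = θ.at U c' x ![w])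
    (hc : ∀ (E : LCS.{u}) (U : Set E) (c : E → X) (z : E → Circle), IsPlot U c →
      IsCircleSmoothOn U z → ∀ x ∈ U, ∀ w : E,
      θ.at U (fun y => act (z y) (c y)) x ![w] = θ.at U c x ![w] + dlog z x w) :
    ∃ η : SmoothForm 1 R.Tot ℝ, R.IsConnection η ∧
      ∀ (E : LCS.{u}) (U U' : Set E) (c : E → R.Tot) (c' : E → X), IsPlot U c → IsPlot U' c' →
        U' ⊆ U → (∀ x ∈ U', c x = k (c' x)) → ∀ x ∈ U', ∀ w : Fin 1 → E,
          η.at U c x w = θ.at U' c' x w := by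
  obtain ⟨η, hη⟩ := θ.exists_descend h.subduction (f := k) fun E U c c' h1 h2 h3 x hx w => by
    have hw : w = ![w 0] := by ext i; fin_cases i; rfl
    rw [hw]
    exact hθ E U c c' h1 h2 (fun y hy => (h.eq_iff _ _).1 (h3 y hy)) x hx _
  refine ⟨η, fun E U c z h1 hz x hx w => ?_, hη⟩
  obtain ⟨V, c', h2, h3, h4, h5⟩ := h.subduction.lift E U c h1 x hx
  have h6 := hs E V c' z h4 (hz.mono h3)
  rw [hη E U V c c' h1 h4 h3 h5 x h2,
    hη E U V _ _ (R.smooth_act E U c z h1 hz) h6 h3 (fun y hy => by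
      rw [h.act_eq, h5 hy]; rfl) x h2]
  exact hc E V c' z h4 (hz.mono h3) x h2 w

end Quotient

/-! ## Actions of Lie groups -/

section Action

variable {G : Type u} [Group G] [SmoothSpace G] {X : Type u} [SmoothSpace X] [MulAction G X]
  {E : LCS.{u}} {U : Set E}

theorem IsLieGrp.plot_mul (hG : IsLieGrp G) {g h : E → G} (hg : IsPlot U g) (hh : IsPlot U h) :
    IsPlot U (fun x => g x * h x) :=
  hG.smooth_mul.comp_plot (c := fun x => (g x, h x)) ⟨hg, hh⟩

theorem IsLieGrp.plot_inv (hG : IsLieGrp G) {g : E → G} (hg : IsPlot U g) :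
    IsPlot U (fun x => (g x)⁻¹) :=
  hG.smooth_inv.comp_plot hg

theorem IsSmoothAction.plot_smul (hX : IsSmoothAction G X) {g : E → G} {c : E → X}
    (hg : IsPlot U g) (hc : IsPlot U c) : IsPlot U (fun x => g x • c x) :=
  IsSmoothMap.comp_plot hX (c := fun x => (g x, c x)) ⟨hg, hc⟩

theorem IsSmoothAction.plot_const_smul (hX : IsSmoothAction G X) (g : G) {c : E → X}
    (hc : IsPlot U c) : IsPlot U (fun x => g • c x) :=
  hX.plot_smul (SmoothSpace.const g hc.isOpen) hc

theorem IsPrincipalQuotient.smul_left_cancel {X' : Type u} [SmoothSpace X'] {q : X → X'}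
    (hq : IsPrincipalQuotient G q) {g g' : G} {x : X} (h : g • x = g' • x) : g = g' := by
  have : (g'⁻¹ * g) • x = x := by rw [mul_smul, h, inv_smul_smul]
  exact (inv_mul_eq_one.1 (hq.free _ _ this)).symm

theorem IsPrincipalQuotient.map_smul {X' : Type u} [SmoothSpace X'] {q : X → X'}
    (hq : IsPrincipalQuotient G q) (g : G) (x : X) : q (g • x) = q x :=
  ((hq.fiber x (g • x)).2 ⟨g, rfl⟩).symm

/-- By freeness the translating element is unique at each point, so the pointwise choice agrees
locally with τ(c') τ(c)⁻¹, which is a plot. -/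
theorem IsPrincipalQuotient.exists_smul_eq (hG : IsLieGrp G) {X' : Type u} [SmoothSpace X']
    {q : X → X'} (hq : IsPrincipalQuotient G q) {c c' : E → X} (hc : IsPlot U c)
    (hc' : IsPlot U c') (h : ∀ x ∈ U, q (c x) = q (c' x)) :
    ∃ g : E → G, IsPlot U g ∧ ∀ x ∈ U, g x • c x = c' x := by
  classical
  have : ∀ x, ∃ g : G, x ∈ U → g • c x = c' x := fun x => by
    by_cases hx : x ∈ U
    · obtain ⟨g, hg⟩ := (hq.fiber _ _).1 (h x hx)
      exact ⟨g, fun _ => hg⟩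
    · exact ⟨1, fun h => absurd h hx⟩
  choose g hg using this
  refine ⟨g, SmoothSpace.glue hc.isOpen fun x hx => ?_, hg⟩
  obtain ⟨W, σ, τ, hW, hxW, hσ, -, hτ, hτs⟩ := hq.locTriv (q (c x))
  have hO := hW.isOpen_inter (hq.smooth.comp_plot hc)
  have h1 := hτs.comp_plot (hc.mono hO inter_subset_left) fun y hy => hy.2
  have hW' : ∀ y ∈ U ∩ (fun x => q (c x)) ⁻¹' W, q (c' y) ∈ W := fun y hy => by
    rw [← h y hy.1]; exact hy.2
  have h2 := hτs.comp_plot (hc'.mono hO inter_subset_left) hW'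
  refine ⟨U ∩ (fun x => q (c x)) ⁻¹' W, _, ⟨hx, hxW⟩, inter_subset_left,
    hG.plot_mul h2 (hG.plot_inv h1), fun y hy => ?_⟩
  refine hq.smul_left_cancel (x := c y) ?_
  have h3 : (τ (c y))⁻¹ • c y = σ (q (c y)) := inv_smul_eq_iff.2 (hτ _ hy.2).symm
  rw [hg y hy.1, mul_smul, h3, h y hy.1, hτ _ (hW' y hy)]

variable {V : Type v} [AddCommGroup V] [Module ℝ V] [TopologicalSpace V] (L : LieAlg G)

/-- The logarithmic derivative `dg g⁻¹` of a group valued function. -/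
noncomputable def LieAlg.dlog (g : E → G) (x w : E) : L.𝔤 :=
  dirDeriv (fun y => L.log (g y * (g x)⁻¹)) x w

theorem LieAlg.log_one : L.log 1 = 0 := by
  have := L.isChart.leftInv 0 L.zero_mem
  rwa [L.exp_zero] at this

theorem LieAlg.plot_exp_smul (hX : IsSmoothAction G X) (p : X) :
    IsPlot L.dom (fun η => L.exp η • p) :=
  hX.plot_smul L.isChart.isPlot (SmoothSpace.const p L.isChart.isPlot.isOpen)

theorem LieAlg.exp_log {g : G} (hg : g ∈ L.exp '' L.dom) : L.exp (L.log g) = g := by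
  obtain ⟨η, hη, rfl⟩ := hg
  rw [L.isChart.leftInv η hη]

theorem LieAlg.log_mem {g : G} (hg : g ∈ L.exp '' L.dom) : L.log g ∈ L.dom := by
  obtain ⟨η, hη, rfl⟩ := hg
  rwa [L.isChart.leftInv η hη]

/-- A 1-form along the orbit map of a curve in the group through the identity. -/
theorem SmoothForm.at_smul_of_eq_one (hX : IsSmoothAction G X) (ω : SmoothForm 1 X V)
    {g : E → G} (hg : IsPlot U g) {x : E} (hx : x ∈ U) (hgx : g x = 1) (p : X) (w : E) :
    ω.at U (fun y => g y • p) x ![w] =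
      ω.moment L p (dirDeriv (fun y => L.log (g y)) x w) := by
  have hO := L.isChart.isOpen_image.isOpen_inter hg
  have hxO : x ∈ U ∩ g ⁻¹' (L.exp '' L.dom) :=
    ⟨hx, by rw [mem_preimage, hgx, ← L.exp_zero]; exact ⟨0, L.zero_mem, rfl⟩⟩
  have hg' := hg.mono hO inter_subset_left
  have h1 := hX.plot_smul hg (SmoothSpace.const p hg.isOpen)
  have h1' := h1.mono hO inter_subset_left
  rw [← ω.at_mono h1 h1' inter_subset_left (eqOn_refl _ _) hxO]
  -- Near `x` one has g = exp ∘ log ∘ g, so the curve g·p is the standard orbit plot reparametrized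
  -- by log ∘ g.
  have := ω.natural _ _ L.dom _ _ _ (fun y => L.log (g y)) (L.plot_exp_smul hX p) h1'
    (L.isChart.smooth_inv E _ g hg' fun y hy => hy.2) (fun y hy => L.log_mem hy.2)
    (fun y hy => by simp only [Function.comp]; rw [L.exp_log hy.2]) x hxO ![w]
  unfold SmoothForm.moment SmoothForm.at
  rw [this, hgx, L.log_one]
  congr 1
  ext i; fin_cases i; rfl

/-- The Leibniz rule: y ↦ g(y)·c(y) is the diagonal restriction of the two-variable plot (y, y') ↦
g(y)·c(y'), and linearity of the form splits the diagonal vector into its two partial directions.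
The group direction gives a moment. -/
theorem SmoothForm.at_smul (hG : IsLieGrp G) (hX : IsSmoothAction G X) (ω : SmoothForm 1 X V)
    {g : E → G} {c : E → X} (hg : IsPlot U g) (hc : IsPlot U c) {x : E} (hx : x ∈ U) (w : E) :
    ω.at U (fun y => g y • c y) x ![w] =
      ω.moment L (g x • c x) (L.dlog g x w) + ω.at U (fun y => g x • c y) x ![w] := by
  have hUU : IsOpen (U ×ˢ U) := hg.isOpen.prod hg.isOpen
  have hg1 : IsPlot (E := E.prod E) (U ×ˢ U) (fun p => g p.1) := by
    simpa using hg.comp_affine (E' := E.prod E) hUU (ContinuousLinearMap.fst ℝ E E) 0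
      (fun p hp => by simpa using hp.1)
  have hc1 : IsPlot (E := E.prod E) (U ×ˢ U) (fun p => c p.2) := by
    simpa using hc.comp_affine (E' := E.prod E) hUU (ContinuousLinearMap.snd ℝ E E) 0
      (fun p hp => by simpa using hp.2)
  have hb := hX.plot_smul hg1 hc1
  have e1 := ω.at_affine hb (hX.plot_smul hg hc)
    ((ContinuousLinearMap.id ℝ E).prod (ContinuousLinearMap.id ℝ E)) 0
    (fun y hy => by simpa using hy) (fun y hy => by simp) hx ![w]
  have e2 := ω.at_affine hb (hX.plot_smul hg (SmoothSpace.const (c x) hg.isOpen))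
    (ContinuousLinearMap.inl ℝ E E) (0, x)
    (fun y hy => by simpa using ⟨hy, hx⟩) (fun y hy => by simp) hx ![w]
  have e3 := ω.at_affine hb (hX.plot_const_smul (g x) hc)
    (ContinuousLinearMap.inr ℝ E E) (x, 0)
    (fun y hy => by simpa using ⟨hx, hy⟩) (fun y hy => by simp) hx ![w]
  -- Writing g(y)·c(x) = (g(y) g(x)⁻¹)·(g(x)·c(x)) gives a group-valued plot equal to 1 at `x`,
  -- acting on a fixed point.
  have hgg := hG.plot_mul hg (SmoothSpace.const (g x)⁻¹ hg.isOpen)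
  have e4 := ω.at_smul_of_eq_one L hX hgg hx (mul_inv_cancel _) (g x • c x) w
  simp only [mul_smul, inv_smul_smul] at e4
  have hv : ∀ ℓ : E →L[ℝ] E × E, (fun i => ℓ (![w] i)) = ![ℓ w] := fun ℓ => by
    ext i <;> fin_cases i <;> rfl
  erw [hv] at e1 e2 e3
  unfold LieAlg.dlog
  rw [e1, ← e4, e2, e3]
  have := ω.at_one_add (E := E.prod E) (U ×ˢ U) (fun p => g p.1 • c p.2) (x, x) (w, 0) (0, w)
  simpa using this

end Action

/-! ## Connections on principal `G`-bundles and moments -/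

section Connection

variable {G : Type u} [Group G] [SmoothSpace G] {L : LieAlg G} {M : Type u} [SmoothSpace M]
  [MulAction G M] {Ξ : SmoothForm 1 M L.𝔤}

/-- A connection inverts the infinitesimal action, so it recovers the chart-defined `Ad` from
conjugated orbit maps at any point of `M`. -/
theorem IsGConnection.Ad_eq (hG : IsLieGrp G) (hM : IsSmoothAction G M) (hΞ : IsGConnection L Ξ)
    (g : G) (m : M) (X : L.𝔤) :
    Ξ.at L.dom (fun ξ => (g * L.exp ξ * g⁻¹) • m) 0 ![X] = L.Ad g X := by
  have h1 : IsPlot L.dom (fun ξ => g * L.exp ξ * g⁻¹) :=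
    hG.plot_mul (hG.plot_mul (SmoothSpace.const g L.isChart.isPlot.isOpen) L.isChart.isPlot)
      (SmoothSpace.const g⁻¹ L.isChart.isPlot.isOpen)
  rw [Ξ.at_smul_of_eq_one L hM h1 L.zero_mem (by simp [L.exp_zero]) m X, hΞ.vertical]
  rfl

/-- Read off from the connection at a point instead of by differentiating conjugations: translating
the plot ξ ↦ (g exp ξ g⁻¹)·g·m by g⁻¹ yields ξ ↦ exp ξ · m, whose value under Ξ is `X`. -/
theorem IsGConnection.Ad_inv_Ad (hG : IsLieGrp G) (hM : IsSmoothAction G M)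
    (hΞ : IsGConnection L Ξ) (m : M) (g : G) (X : L.𝔤) : L.Ad g⁻¹ (L.Ad g X) = X := by
  have h1 : IsPlot L.dom (fun ξ => (g * L.exp ξ * g⁻¹) • g • m) :=
    hM.plot_smul (hG.plot_mul (hG.plot_mul (SmoothSpace.const g L.isChart.isPlot.isOpen)
      L.isChart.isPlot) (SmoothSpace.const g⁻¹ L.isChart.isPlot.isOpen))
      (SmoothSpace.const _ L.isChart.isPlot.isOpen)
  have h2 := hΞ.equivariant g⁻¹ _ _ _ h1 0 L.zero_mem ![X]
  rw [hΞ.Ad_eq hG hM] at h2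
  rw [← h2]
  simp only [← mul_smul, mul_assoc, inv_mul_cancel_left, inv_mul_cancel, mul_one]
  exact hΞ.vertical m X

/-- The properties of a function `μ : M → 𝔤^†` under which `⟨Ξ|μ⟩` is an invariant 1-form whose
differential is `⟨dΞ|μ⟩`. -/
structure IsLocallyConstantMoment (L : LieAlg G) (μ : M → (L.𝔤 →ₗ[ℝ] ℝ)) : Prop where
  continuous : ∀ m, Continuous (μ m)
  locallyConst : ∀ (E : LCS.{u}) (U : Set E) (c : E → M), IsPlot U c → ∀ x ∈ U,
    ∃ V ∈ 𝓝 x, ∀ y ∈ V, μ (c y) = μ (c x)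
  smul : ∀ (g : G) (m : M) (X : L.𝔤), μ (g • m) X = μ m (L.Ad g⁻¹ X)

namespace IsLocallyConstantMoment

variable {μ : M → (L.𝔤 →ₗ[ℝ] ℝ)}

/-- The 1-form `⟨Ξ|μ⟩`. -/
def form (hμ : IsLocallyConstantMoment L μ) (Ξ : SmoothForm 1 M L.𝔤) : SmoothForm 1 M ℝ where
  toFun E U c x := (μ (c x)).compAlternatingMap (Ξ.toFun E U c x)
  eq_zero E U c x h := by rw [Ξ.eq_zero _ _ _ _ h]; ext; simp
  smooth E U c hc := by
    refine IsSmoothOn.of_local fun p hp => ?_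
    -- Near the point μ is one fixed continuous functional applied to Ξ, so no product rule is
    -- needed.
    obtain ⟨V, hV, hμV⟩ := hμ.locallyConst E U c hc p.1 hp.1
    have hO : IsOpen ((U ∩ interior V) ×ˢ (univ : Set (Fin 1 → E))) :=
      (hc.isOpen.inter isOpen_interior).prod isOpen_univ
    refine ⟨_, hO, ⟨⟨hp.1, mem_interior_iff_mem_nhds.2 hV⟩, trivial⟩, ?_⟩
    have h1 := (Ξ.smooth E U c hc).mono
      (prod_mono (inter_subset_left (t := interior V)) (Subset.refl (univ : Set (Fin 1 → E))))
    intro n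
    have h2 := CnOn.clm_comp (⟨μ (c p.1), hμ.continuous _⟩ : L.𝔤 →L[ℝ] ℝ) hO (h1 n)
    refine h2.congr hO fun p' hp' => ?_
    simp only [LinearMap.compAlternatingMap_apply, ContinuousLinearMap.coe_mk',
      hμV _ (interior_subset hp'.1.2)]
  natural E E' U U' c c' h hc hc' hh hm heq x hx w := by
    simp only [LinearMap.compAlternatingMap_apply]
    rw [Ξ.natural E E' U U' c c' h hc hc' hh hm heq x hx w, heq hx]
    rfl

theorem form_at (hμ : IsLocallyConstantMoment L μ) {E : LCS.{u}} (U : Set E) (c : E → M) (x : E)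
    (w : Fin 1 → E) : (hμ.form Ξ).at U c x w = μ (c x) (Ξ.at U c x w) := rfl

theorem form_moment (hμ : IsLocallyConstantMoment L μ) (hΞ : IsGConnection L Ξ) (m : M)
    (X : L.𝔤) : (hμ.form Ξ).moment L m X = μ m X := by
  have := hΞ.vertical m X
  unfold SmoothForm.moment at *
  rw [hμ.form_at, this, L.exp_zero, one_smul]

/-- The Ad_{g⁻¹} from the equivariance of μ cancels the Ad_g from that of Ξ. -/
theorem form_isInvariant (hμ : IsLocallyConstantMoment L μ) (hG : IsLieGrp G)
    (hM : IsSmoothAction G M) (hΞ : IsGConnection L Ξ) : (hμ.form Ξ).IsInvariant G := by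
  intro g E U c hc x hx w
  rw [hμ.form_at, hμ.form_at, hμ.smul, hΞ.equivariant g E U c hc x hx w,
    hΞ.Ad_inv_Ad hG hM (c x)]

end IsLocallyConstantMoment

end Connection

/-! ## Admissible maps -/

namespace BundleGerbe

section Admissible

variable {G : Type u} [Group G] [SmoothSpace G] {L : LieAlg G} {M : Type u} [SmoothSpace M]
  [MulAction G M] {Ξ : SmoothForm 1 M L.𝔤} {𝒢 : BundleGerbe M} [StronglyEquivariant G 𝒢]
  {𝒟 : 𝒢.ConnCurv} {lam lam' : 𝒢.Y → (L.𝔤 →ₗ[ℝ] ℝ)}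

theorem IsAdmissible.continuous (h : IsAdmissible L 𝒟 lam) (y : 𝒢.Y) : Continuous (lam y) := by
  have := (h.smooth L.𝔤 univ _ (SmoothSpace.const y isOpen_univ)).continuousOn
  simp only [univ_prod_univ, continuousOn_univ] at this
  exact this.comp (continuous_const.prodMk continuous_id : Continuous fun X : L.𝔤 => ((0 : L.𝔤), X))

/-- The derivative is expressed through `𝒟` alone, so any two admissible maps have the same one. -/
theorem IsAdmissible.hasDirDeriv (h : IsAdmissible L 𝒟 lam) {E : LCS.{u}} {U : Set E}
    {c : E → 𝒢.Y} (hc : IsPlot U c) {x : E} (hx : x ∈ U) (w : E) (X : L.𝔤) :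
    HasDirDeriv (fun y => lam (c y) X) x w (- 𝒟.curv.contract L X U c x w) := by
  have h1 := (h.smooth E U c hc).comp_affine (ContinuousLinearMap.inl ℝ E L.𝔤) (0, X) (V := U)
    fun y hy => by simpa using hy
  have h2 := h1.hasDirDeriv hx w
  simp only [ContinuousLinearMap.inl_apply, Prod.mk_add_mk, add_zero, zero_add] at h2
  rwa [eq_neg_of_add_eq_zero_left (h.E_eq_zero E U c hc x hx w X)] at h2

/-- Product rule for the pairing of `lam` with Ξ. In the term where Ξ is differentiated, base point
and argument of `lam` move together, so joint continuity of `lam` is used at (x, ξ). -/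
theorem IsAdmissible.kappa_hasDirDeriv (h : IsAdmissible L 𝒟 lam) (Ξ : SmoothForm 1 M L.𝔤)
    {E : LCS.{u}} {U : Set E} {c : E → 𝒢.Y} (hc : IsPlot U c) {x : E} (hx : x ∈ U)
    (w : Fin 1 → E) (v : E) :
    ∃ a, HasDirDeriv (fun y => kappa L 𝒢 Ξ lam U c y w) x v a := by
  have hπ : IsPlot U (𝒢.π ∘ c) := 𝒢.submersion.smooth.comp_plot hc
  obtain ⟨ξ, hξ⟩ := Ξ.exists_hasDirDeriv hπ hx w v
  have h1 := h.hasDirDeriv hc hx v (Ξ.at U (𝒢.π ∘ c) x w)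
  have h2 : Tendsto (fun t : ℝ => lam (c (x + t • v))
      (t⁻¹ • (Ξ.at U (𝒢.π ∘ c) (x + t • v) w - Ξ.at U (𝒢.π ∘ c) x w))) (𝓝[≠] 0)
      (𝓝 (lam (c x) ξ)) := by
    have h3 : ContinuousAt (fun p : E × L.𝔤 => lam (c p.1) p.2) (x, ξ) :=
      (h.smooth E U c hc).continuousOn.continuousAt
        ((hc.isOpen.prod isOpen_univ).mem_nhds ⟨hx, trivial⟩)
    have h4 : Tendsto (fun t : ℝ => x + t • v) (𝓝[≠] 0) (𝓝 x) := by
      have := (Continuous.tendsto (by fun_prop : Continuous fun t : ℝ => x + t • v) 0).mono_left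
        (nhdsWithin_le_nhds (s := {0}ᶜ))
      simpa using this
    exact h3.tendsto.comp (h4.prodMk_nhds hξ)
  refine ⟨_, (h2.add h1).congr fun t => ?_⟩
  simp only [kappa, map_smul, map_sub, ← smul_add]
  congr 1
  ring

/-- The derivatives of the two maps cancel, so the difference has zero derivative along lines. Local
convexity provides a neighbourhood in which every point is joined to `x` by a segment, and on a
segment this is the one-variable theorem. -/
theorem IsAdmissible.exists_nhds_sub_eq (h : IsAdmissible L 𝒟 lam) (h' : IsAdmissible L 𝒟 lam')
    {E : LCS.{u}} {U : Set E} {c : E → 𝒢.Y} (hc : IsPlot U c) {x : E} (hx : x ∈ U) :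
    ∃ V ∈ 𝓝 x, ∀ y ∈ V, lam' (c y) - lam (c y) = lam' (c x) - lam (c x) := by
  obtain ⟨V, hV, hconv, hVU⟩ := (locallyConvexSpace_iff_exists_convex_subset ℝ E).1 inferInstance x
    U (hc.isOpen.mem_nhds hx)
  have hxV := mem_of_mem_nhds hV
  refine ⟨V, hV, fun y hy => ?_⟩
  ext X
  have hmem : ∀ t ∈ Icc (0 : ℝ) 1, x + t • (y - x) ∈ V := fun t ht =>
    hconv.add_smul_sub_mem hxV hy ht
  let f : ℝ → ℝ := fun t => lam' (c (x + t • (y - x))) X - lam (c (x + t • (y - x))) X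
  have hf : ∀ t ∈ Icc (0 : ℝ) 1, HasDerivAt f 0 t := fun t ht => by
    rw [hasDerivAt_iff_tendsto_slope_zero]
    have h1 := (h'.hasDirDeriv hc (hVU (hmem t ht)) (y - x) X).sub
      (h.hasDirDeriv hc (hVU (hmem t ht)) (y - x) X)
    rw [sub_self] at h1
    refine Tendsto.congr (fun s => ?_) h1
    simp only [f, add_smul, add_assoc]
  have := constant_of_has_deriv_right_zero (f := f) (a := 0) (b := 1)
    (fun t ht => (hf t ht).continuousAt.continuousWithinAt)
    (fun t ht => (hf t (Ico_subset_Icc_self ht)).hasDerivWithinAt) 1 (by simp)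
  simpa [f] using this

variable (G) in
theorem π_act (g : G) (y : 𝒢.Y) : 𝒢.π (g • y) = g • 𝒢.π y := StronglyEquivariant.π_smul g y

/-- Each property holds for lam' − lam on `Y` and is carried to `M` by the surjectivity and the
local sections of π. -/
theorem IsAdmissible.isLocallyConstantMoment (h : IsAdmissible L 𝒟 lam)
    (h' : IsAdmissible L 𝒟 lam') {μ : M → (L.𝔤 →ₗ[ℝ] ℝ)}
    (hμ : ∀ y, lam' y - lam y = μ (𝒢.π y)) : IsLocallyConstantMoment L μ where
  continuous m := by
    obtain ⟨y, rfl⟩ := 𝒢.submersion.surjective m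
    rw [← hμ]
    exact (h'.continuous y).sub (h.continuous y)
  locallyConst E U c hc x hx := by
    obtain ⟨V, c', h1, h2, h3, h4⟩ :=
      𝒢.submersion.hasLocalSections.isSubduction.lift E U c hc x hx
    obtain ⟨O, hO, hOc⟩ := h.exists_nhds_sub_eq h' h3 h1
    refine ⟨V ∩ O, inter_mem (h3.isOpen.mem_nhds h1) hO, fun y hy => ?_⟩
    rw [h4 hy.1, h4 h1]
    simp only [Function.comp, ← hμ, hOc y hy.2]
  smul g m X := by
    obtain ⟨y, rfl⟩ := 𝒢.submersion.surjective m
    rw [← π_act, ← hμ, ← hμ, LinearMap.sub_apply, LinearMap.sub_apply,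
      sub_eq_zero.1 (h.ζ_eq_zero g y X), sub_eq_zero.1 (h'.ζ_eq_zero g y X)]

/-- Two points in one fibre of π are the two ends of some p ∈ P, and δ(lam' − lam) vanishes there
because both δ's equal the moment of ∇. -/
theorem IsAdmissible.exists_moment (h : IsAdmissible L 𝒟 lam) (h' : IsAdmissible L 𝒟 lam') :
    ∃ μ : M → (L.𝔤 →ₗ[ℝ] ℝ), ∀ y, lam' y - lam y = μ (𝒢.π y) := by
  choose y hy using 𝒢.submersion.surjective
  refine ⟨fun m => lam' (y m) - lam (y m), fun y' => ?_⟩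
  obtain ⟨p, hp⟩ := 𝒢.P.proj_surjective ⟨(y (𝒢.π y'), y'), hy _⟩
  ext X
  have h1 := h.δlam p X
  have h2 := h'.δlam p X
  simp only [BundleGerbe.fst, BundleGerbe.snd, hp] at h1 h2
  simp only [LinearMap.sub_apply]
  linarith

end Admissible

end BundleGerbe

namespace BundleGerbe

/-! ## Properties of the reduction -/

section Reduction

variable {G : Type u} [Group G] [SmoothSpace G] {L : LieAlg G} {M : Type u} [SmoothSpace M]
  [MulAction G M] {M' : Type u} [SmoothSpace M'] {q : M → M'} {Ξ : SmoothForm 1 M L.𝔤}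
  {𝒢 : BundleGerbe M} [StronglyEquivariant G 𝒢]
  {𝒟 : 𝒢.ConnCurv} {𝒢' : BundleGerbe M'} {qY : 𝒢.Y → 𝒢'.Y} {qP : 𝒢.P.Tot → 𝒢'.P.Tot}
  {lam₁ lam₂ : 𝒢.Y → (L.𝔤 →ₗ[ℝ] ℝ)} {𝒟₁ 𝒟₂ : 𝒢'.ConnCurv}

theorem smooth_fst (𝒢 : BundleGerbe M) : IsSmoothMap 𝒢.fst :=
  isSmoothMap_fst.comp ((isSmoothMap_val _).comp 𝒢.P.smooth_proj)

theorem smooth_snd (𝒢 : BundleGerbe M) : IsSmoothMap 𝒢.snd :=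
  isSmoothMap_snd.comp ((isSmoothMap_val _).comp 𝒢.P.smooth_proj)

theorem π_fst (𝒢 : BundleGerbe M) (p : 𝒢.P.Tot) : 𝒢.π (𝒢.fst p) = 𝒢.π (𝒢.snd p) :=
  (𝒢.P.proj p).2

/-- A pair of plots of `Y` with the same projection to `M` lifts locally to `P`. -/
theorem exists_plot_lift (𝒢 : BundleGerbe M) {E : LCS.{u}} {U : Set E} {y₁ y₂ : E → 𝒢.Y}
    (h₁ : IsPlot U y₁) (h₂ : IsPlot U y₂) (h : ∀ x ∈ U, 𝒢.π (y₁ x) = 𝒢.π (y₂ x)) {x : E}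
    (hx : x ∈ U) : ∃ (V : Set E) (p : E → 𝒢.P.Tot), x ∈ V ∧ V ⊆ U ∧ IsPlot V p ∧
      ∀ z ∈ V, (𝒢.P.proj (p z)).1 = (y₁ z, y₂ z) := by
  classical
  let c : E → FibProd 𝒢.π 𝒢.π := fun z =>
    if hz : z ∈ U then ⟨(y₁ z, y₂ z), h z hz⟩ else ⟨(y₁ x, y₂ x), h x hx⟩
  have hc : ∀ z ∈ U, (c z).1 = (y₁ z, y₂ z) := fun z hz => by simp [c, hz]
  have hplot : IsPlot U c :=
    ⟨h₁.congr fun z hz => by simp [hc z hz], h₂.congr fun z hz => by simp [hc z hz]⟩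
  obtain ⟨V, p, h3, h4, h5, h6⟩ := 𝒢.P.hasLocalSections.isSubduction.lift E U c hplot x hx
  exact ⟨V, p, h3, h4, h5, fun z hz => by rw [← hc z (h4 hz), h6 hz]; rfl⟩

theorem exists_proj_eq (𝒢 : BundleGerbe M) {y₁ y₂ : 𝒢.Y} (h : 𝒢.π y₁ = 𝒢.π y₂) :
    ∃ p, (𝒢.P.proj p).1 = (y₁, y₂) := by
  obtain ⟨p, hp⟩ := 𝒢.P.proj_surjective ⟨(y₁, y₂), h⟩
  exact ⟨p, by rw [hp]⟩

/-- The two κ's differ by a form pulled back from `M`, which has the same value at both ends of a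
point of `P` and so drops out of δκ. -/
theorem IsReduction.nabla_unique (hquot : IsQuotient G q 𝒢 𝒢' qY qP)
    (h₁ : IsReduction L qY qP Ξ 𝒟 lam₁ 𝒟₁) (h₂ : IsReduction L qY qP Ξ 𝒟 lam₂ 𝒟₂)
    {μ : M → (L.𝔤 →ₗ[ℝ] ℝ)} (hμ : ∀ y, lam₂ y - lam₁ y = μ (𝒢.π y)) : 𝒟₁.nabla = 𝒟₂.nabla := by
  refine SmoothForm.ext_of_subduction hquot.quotP.isSubduction fun E U p hp x hx w => ?_
  rw [h₁.nabla_eq E U p hp x hx w, h₂.nabla_eq E U p hp x hx w]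
  have h3 : 𝒢.π ∘ 𝒢.fst ∘ p = 𝒢.π ∘ 𝒢.snd ∘ p := funext fun z => 𝒢.π_fst _
  have h4 : lam₂ (𝒢.snd (p x)) - lam₁ (𝒢.snd (p x)) =
      lam₂ (𝒢.fst (p x)) - lam₁ (𝒢.fst (p x)) := by rw [hμ, hμ, π_fst]
  have h5 := congrArg (fun ℓ : L.𝔤 →ₗ[ℝ] ℝ => ℓ (Ξ.at U (𝒢.π ∘ 𝒢.snd ∘ p) x w)) h4
  simp only [LinearMap.sub_apply] at h5
  simp only [kappa, h3, Function.comp_apply]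
  linarith

/-- The difference of curvings is compared with −dβ over any pair of plots of Y/G and M with the
same image in M/G, so neither form has to be descended to M/G. -/
theorem IsReduction.curv_sub (hG : IsLieGrp G) (hq : IsPrincipalQuotient G q)
    (hquot : IsQuotient G q 𝒢 𝒢' qY qP) (hlam₁ : IsAdmissible L 𝒟 lam₁)
    (h₁ : IsReduction L qY qP Ξ 𝒟 lam₁ 𝒟₁) (h₂ : IsReduction L qY qP Ξ 𝒟 lam₂ 𝒟₂)
    {μ : M → (L.𝔤 →ₗ[ℝ] ℝ)} (hμ : ∀ y, lam₂ y - lam₁ y = μ (𝒢.π y))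
    (hμ' : IsLocallyConstantMoment L μ) {E : LCS.{u}} {U : Set E} {y : E → 𝒢'.Y} {m : E → M}
    (hy : IsPlot U y) (hm : IsPlot U m) (hym : ∀ x ∈ U, 𝒢'.π (y x) = q (m x)) {x : E}
    (hx : x ∈ U) (w : Fin 2 → E) :
    𝒟₂.curv.at U y x w - 𝒟₁.curv.at U y x w = - extD ((hμ'.form Ξ).at U m) x w := by
  obtain ⟨V, c₀, hxV, hVU, hc₀, hlift⟩ :=
    hquot.quotY.hasLocalSections.isSubduction.lift E U y hy x hx
  have hmV := hm.mono hc₀.isOpen hVU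
  -- The lift c₀ of `y` to `Y` need only project into the orbit of `m`. Moving it by `g` makes it
  -- lie exactly over `m` without changing its image in Y/G.
  obtain ⟨g, hg, hgm⟩ := hq.exists_smul_eq hG (𝒢.submersion.smooth.comp_plot hc₀) hmV
    fun z hz => by
      rw [← hym z (hVU hz), hlift hz, ← hquot.π_qY]; rfl
  have hc : IsPlot V (fun z => g z • c₀ z) := StronglyEquivariant.smoothY.plot_smul hg hc₀
  have hcy : EqOn (qY ∘ fun z => g z • c₀ z) y V := fun z hz => by
    rw [hlift hz, Function.comp_apply, hquot.quotY.map_smul]; rfl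
  have hcm : EqOn (𝒢.π ∘ fun z => g z • c₀ z) m V := fun z hz => by
    rw [Function.comp_apply, π_act, hgm z hz]
  have hcy' := hquot.quotY.smooth.comp_plot hc
  rw [← 𝒟₂.curv.at_mono hy hcy' hVU hcy hxV, ← 𝒟₁.curv.at_mono hy hcy' hVU hcy hxV]
  have e1 := h₁.curv_eq E V _ hc x hxV w
  have e2 := h₂.curv_eq E V _ hc x hxV w
  have hβ : ∀ z ∈ V, ∀ w, kappa L 𝒢 Ξ lam₂ V (fun z => g z • c₀ z) z w =
      kappa L 𝒢 Ξ lam₁ V (fun z => g z • c₀ z) z w + (hμ'.form Ξ).at V m z w := fun z hz w => by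
    rw [hμ'.form_at]
    unfold kappa
    rw [Ξ.at_congr hmV hcm hz]
    have h3 := hμ (g z • c₀ z)
    rw [show 𝒢.π (g z • c₀ z) = m z from hcm hz] at h3
    rw [← h3, LinearMap.sub_apply]
    ring
  have e3 := extD_congr (hc.isOpen.mem_nhds hxV) hβ w
  rw [extD_add (hlam₁.kappa_hasDirDeriv Ξ hc hxV)
    ((hμ'.form Ξ).exists_hasDirDeriv hmV hxV)] at e3
  have e4 : extD ((hμ'.form Ξ).at V m) x w = extD ((hμ'.form Ξ).at U m) x w :=
    extD_congr (hc.isOpen.mem_nhds hxV)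
      (fun z hz w => (hμ'.form Ξ).at_mono hm hmV hVU (eqOn_refl _ _) hz w) w
  change 𝒟₁.curv.at V (fun z => qY (g z • c₀ z)) x w = _ at e1
  change 𝒟₂.curv.at V (fun z => qY (g z • c₀ z)) x w = _ at e2
  linarith

end Reduction

/-! ## The equivariant bundle of a stable isomorphism -/

/-- The diagonal of `Y ×_M Y`. -/
abbrev diag {M : Type u} [SmoothSpace M] (𝒢 : BundleGerbe M) (y : 𝒢.Y) : FibProd 𝒢.π 𝒢.π :=
  ⟨(y, y), rfl⟩

theorem smooth_diag {M : Type u} [SmoothSpace M] (𝒢 : BundleGerbe M) : IsSmoothMap 𝒢.diag :=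
  fun _ _ _ hc _ => ⟨hc, hc⟩

namespace StableIso

variable {M : Type u} {M' : Type u} [SmoothSpace M'] {𝒢' : BundleGerbe M'}
  {𝒟₁ 𝒟₂ : 𝒢'.ConnCurv} (S : StableIso 𝒟₁ 𝒟₂) (q : M → M')

/-- The pull-back to `M ×_{M'} Y` of the restriction of `R` to the diagonal. -/
abbrev Cover : Type u := FibProd (fun a : FibProd q 𝒢'.π => 𝒢'.diag a.1.2) S.R.proj

variable {S q}

/-- The component in `M`. -/
abbrev Cover.base (x : S.Cover q) : M := x.1.1.1.1

/-- The component in `Y`. -/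
abbrev Cover.pt (x : S.Cover q) : 𝒢'.Y := x.1.1.1.2

/-- The component in `R`. -/
abbrev Cover.fib (x : S.Cover q) : S.R.Tot := x.1.2

theorem Cover.q_base (x : S.Cover q) : q x.base = 𝒢'.π x.pt := x.1.1.2

theorem Cover.proj_fib (x : S.Cover q) : (S.R.proj x.fib).1 = (x.pt, x.pt) :=
  congrArg Subtype.val x.2.symm

/-- The action of `𝕋` on the cover. -/
def Cover.act (z : Circle) (x : S.Cover q) : S.Cover q :=
  ⟨(x.1.1, z • x.1.2), by rw [S.R.proj_smul]; exact x.2⟩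

/-- Replacing p by b p in both slots multiplies v by b⁻¹ b = 1: this is the canonical triviality of
P⁻¹ ⊗ P. If no such p exists, the value 1 is arbitrary. -/
theorem Cover.exists_factor (x x' : S.Cover q) : ∃ t : Circle, ∀ p : 𝒢'.P.Tot,
    (𝒢'.P.proj p).1 = (x.pt, x'.pt) → S.v x.fib x'.fib p p = t := by
  by_cases h : ∃ p : 𝒢'.P.Tot, (𝒢'.P.proj p).1 = (x.pt, x'.pt)
  · obtain ⟨p, hp⟩ := h
    refine ⟨S.v x.fib x'.fib p p, fun p' hp' => ?_⟩
    obtain ⟨b, rfl⟩ := (𝒢'.P.fiber p p').1 (Subtype.ext (hp.trans hp'.symm))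
    have := S.v_smul _ _ _ _ x.fib x'.fib p p x.proj_fib x'.proj_fib hp hp 1 1 b b
    simpa using this
  · exact ⟨1, fun p hp => absurd ⟨p, hp⟩ h⟩

/-- The descent datum on the restriction of `R` to the diagonal. -/
noncomputable def Cover.factor (x x' : S.Cover q) : Circle := (Cover.exists_factor x x').choose

theorem Cover.factor_eq (x x' : S.Cover q) {p : 𝒢'.P.Tot}
    (hp : (𝒢'.P.proj p).1 = (x.pt, x'.pt)) : S.v x.fib x'.fib p p = x.factor x' :=
  (Cover.exists_factor x x').choose_spec p hp

theorem Cover.exists_p {x x' : S.Cover q} (h : x.base = x'.base) :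
    ∃ p, (𝒢'.P.proj p).1 = (x.pt, x'.pt) :=
  𝒢'.exists_proj_eq (by rw [← x.q_base, ← x'.q_base, h])

/-- With the same points of `P` in both gerbe slots the right side of δv = s⁻¹ ⊗ s' is 1, and δv = 1
is the cocycle identity. -/
theorem Cover.factor_trans {x x' x'' : S.Cover q} (h : x.base = x'.base)
    (h' : x'.base = x''.base) : x.factor x' * x'.factor x'' = x.factor x'' := by
  obtain ⟨p₁₂, h₁₂⟩ := Cover.exists_p h
  obtain ⟨p₂₃, h₂₃⟩ := Cover.exists_p h'
  obtain ⟨p₁₃, h₁₃⟩ := Cover.exists_p (h.trans h')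
  have := S.δv_eq _ _ _ _ _ _ x.fib x'.fib x''.fib p₂₃ p₁₃ p₁₂ p₂₃ p₁₃ p₁₂ x.proj_fib x'.proj_fib
    x''.proj_fib h₂₃ h₁₃ h₁₂ h₂₃ h₁₃ h₁₂
  rw [inv_mul_cancel, Cover.factor_eq _ _ h₁₂, Cover.factor_eq _ _ h₁₃,
    Cover.factor_eq _ _ h₂₃, mul_right_comm, mul_inv_eq_one] at this
  rw [mul_comm, this]

theorem Cover.factor_act_left {x x' : S.Cover q} (h : x.base = x'.base) (z : Circle) :
    (Cover.act z x).factor x' = z * x.factor x' := by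
  obtain ⟨p, hp⟩ := Cover.exists_p h
  rw [← Cover.factor_eq _ _ hp, ← Cover.factor_eq (Cover.act z x) x' hp]
  have := S.v_smul _ _ _ _ x.fib x'.fib p p x.proj_fib x'.proj_fib hp hp z 1 1 1
  simpa [Cover.act, Cover.fib] using this

variable [SmoothSpace M]

theorem Cover.smooth_base : IsSmoothMap (Cover.base : S.Cover q → M) :=
  fun _ _ _ hc _ => hc.1.1

theorem Cover.smooth_pt : IsSmoothMap (Cover.pt : S.Cover q → 𝒢'.Y) :=
  fun _ _ _ hc _ => hc.1.2

theorem Cover.smooth_fib : IsSmoothMap (Cover.fib : S.Cover q → S.R.Tot) :=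
  fun _ _ _ hc _ => hc.2

theorem Cover.factor_smooth {E : LCS.{u}} {U : Set E} {c c' : E → S.Cover q} (hc : IsPlot U c)
    (hc' : IsPlot U c') (h : ∀ x ∈ U, (c x).base = (c' x).base) :
    IsCircleSmoothOn U (fun x => (c x).factor (c' x)) := by
  refine IsCircleSmoothOn.of_local fun x hx => ?_
  obtain ⟨V, p, h1, h2, h3, h4⟩ := 𝒢'.exists_plot_lift (Cover.smooth_pt.comp_plot hc)
    (Cover.smooth_pt.comp_plot hc') (fun z hz => by
      rw [← Cover.q_base, ← Cover.q_base, h z hz]) hx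
  exact ⟨V, _, h3.isOpen, h1, S.v_smooth E V _ _ _ _ _ _ p p
    ((Cover.smooth_fib.comp_plot hc).mono h3.isOpen h2)
    ((Cover.smooth_fib.comp_plot hc').mono h3.isOpen h2) h3 h3 (fun z _ => (c z).proj_fib)
    (fun z _ => (c' z).proj_fib) h4 h4, fun z hz => Cover.factor_eq _ _ (h4 z hz)⟩

variable (S)

theorem isDescentDatum {q : M → M'} (hq : IsSmoothMap q) :
    IsDescentDatum Cover.act (Cover.base : S.Cover q → M) Cover.factor where
  sections := (𝒢'.submersion.hasLocalSections.pullback hq).comp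
    (S.R.hasLocalSections.pullback
      (𝒢'.smooth_diag.comp (isSmoothMap_snd.comp (isSmoothMap_val _))))
  act_one x := by simp [Cover.act]
  act_mul z z' x := by simp [Cover.act, mul_smul]
  smooth_act E U c z hc hz := ⟨hc.1, S.R.smooth_act E U _ z hc.2 hz⟩
  proj_act _ _ := rfl
  trans _ _ _ := Cover.factor_trans
  act_left z _ _ h := Cover.factor_act_left h z
  smooth _ _ _ _ := Cover.factor_smooth

/-- On related plots v is constantly 1, so its logarithmic derivative vanishes; the two ∇-terms of
`v_parallel` are taken on the same p and cancel because the connections agree. -/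
theorem η_eq_of_rel (hn : 𝒟₁.nabla = 𝒟₂.nabla) {E : LCS.{u}} {U : Set E} {c c' : E → S.Cover q}
    (hc : IsPlot U c) (hc' : IsPlot U c') (h : ∀ x ∈ U, (c x).base = (c' x).base ∧ (c x).factor (c' x) = 1) {x : E}
    (hx : x ∈ U) (w : E) : S.η.at U (fun y => (c y).fib) x ![w] =
      S.η.at U (fun y => (c' y).fib) x ![w] := by
  obtain ⟨V, p, h1, h2, h3, h4⟩ := 𝒢'.exists_plot_lift (Cover.smooth_pt.comp_plot hc)
    (Cover.smooth_pt.comp_plot hc') (fun z hz => by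
      rw [← Cover.q_base, ← Cover.q_base, (h z hz).1]) hx
  have hf := Cover.smooth_fib.comp_plot hc
  have hf' := Cover.smooth_fib.comp_plot hc'
  have e := S.v_parallel E V _ _ _ _ _ _ p p (hf.mono h3.isOpen h2) (hf'.mono h3.isOpen h2) h3 h3
    (fun z _ => (c z).proj_fib) (fun z _ => (c' z).proj_fib) h4 h4 x h1 w
  rw [dlog_congr (h3.isOpen.mem_nhds h1) (z' := fun _ => 1) fun z hz => by
      rw [← (h z (h2 hz)).2]; exact Cover.factor_eq _ _ (h4 z hz), dlog_const,
    S.η.at_mono hf (hf.mono h3.isOpen h2) h2 (eqOn_refl _ _) h1,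
    S.η.at_mono hf' (hf'.mono h3.isOpen h2) h2 (eqOn_refl _ _) h1, hn] at e
  linarith

variable {G : Type u} [Group G] [SmoothSpace G] [MulAction G M]

/-- The action of `G` on the cover. -/
def Cover.gact {S : StableIso 𝒟₁ 𝒟₂} {q : M → M'} (hq : IsPrincipalQuotient G q) (g : G)
    (x : S.Cover q) : S.Cover q :=
  ⟨(⟨(g • x.base, x.pt), by rw [hq.map_smul]; exact x.1.1.2⟩, x.fib), x.2⟩

/-- The factor involves only the components in Y and R, which G does not move. -/
theorem Cover.gact_rel {S : StableIso 𝒟₁ 𝒟₂} {q : M → M'} (hq : IsPrincipalQuotient G q) (g : G)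
    {x x' : S.Cover q} (h : x.base = x'.base ∧ x.factor x' = 1) :
    (Cover.gact hq g x).base = (Cover.gact hq g x').base ∧
      (Cover.gact hq g x).factor (Cover.gact hq g x') = 1 := by
  refine ⟨congrArg (g • ·) h.1, ?_⟩
  obtain ⟨p, hp⟩ := Cover.exists_p h.1
  rw [← h.2, ← Cover.factor_eq _ _ hp, ← Cover.factor_eq (Cover.gact hq g x) (Cover.gact hq g x') hp]
  rfl

/-- The bundle is R restricted to the diagonal, descended and pulled back to `M` in one step, with
connection η + β. Its curvature is f₂ − f₁ + dβ = 0, and only β contributes to the moment. -/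
theorem exists_equivariantFlatTBundle (S : StableIso 𝒟₁ 𝒟₂) (hn : 𝒟₁.nabla = 𝒟₂.nabla) {q : M → M'}
    (hq : IsPrincipalQuotient G q) {L : LieAlg G} (β : SmoothForm 1 M ℝ)
    (hβ : β.IsInvariant G)
    (hcurv : ∀ (E : LCS.{u}) (U : Set E) (y : E → 𝒢'.Y) (m : E → M), IsPlot U y → IsPlot U m →
      (∀ x ∈ U, 𝒢'.π (y x) = q (m x)) → ∀ x ∈ U, ∀ w : Fin 2 → E,
      𝒟₂.curv.at U y x w - 𝒟₁.curv.at U y x w = - extD (β.at U m) x w) :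
    ∃ 𝓡 : EquivariantFlatTBundle G M, ∀ (r : 𝓡.R.Tot) (X : L.𝔤),
      𝓡.η.moment L r X = β.moment L (𝓡.R.proj r) X := by
  have hpres := (S.isDescentDatum hq.smooth).isTBundlePresentation
  obtain ⟨R, k, hk⟩ := hpres.exists_quotient
  let θ := (S.η.pullback _ (Cover.smooth_fib (q := q))).add
    (β.pullback _ (Cover.smooth_base (S := S) (q := q)))
  have hθ : ∀ {E : LCS.{u}} {U : Set E} {c : E → S.Cover q}, IsPlot U c → ∀ x {n : Fin 1 → E},
      θ.at U c x n = S.η.at U (fun y => (c y).fib) x n + β.at U (fun y => (c y).base) x n :=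
    fun hc x n => by
      rw [SmoothForm.add_at, SmoothForm.pullback_at _ _ _ hc, SmoothForm.pullback_at _ _ _ hc]
  obtain ⟨η, hη, hηθ⟩ := hk.exists_connection hpres.smooth_act θ
    (fun E U c c' hc hc' h x hx w => by
      rw [hθ hc, hθ hc', S.η_eq_of_rel hn hc hc' h hx,
        β.at_congr (Cover.smooth_base.comp_plot hc') (fun y hy => (h y hy).1) hx])
    (fun E U c z hc hz x hx w => by
      rw [hθ (hpres.smooth_act E U c z hc hz), hθ hc]
      have := S.isConnection E U _ z (Cover.smooth_fib.comp_plot hc) hz x hx w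
      change S.η.at U (fun y => z y • (c y).fib) x ![w] +
        β.at U (fun y => (c y).base) x ![w] = _
      rw [this]; ring)
  -- The action is defined through arbitrary representatives; `Cover.gact_rel` makes it independent
  -- of them.
  choose kinv hkinv using hk.subduction.surjective
  let sm : G → R.Tot → R.Tot := fun g a => k (Cover.gact hq g (kinv a))
  have hsm : ∀ g x, sm g (k x) = k (Cover.gact hq g x) := fun g x =>
    (hk.eq_iff _ _).2 (Cover.gact_rel hq g ((hk.eq_iff _ _).1 (hkinv _)))
  let actG : MulAction G R.Tot :=
    { smul := sm
      one_smul := fun a => by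
        obtain ⟨x, rfl⟩ := hk.subduction.surjective a
        refine (hsm 1 x).trans (congrArg k ?_)
        simp [Cover.gact]
      mul_smul := fun g g' a => by
        obtain ⟨x, rfl⟩ := hk.subduction.surjective a
        refine (hsm (g * g') x).trans ?_
        refine Eq.trans (congrArg k ?_) ((congrArg (sm g) (hsm g' x)).trans (hsm g _)).symm
        simp [Cover.gact, mul_smul] }
  have hgk : ∀ (g : G) x, g • k x = k (Cover.gact hq g x) := hsm
  have hplot : ∀ {E : LCS.{u}} {U : Set E} {g : E → G} {c : E → S.Cover q}, IsPlot U g →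
      IsPlot U c → IsPlot U (fun x => Cover.gact hq (g x) (c x)) := fun hg hc =>
    ⟨⟨hq.smoothAction.plot_smul hg hc.1.1, hc.1.2⟩, hc.2⟩
  have hsmooth : IsSmoothAction G R.Tot := fun E U c hc _ => SmoothSpace.glue hc.1.isOpen
    fun x hx => by
      obtain ⟨V, c', h1, h2, h3, h4⟩ := hk.subduction.lift E U _ hc.2 x hx
      exact ⟨V, _, h1, h2, hk.subduction.smooth.comp_plot
        (hplot (hc.1.mono h3.isOpen h2) h3), fun y hy => by
          have := h4 hy
          simp only [Function.comp] at this ⊢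
          rw [this, hgk]⟩
  refine ⟨@EquivariantFlatTBundle.mk G _ _ M _ _ R actG ⟨hsmooth, fun g a => ?_, fun g z a => ?_⟩
    η hη (fun g E U c hc x hx w => ?_) (fun E U c hc x hx w => ?_), fun a X => ?_⟩
  · obtain ⟨x, rfl⟩ := hk.subduction.surjective a
    rw [hgk, hk.proj_eq, hk.proj_eq]; rfl
  · obtain ⟨x, rfl⟩ := hk.subduction.surjective a
    rw [← hk.act_eq, hgk, hgk, ← hk.act_eq]; rfl
  · obtain ⟨V, c', h1, h2, h3, h4⟩ := hk.subduction.lift E U c hc x hx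
    have h5 := hplot (SmoothSpace.const g h3.isOpen) h3
    rw [hηθ E U V c c' hc h3 h2 h4 x h1, hηθ E U V _ _ (hsmooth.plot_const_smul g hc) h5 h2
      (fun y hy => by rw [h4 hy, ← hgk]; rfl) x h1, hθ h3, hθ h5]
    exact congrArg _ (hβ g E V _ (Cover.smooth_base.comp_plot h3) x h1 w)
  · obtain ⟨V, c', h1, h2, h3, h4⟩ := hk.subduction.lift E U c hc x hx
    rw [extD_congr (h3.isOpen.mem_nhds h1) (fun y hy w => hηθ E U V c c' hc h3 h2 h4 y hy w),
      SmoothForm.extD_add _ _ h3 h1]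
    have e1 : ∀ (w), extD ((S.η.pullback _ (Cover.smooth_fib (q := q))).at V c') x w =
        extD (S.η.at V fun y => (c' y).fib) x w := fun w =>
      extD_congr (h3.isOpen.mem_nhds h1) (fun y hy w => SmoothForm.pullback_at _ _ _ h3 _ _) w
    have e2 : ∀ (w), extD ((β.pullback _ (Cover.smooth_base (S := S) (q := q))).at V c') x w =
        extD (β.at V fun y => (c' y).base) x w := fun w =>
      extD_congr (h3.isOpen.mem_nhds h1) (fun y hy w => SmoothForm.pullback_at _ _ _ h3 _ _) w
    rw [e1, e2, S.curvature E V _ (Cover.smooth_fib.comp_plot h3) x h1 w]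
    have e3 := hcurv E V _ _ (Cover.smooth_pt.comp_plot h3) (Cover.smooth_base.comp_plot h3)
      (fun y _ => (c' y).q_base.symm) x h1 w
    -- On the diagonal both components of the base point of R are the same point of `Y`, so F(η)
    -- becomes f₂ − f₁ there.
    simp only [Cover.proj_fib]
    linarith
  · obtain ⟨x, rfl⟩ := hk.subduction.surjective a
    have hdom := L.isChart.isPlot.isOpen
    have h5 := hplot L.isChart.isPlot (SmoothSpace.const x hdom)
    have h6 := L.plot_exp_smul hsmooth (k x)
    unfold SmoothForm.moment
    change η.at L.dom (fun ξ => L.exp ξ • k x) 0 ![X] = _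
    rw [hηθ _ L.dom L.dom _ _ h6 h5 Subset.rfl (fun y _ => hgk _ _) 0 L.zero_mem, hθ h5]
    change S.η.at L.dom (fun _ => x.fib) 0 ![X] + β.at L.dom (fun ξ => L.exp ξ • x.base) 0 ![X] = _
    -- Along the orbit the R-component is constant, so η contributes nothing to the moment.
    rw [S.η.at_const hdom x.fib L.zero_mem, zero_add]
    change _ = β.at L.dom (fun ξ => L.exp ξ • R.proj (k x)) 0 ![X]
    rw [hk.proj_eq]

end StableIso

end BundleGerbe

/-! ## Equivariant `𝕋`-bundles over a principal bundle -/

section OrbitRatio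

variable {G : Type u} [Group G] [SmoothSpace G] {M : Type u} [SmoothSpace M]
  [MulAction G M] {M' : Type u} [SmoothSpace M'] {q : M → M'} {R : TBundle M} [MulAction G R.Tot]

namespace TBundle

variable (G) in
/-- The circle valued `z` such that `g r = z r'` for some `g ∈ G`. -/
noncomputable def orbitRatio (R : TBundle M) [MulAction G R.Tot] (r r' : R.Tot) : Circle :=
  Classical.epsilon fun z : Circle => ∃ g : G, g • r = z • r'

/-- Freeness of G on `M` determines g from the base points, and freeness of 𝕋 then determines z. -/
theorem IsEquivariant.orbitRatio_eq (hR : R.IsEquivariant G) (hq : IsPrincipalQuotient G q)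
    {r r' : R.Tot} {z : Circle} {g : G} (h : g • r = z • r') : R.orbitRatio G r r' = z := by
  obtain ⟨g', hg'⟩ : ∃ g : G, g • r = R.orbitRatio G r r' • r' :=
    Classical.epsilon_spec (p := fun z : Circle => ∃ g : G, g • r = z • r') ⟨z, g, h⟩
  have h1 := congrArg R.proj h
  have h2 := congrArg R.proj hg'
  rw [hR.proj_smul, R.proj_smul] at h1 h2
  obtain rfl := hq.smul_left_cancel (h1.trans h2.symm)
  exact R.smul_left_cancel (hg'.symm.trans h)

theorem IsEquivariant.orbitRatio_spec (hR : R.IsEquivariant G) (hq : IsPrincipalQuotient G q)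
    {r r' : R.Tot} (h : q (R.proj r) = q (R.proj r')) :
    ∃ g : G, g • r = R.orbitRatio G r r' • r' := by
  obtain ⟨g, hg⟩ := (hq.fiber _ _).1 h
  rw [← hR.proj_smul] at hg
  obtain ⟨z, hz⟩ := (R.fiber _ _).1 hg.symm
  exact ⟨g, by rw [hR.orbitRatio_eq hq hz.symm, hz]⟩

theorem IsEquivariant.orbitRatio_trans (hR : R.IsEquivariant G) (hq : IsPrincipalQuotient G q)
    {r r' r'' : R.Tot} (h : q (R.proj r) = q (R.proj r')) (h' : q (R.proj r') = q (R.proj r'')) :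
    R.orbitRatio G r r' * R.orbitRatio G r' r'' = R.orbitRatio G r r'' := by
  obtain ⟨g, hg⟩ := hR.orbitRatio_spec hq h
  obtain ⟨g', hg'⟩ := hR.orbitRatio_spec hq h'
  refine (hR.orbitRatio_eq hq (g := g' * g) ?_).symm
  rw [mul_smul, hg, hR.smul_comm, hg', mul_smul]

theorem IsEquivariant.orbitRatio_symm (hR : R.IsEquivariant G) (hq : IsPrincipalQuotient G q)
    {r r' : R.Tot} (h : q (R.proj r) = q (R.proj r')) :
    (R.orbitRatio G r r')⁻¹ = R.orbitRatio G r' r := by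
  refine inv_eq_of_mul_eq_one_right ?_
  rw [hR.orbitRatio_trans hq h h.symm]
  exact hR.orbitRatio_eq hq (g := 1) (by simp)

theorem IsEquivariant.exists_smul_eq (hR : R.IsEquivariant G) (hG : IsLieGrp G)
    (hq : IsPrincipalQuotient G q) {E : LCS.{u}} {U : Set E} {c c' : E → R.Tot} (hc : IsPlot U c)
    (hc' : IsPlot U c') (h : ∀ x ∈ U, q (R.proj (c x)) = q (R.proj (c' x))) :
    ∃ g : E → G, IsPlot U g ∧ (∀ x ∈ U, g x • R.proj (c x) = R.proj (c' x)) ∧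
      ∀ x ∈ U, R.orbitRatio G (c x) (c' x) • c' x = g x • c x := by
  obtain ⟨g, hg, hgc⟩ := hq.exists_smul_eq hG (R.smooth_proj.comp_plot hc)
    (R.smooth_proj.comp_plot hc') h
  refine ⟨g, hg, hgc, fun x hx => ?_⟩
  have h1 := hgc x hx
  rw [← hR.proj_smul] at h1
  obtain ⟨z, hz⟩ := (R.fiber _ _).1 h1.symm
  rw [hR.orbitRatio_eq hq hz.symm, hz]

theorem IsEquivariant.orbitRatio_smooth (hR : R.IsEquivariant G) (hG : IsLieGrp G)
    (hq : IsPrincipalQuotient G q) {E : LCS.{u}} {U : Set E} {c c' : E → R.Tot} (hc : IsPlot U c)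
    (hc' : IsPlot U c') (h : ∀ x ∈ U, q (R.proj (c x)) = q (R.proj (c' x))) :
    IsCircleSmoothOn U (fun x => R.orbitRatio G (c x) (c' x)) := by
  obtain ⟨g, hg, -, hz⟩ := hR.exists_smul_eq hG hq hc hc' h
  exact R.isCircleSmoothOn_of_smul_eq hc' (hR.smoothAction.plot_smul hg hc) hz

/-- If `η` and a form `β` on the base have the same moment, then `η - β` descends to the
quotient. -/
theorem IsEquivariant.dlog_orbitRatio (hR : R.IsEquivariant G) (hG : IsLieGrp G)
    (hq : IsPrincipalQuotient G q) (L : LieAlg G) {η : SmoothForm 1 R.Tot ℝ}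
    {β : SmoothForm 1 M ℝ} (hη : R.IsConnection η) (hηG : η.IsInvariant G) (hβ : β.IsInvariant G)
    (hmom : ∀ (r : R.Tot) (X : L.𝔤), η.moment L r X = β.moment L (R.proj r) X)
    {E : LCS.{u}} {U : Set E} {c c' : E → R.Tot} (hc : IsPlot U c)
    (hc' : IsPlot U c') (h : ∀ x ∈ U, q (R.proj (c x)) = q (R.proj (c' x))) {x : E} (hx : x ∈ U)
    (w : E) : dlog (fun y => R.orbitRatio G (c y) (c' y)) x w =
      (η.at U c x ![w] - β.at U (fun y => R.proj (c y)) x ![w]) -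
      (η.at U c' x ![w] - β.at U (fun y => R.proj (c' y)) x ![w]) := by
  obtain ⟨g, hg, hgm, hgr⟩ := hR.exists_smul_eq hG hq hc hc' h
  have hz := hR.orbitRatio_smooth hG hq hc hc' h
  have hm := R.smooth_proj.comp_plot hc
  have hm' := R.smooth_proj.comp_plot hc'
  -- The form η is evaluated on z c' = g c in two ways: as η(c') + dlog z and, by the Leibniz rule,
  -- as a moment term plus η(c). The same moment term occurs for β on the base and cancels in the
  -- difference.
  have e1 := hη E U c' _ hc' hz x hx w
  rw [← η.at_congr (R.smooth_act E U c' _ hc' hz) (fun y hy => (hgr y hy).symm) hx,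
    η.at_smul L hG hR.smoothAction hg hc hx, hmom, hR.proj_smul,
    hηG (g x) E U c hc x hx] at e1
  have e2 := β.at_smul L hG hq.smoothAction hg hm hx w
  rw [hβ (g x) E U _ hm x hx, β.at_congr hm' hgm hx] at e2
  linarith

end TBundle

end OrbitRatio

namespace BundleGerbe

/-! ## The identity stable isomorphism of a bundle gerbe -/

section Identity

variable {M : Type u} [SmoothSpace M] (𝒢 : BundleGerbe M)

/-- The section of `δP⁻¹ ⊗ (P⁻¹ ⊗ P)` over `(Y ×_M Y)^[2]` induced by `s`. -/
noncomputable def idSection (u₁ u₂ p p' : 𝒢.P.Tot) : Circle :=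
  let b := @Classical.epsilon _ ⟨p⟩ fun b => (𝒢.P.proj b).1 = (𝒢.fst u₁, 𝒢.snd u₂)
  𝒢.s p' b u₁ * (𝒢.s u₂ b p)⁻¹

variable {𝒢}
variable {y₁ y₂ y₁' y₂' : 𝒢.Y} {u₁ u₂ p p' : 𝒢.P.Tot}

/-- The section compares the two paths from y₁ to y₂', through y₁' and through y₂. Scaling the
auxiliary b by z changes the two values of s by the same factor z⁻¹, so their quotient is
unaffected. -/
theorem idSection_eq (h₁ : (𝒢.P.proj u₁).1 = (y₁, y₁')) (h₂ : (𝒢.P.proj u₂).1 = (y₂, y₂'))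
    (hp : (𝒢.P.proj p).1 = (y₁, y₂)) (hp' : (𝒢.P.proj p').1 = (y₁', y₂')) {b : 𝒢.P.Tot}
    (hb : (𝒢.P.proj b).1 = (y₁, y₂')) :
    𝒢.idSection u₁ u₂ p p' = 𝒢.s p' b u₁ * (𝒢.s u₂ b p)⁻¹ := by
  have hf : 𝒢.fst u₁ = y₁ := by rw [fst, h₁]
  have hs : 𝒢.snd u₂ = y₂' := by rw [snd, h₂]
  have hb₀ : (𝒢.P.proj b).1 = (𝒢.fst u₁, 𝒢.snd u₂) := by rw [hb, hf, hs]
  obtain ⟨b', hb', he⟩ : ∃ b', (𝒢.P.proj b').1 = (𝒢.fst u₁, 𝒢.snd u₂) ∧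
      𝒢.idSection u₁ u₂ p p' = 𝒢.s p' b' u₁ * (𝒢.s u₂ b' p)⁻¹ :=
    ⟨_, Classical.epsilon_spec (p := fun b => (𝒢.P.proj b).1 = (𝒢.fst u₁, 𝒢.snd u₂)) ⟨b, hb₀⟩, rfl⟩
  obtain ⟨z, rfl⟩ := (𝒢.P.fiber b b').1 (Subtype.ext (hb₀.trans hb'.symm))
  have e1 := 𝒢.s_smul _ _ _ p' b u₁ hp' hb h₁ 1 z 1
  have e2 := 𝒢.s_smul _ _ _ u₂ b p h₂ hb hp 1 z 1
  simp only [one_smul, one_mul, mul_one] at e1 e2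
  rw [he, e1, e2, mul_inv, inv_inv, mul_mul_mul_comm, inv_mul_cancel, one_mul]

theorem exists_proj_eq_of (h₁ : (𝒢.P.proj u₁).1 = (y₁, y₁')) (hp' : (𝒢.P.proj p').1 = (y₁', y₂')) :
    ∃ b, (𝒢.P.proj b).1 = (y₁, y₂') := by
  have e1 := (𝒢.P.proj u₁).2
  have e2 := (𝒢.P.proj p').2
  rw [h₁] at e1
  rw [hp'] at e2
  exact 𝒢.exists_proj_eq (e1.trans e2)

theorem idSection_smul (h₁ : (𝒢.P.proj u₁).1 = (y₁, y₁')) (h₂ : (𝒢.P.proj u₂).1 = (y₂, y₂'))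
    (hp : (𝒢.P.proj p).1 = (y₁, y₂)) (hp' : (𝒢.P.proj p').1 = (y₁', y₂')) (a₁ a₂ b b' : Circle) :
    𝒢.idSection (a₁ • u₁) (a₂ • u₂) (b • p) (b' • p') =
      a₂⁻¹ * a₁ * b⁻¹ * b' * 𝒢.idSection u₁ u₂ p p' := by
  obtain ⟨x, hx⟩ := exists_proj_eq_of h₁ hp'
  have e1 := 𝒢.s_smul _ _ _ p' x u₁ hp' hx h₁ b' 1 a₁
  have e2 := 𝒢.s_smul _ _ _ u₂ x p h₂ hx hp a₂ 1 b
  rw [one_smul] at e1 e2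
  rw [idSection_eq h₁ h₂ hp hp' hx, idSection_eq (y₁ := y₁) (y₂ := y₂) (y₁' := y₁') (y₂' := y₂')
    (by rw [𝒢.P.proj_smul, h₁]) (by rw [𝒢.P.proj_smul, h₂]) (by rw [𝒢.P.proj_smul, hp])
    (by rw [𝒢.P.proj_smul, hp']) hx, e1, e2]
  simp only [mul_inv, inv_one, mul_one]
  simp only [mul_comm, mul_left_comm, mul_assoc]

/-- The prism on the triangles y₁y₂y₃ and y₁'y₂'y₃' is cut into the tetrahedra y₁y₁'y₂'y₃',
y₁y₂y₂'y₃' and y₁y₂y₃y₃', and δs = 1 is applied to each. -/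
theorem idSection_cocycle {y₃ y₃' : 𝒢.Y} {u₃ p₂₃ p₁₃ p₁₂ p₂₃' p₁₃' p₁₂' : 𝒢.P.Tot}
    (h₁ : (𝒢.P.proj u₁).1 = (y₁, y₁')) (h₂ : (𝒢.P.proj u₂).1 = (y₂, y₂'))
    (h₃ : (𝒢.P.proj u₃).1 = (y₃, y₃')) (h₂₃ : (𝒢.P.proj p₂₃).1 = (y₂, y₃))
    (h₁₃ : (𝒢.P.proj p₁₃).1 = (y₁, y₃)) (h₁₂ : (𝒢.P.proj p₁₂).1 = (y₁, y₂))
    (h₂₃' : (𝒢.P.proj p₂₃').1 = (y₂', y₃')) (h₁₃' : (𝒢.P.proj p₁₃').1 = (y₁', y₃'))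
    (h₁₂' : (𝒢.P.proj p₁₂').1 = (y₁', y₂')) :
    𝒢.idSection u₂ u₃ p₂₃ p₂₃' * (𝒢.idSection u₁ u₃ p₁₃ p₁₃')⁻¹ * 𝒢.idSection u₁ u₂ p₁₂ p₁₂' =
      (𝒢.s p₂₃ p₁₃ p₁₂)⁻¹ * 𝒢.s p₂₃' p₁₃' p₁₂' := by
  obtain ⟨x₂₃, hx₂₃⟩ := exists_proj_eq_of h₂ h₂₃'
  obtain ⟨x₁₃, hx₁₃⟩ := exists_proj_eq_of h₁ h₁₃'
  obtain ⟨x₁₂, hx₁₂⟩ := exists_proj_eq_of h₁ h₁₂'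
  rw [idSection_eq h₂ h₃ h₂₃ h₂₃' hx₂₃, idSection_eq h₁ h₃ h₁₃ h₁₃' hx₁₃,
    idSection_eq h₁ h₂ h₁₂ h₁₂' hx₁₂]
  have e1 := 𝒢.δs_eq_one _ _ _ _ u₁ x₁₂ x₁₃ p₁₂' p₁₃' p₂₃' h₁ hx₁₂ hx₁₃ h₁₂' h₁₃' h₂₃'
  have e2 := 𝒢.δs_eq_one _ _ _ _ p₁₂ x₁₂ x₁₃ u₂ x₂₃ p₂₃' h₁₂ hx₁₂ hx₁₃ h₂ hx₂₃ h₂₃'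
  have e3 := 𝒢.δs_eq_one _ _ _ _ p₁₂ p₁₃ x₁₃ p₂₃ x₂₃ u₃ h₁₂ h₁₃ hx₁₃ h₂₃ hx₂₃ h₃
  -- The letters are the ten values of s in `e1`, `e2`, `e3`. The repeated ones, b and f, belong to
  -- the two interior faces of the prism and cancel.
  have key : ∀ a b c d e f g h i j : Circle, a * b⁻¹ * c * d⁻¹ = 1 → e * b⁻¹ * f * g⁻¹ = 1 →
      h * i⁻¹ * f * j⁻¹ = 1 → e * h⁻¹ * (c * i⁻¹)⁻¹ * (d * g⁻¹) = j⁻¹ * a := by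
    intro a b c d e f g h i j k1 k2 k3
    have ha : a = b * c⁻¹ * d := by
      rw [← mul_inv_eq_one]; rw [← k1]; simp only [mul_inv, inv_inv]
      simp only [mul_comm, mul_left_comm, mul_assoc]
    have he : e = b * f⁻¹ * g := by
      rw [← mul_inv_eq_one]; rw [← k2]; simp only [mul_inv, inv_inv]
      simp only [mul_comm, mul_left_comm, mul_assoc]
    have hj : j = h * i⁻¹ * f := (mul_inv_eq_one.1 k3).symm
    subst ha he hj
    simp only [Circle.ext_iff, Circle.coe_mul, Circle.coe_inv]
    have := b.coe_ne_zero; have := c.coe_ne_zero; have := d.coe_ne_zero; have := f.coe_ne_zero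
    have := g.coe_ne_zero; have := h.coe_ne_zero; have := i.coe_ne_zero
    field_simp
  exact key _ _ _ _ _ _ _ _ _ _ e1 e2 e3

section Plots

variable {E : LCS.{u}} {U : Set E} {z₁ z₂ z₁' z₂' : E → 𝒢.Y} {c₁ c₂ d d' : E → 𝒢.P.Tot}

theorem exists_plot_of (hc₁ : IsPlot U c₁) (hc₂ : IsPlot U c₂)
    (h₁ : ∀ x ∈ U, (𝒢.P.proj (c₁ x)).1 = (z₁ x, z₁' x))
    (h₂ : ∀ x ∈ U, (𝒢.P.proj (c₂ x)).1 = (z₂ x, z₂' x))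
    (hp' : ∀ x ∈ U, (𝒢.P.proj (d' x)).1 = (z₁' x, z₂' x)) {x : E} (hx : x ∈ U) :
    ∃ (V : Set E) (b : E → 𝒢.P.Tot), x ∈ V ∧ V ⊆ U ∧ IsPlot V b ∧
      ∀ z ∈ V, (𝒢.P.proj (b z)).1 = (z₁ z, z₂' z) := by
  obtain ⟨V, b, h3, h4, h5, h6⟩ := 𝒢.exists_plot_lift (𝒢.smooth_fst.comp_plot hc₁)
    (𝒢.smooth_snd.comp_plot hc₂) (fun y hy => by
      have e1 := 𝒢.π_fst (c₁ y)
      have e2 := 𝒢.π_fst (d' y)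
      simp only [fst, snd, h₁ y hy, h₂ y hy, hp' y hy] at e1 e2 ⊢
      exact e1.trans e2) hx
  exact ⟨V, b, h3, h4, h5, fun y hy => by
    rw [h6 y hy, fst, snd, h₁ y (h4 hy), h₂ y (h4 hy)]⟩

theorem idSection_smooth (hc₁ : IsPlot U c₁) (hc₂ : IsPlot U c₂) (hd : IsPlot U d)
    (hd' : IsPlot U d') (h₁ : ∀ x ∈ U, (𝒢.P.proj (c₁ x)).1 = (z₁ x, z₁' x))
    (h₂ : ∀ x ∈ U, (𝒢.P.proj (c₂ x)).1 = (z₂ x, z₂' x))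
    (hp : ∀ x ∈ U, (𝒢.P.proj (d x)).1 = (z₁ x, z₂ x))
    (hp' : ∀ x ∈ U, (𝒢.P.proj (d' x)).1 = (z₁' x, z₂' x)) :
    IsCircleSmoothOn U (fun x => 𝒢.idSection (c₁ x) (c₂ x) (d x) (d' x)) := by
  refine IsCircleSmoothOn.of_local fun x hx => ?_
  obtain ⟨V, b, hxV, hVU, hb, hbz⟩ := exists_plot_of hc₁ hc₂ h₁ h₂ hp' hx
  have hV := hb.isOpen
  refine ⟨V, _, hV, hxV, (𝒢.s_smooth E V _ _ _ d' b c₁ (hd'.mono hV hVU) hb (hc₁.mono hV hVU)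
    (fun y hy => hp' y (hVU hy)) hbz (fun y hy => h₁ y (hVU hy))).mul hV
    ((𝒢.s_smooth E V _ _ _ c₂ b d (hc₂.mono hV hVU) hb (hd.mono hV hVU)
    (fun y hy => h₂ y (hVU hy)) hbz (fun y hy => hp y (hVU hy))).inv hV), fun y hy => ?_⟩
  exact (idSection_eq (h₁ y (hVU hy)) (h₂ y (hVU hy)) (hp y (hVU hy)) (hp' y (hVU hy))
    (hbz y hy)).symm

/-- Parallelism of s for each of the two factors; the terms in ∇(b) cancel. -/
theorem dlog_idSection (𝒟 : 𝒢.ConnCurv) (hc₁ : IsPlot U c₁) (hc₂ : IsPlot U c₂) (hd : IsPlot U d)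
    (hd' : IsPlot U d') (h₁ : ∀ x ∈ U, (𝒢.P.proj (c₁ x)).1 = (z₁ x, z₁' x))
    (h₂ : ∀ x ∈ U, (𝒢.P.proj (c₂ x)).1 = (z₂ x, z₂' x))
    (hp : ∀ x ∈ U, (𝒢.P.proj (d x)).1 = (z₁ x, z₂ x))
    (hp' : ∀ x ∈ U, (𝒢.P.proj (d' x)).1 = (z₁' x, z₂' x)) {x : E} (hx : x ∈ U) (w : E) :
    dlog (fun x => 𝒢.idSection (c₁ x) (c₂ x) (d x) (d' x)) x w =
      𝒟.nabla.at U d' x ![w] + 𝒟.nabla.at U c₁ x ![w] - 𝒟.nabla.at U c₂ x ![w] -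
        𝒟.nabla.at U d x ![w] := by
  obtain ⟨V, b, hxV, hVU, hb, hbz⟩ := exists_plot_of hc₁ hc₂ h₁ h₂ hp' hx
  have hV := hb.isOpen
  have hN := hV.mem_nhds hxV
  rw [dlog_congr hN fun y hy => idSection_eq (h₁ y (hVU hy)) (h₂ y (hVU hy)) (hp y (hVU hy))
    (hp' y (hVU hy)) (hbz y hy)]
  have s1 := 𝒢.s_smooth E V _ _ _ d' b c₁ (hd'.mono hV hVU) hb (hc₁.mono hV hVU)
    (fun y hy => hp' y (hVU hy)) hbz (fun y hy => h₁ y (hVU hy))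
  have s2 := 𝒢.s_smooth E V _ _ _ c₂ b d (hc₂.mono hV hVU) hb (hd.mono hV hVU)
    (fun y hy => h₂ y (hVU hy)) hbz (fun y hy => hp y (hVU hy))
  have t1 := 𝒟.s_parallel E V _ _ _ d' b c₁ (hd'.mono hV hVU) hb (hc₁.mono hV hVU)
    (fun y hy => hp' y (hVU hy)) hbz (fun y hy => h₁ y (hVU hy)) x hxV w
  have t2 := 𝒟.s_parallel E V _ _ _ c₂ b d (hc₂.mono hV hVU) hb (hd.mono hV hVU)
    (fun y hy => h₂ y (hVU hy)) hbz (fun y hy => hp y (hVU hy)) x hxV w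
  have r : ∀ {c : E → 𝒢.P.Tot}, IsPlot U c → 𝒟.nabla.at V c x ![w] = 𝒟.nabla.at U c x ![w] :=
    fun hc => 𝒟.nabla.at_mono hc (hc.mono hV hVU) hVU (eqOn_refl _ _) hxV _
  rw [r hd', r hc₁] at t1
  rw [r hc₂, r hd] at t2
  rw [dlog_mul s1 (s2.inv hV) hxV, dlog_inv hV s2 hxV, ← t1, ← t2]
  ring

end Plots

end Identity

end BundleGerbe

namespace BundleGerbe

/-! ## The stable isomorphism of an equivariant flat bundle -/

section Tensor

variable {G : Type u} [Group G] [SmoothSpace G] {M : Type u} [SmoothSpace M]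
  [MulAction G M] {M' : Type u} [SmoothSpace M'] {q : M → M'} {𝒢' : BundleGerbe M'}
  {R : TBundle M} [MulAction G R.Tot]

variable (q 𝒢' R) in
/-- The fibre product of `P` and `R` over `M'`, which covers the tensor product of `P` with the
bundle `R/G`. -/
abbrev TensorCover : Type u :=
  FibProd (fun p => 𝒢'.π (𝒢'.fst p)) (fun r => q (R.proj r))

namespace TensorCover

/-- The component in `P`. -/
abbrev left (x : TensorCover q 𝒢' R) : 𝒢'.P.Tot := x.1.1

/-- The component in `R`. -/
abbrev right (x : TensorCover q 𝒢' R) : R.Tot := x.1.2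

/-- The projection to `Y ×_{M'} Y`. -/
abbrev toBase (x : TensorCover q 𝒢' R) : FibProd 𝒢'.π 𝒢'.π := 𝒢'.P.proj x.left

theorem smooth_left : IsSmoothMap (left : TensorCover q 𝒢' R → 𝒢'.P.Tot) := fun _ _ _ hc _ => hc.1

theorem smooth_right : IsSmoothMap (right : TensorCover q 𝒢' R → R.Tot) := fun _ _ _ hc _ => hc.2

theorem π_left (x : TensorCover q 𝒢' R) : 𝒢'.π (𝒢'.fst x.left) = q (R.proj x.right) := x.2

theorem q_right_eq {x x' : TensorCover q 𝒢' R} (h : 𝒢'.π x.toBase.1.1 = 𝒢'.π x'.toBase.1.1) :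
    q (R.proj x.right) = q (R.proj x'.right) := by
  rw [← x.π_left, ← x'.π_left]; exact h

theorem q_right_eq_of_toBase_eq {x x' : TensorCover q 𝒢' R} (h : x.toBase = x'.toBase) :
    q (R.proj x.right) = q (R.proj x'.right) :=
  q_right_eq (by rw [h])

/-- The action of `𝕋` on the first factor. -/
def act (z : Circle) (x : TensorCover q 𝒢' R) : TensorCover q 𝒢' R :=
  ⟨(z • x.left, x.right), by
    have := x.2
    simpa only [fst, 𝒢'.P.proj_smul] using this⟩

variable (G) in
/-- The descent datum of the tensor product. -/
noncomputable def factor (x x' : TensorCover q 𝒢' R) : Circle :=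
  𝒢'.P.ratio x.left x'.left * R.orbitRatio G x.right x'.right

/-- Factor 1 identifies (z p, r) with (p, z r) and (p, r) with (p, g r). The quotient is therefore P
⊗ (R/G), obtained without forming R/G. -/
theorem isDescentDatum (hR : R.IsEquivariant G) (hG : IsLieGrp G) (hq : IsPrincipalQuotient G q) :
    IsDescentDatum act (toBase : TensorCover q 𝒢' R → _) (factor G) where
  sections := 𝒢'.P.hasLocalSections.comp
    ((hq.hasLocalSections.comp R.hasLocalSections).pullback
      (𝒢'.submersion.smooth.comp 𝒢'.smooth_fst))
  act_one x := by simp [act]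
  act_mul z z' x := by simp [act, mul_smul]
  smooth_act E U c z hc hz := ⟨𝒢'.P.smooth_act E U _ z hc.1 hz, hc.2⟩
  proj_act z x := 𝒢'.P.proj_smul z x.left
  trans x x' x'' h h' := by
    unfold factor
    rw [mul_mul_mul_comm, 𝒢'.P.ratio_trans h h',
      hR.orbitRatio_trans hq (q_right_eq_of_toBase_eq h) (q_right_eq_of_toBase_eq h')]
  act_left z x x' h := by
    have := 𝒢'.P.ratio_smul_left h z
    simp only [factor, ← mul_assoc]
    exact congrArg (· * _) this
  smooth E U c c' hc hc' h :=
    (𝒢'.P.ratio_smooth (smooth_left.comp_plot hc) (smooth_left.comp_plot hc') h).mul hc.isOpen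
      (hR.orbitRatio_smooth hG hq (smooth_right.comp_plot hc) (smooth_right.comp_plot hc')
        fun x hx => q_right_eq_of_toBase_eq (h x hx))

variable (G) in
/-- The section defining the stable isomorphism, on the cover. -/
noncomputable def section₀ (x₁ x₂ : TensorCover q 𝒢' R) (p p' : 𝒢'.P.Tot) : Circle :=
  𝒢'.idSection x₁.left x₂.left p p' * R.orbitRatio G x₁.right x₂.right

theorem q_right_eq_of_proj {y₁ y₂ y₁' y₂' : 𝒢'.Y} {x₁ x₂ : TensorCover q 𝒢' R} {p : 𝒢'.P.Tot}
    (h₁ : x₁.toBase.1 = (y₁, y₁')) (h₂ : x₂.toBase.1 = (y₂, y₂'))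
    (hp : (𝒢'.P.proj p).1 = (y₁, y₂)) : q (R.proj x₁.right) = q (R.proj x₂.right) := by
  refine q_right_eq ?_
  have := 𝒢'.π_fst p
  rw [fst, snd, hp] at this
  rw [h₁, h₂]
  exact this

/-- Change of representatives multiplies the section by descent factors, so it is well defined on
the quotient. -/
theorem section₀_factor (hR : R.IsEquivariant G) (hq : IsPrincipalQuotient G q)
    {y₁ y₂ y₁' y₂' : 𝒢'.Y} {x₁ x₂ x₁' x₂' : TensorCover q 𝒢' R} {p p' : 𝒢'.P.Tot}
    (h₁ : x₁.toBase.1 = (y₁, y₁')) (h₂ : x₂.toBase.1 = (y₂, y₂'))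
    (hp : (𝒢'.P.proj p).1 = (y₁, y₂)) (hp' : (𝒢'.P.proj p').1 = (y₁', y₂'))
    (hx₁ : x₁.toBase = x₁'.toBase) (hx₂ : x₂.toBase = x₂'.toBase) :
    section₀ G x₁ x₂ p p' = factor G x₁ x₁' * (factor G x₂ x₂')⁻¹ * section₀ G x₁' x₂' p p' := by
  have e := idSection_smul (hx₁ ▸ h₁) (hx₂ ▸ h₂) hp hp' (𝒢'.P.ratio x₁.left x₁'.left)
    (𝒢'.P.ratio x₂.left x₂'.left) 1 1
  rw [𝒢'.P.ratio_smul hx₁, 𝒢'.P.ratio_smul hx₂, one_smul, one_smul] at e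
  have k1 := q_right_eq_of_toBase_eq hx₁
  have k2 := q_right_eq_of_toBase_eq hx₂
  have k3 := q_right_eq_of_proj h₁ h₂ hp
  have e1 := hR.orbitRatio_trans hq k1 (k1.symm.trans k3)
  have e2 := hR.orbitRatio_trans hq (k1.symm.trans (k3.trans k2)) k2.symm
  rw [← hR.orbitRatio_symm hq k2] at e2
  unfold section₀ factor
  rw [e, ← e1, ← e2]
  simp only [mul_inv, inv_one, mul_one]
  simp only [mul_comm, mul_left_comm, mul_assoc]

end TensorCover

open TensorCover in
-- The bundle is P ⊗ (R/G) over Y ×_{M'} Y, the section is the product of the identity section with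
-- the orbit ratio, and the connection is ∇ + (η − β).
theorem nonempty_stableIso {𝒟₁ 𝒟₂ : 𝒢'.ConnCurv} (hn : 𝒟₁.nabla = 𝒟₂.nabla)
    (hR : R.IsEquivariant G) (hG : IsLieGrp G) (hq : IsPrincipalQuotient G q) (L : LieAlg G)
    {η : SmoothForm 1 R.Tot ℝ} {β : SmoothForm 1 M ℝ} (hη : R.IsConnection η)
    (hηG : η.IsInvariant G)
    (hflat : ∀ (E : LCS.{u}) (U : Set E) (c : E → R.Tot), IsPlot U c → ∀ x ∈ U,
      ∀ w : Fin 2 → E, extD (η.at U c) x w = 0)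
    (hβ : β.IsInvariant G)
    (hmom : ∀ (r : R.Tot) (X : L.𝔤), η.moment L r X = β.moment L (R.proj r) X)
    (hcurv : ∀ (E : LCS.{u}) (U : Set E) (y : E → 𝒢'.Y) (m : E → M), IsPlot U y → IsPlot U m →
      (∀ x ∈ U, 𝒢'.π (y x) = q (m x)) → ∀ x ∈ U, ∀ w : Fin 2 → E,
      𝒟₂.curv.at U y x w - 𝒟₁.curv.at U y x w = - extD (β.at U m) x w) :
    Nonempty (StableIso 𝒟₁ 𝒟₂) := by
  have hdesc := TensorCover.isDescentDatum (𝒢' := 𝒢') hR hG hq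
  have hpres := hdesc.isTBundlePresentation
  obtain ⟨Q, k, hk⟩ := hpres.exists_quotient
  -- On R this is η − β, whose moment vanishes; it represents the connection of R/G.
  let χ := η.add (β.pullback _ R.smooth_proj).neg
  let θ := (𝒟₁.nabla.pullback _ (smooth_left (R := R) (q := q))).add
    (χ.pullback _ (smooth_right (𝒢' := 𝒢') (q := q)))
  have hχ : ∀ {E : LCS.{u}} {U : Set E} {c : E → R.Tot}, IsPlot U c → ∀ x {n : Fin 1 → E},
      χ.at U c x n = η.at U c x n - β.at U (fun y => R.proj (c y)) x n := fun hc x n => by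
    rw [SmoothForm.add_at, SmoothForm.neg_at, SmoothForm.pullback_at _ _ _ hc, sub_eq_add_neg]
  have hθ : ∀ {E : LCS.{u}} {U : Set E} {c : E → TensorCover q 𝒢' R}, IsPlot U c →
      ∀ x {n : Fin 1 → E}, θ.at U c x n =
        𝒟₁.nabla.at U (fun y => (c y).left) x n + χ.at U (fun y => (c y).right) x n :=
    fun hc x n => by
      rw [SmoothForm.add_at, SmoothForm.pullback_at _ _ _ hc, SmoothForm.pullback_at _ _ _ hc]
  have hdlog : ∀ {E : LCS.{u}} {U : Set E} {c c' : E → TensorCover q 𝒢' R}, IsPlot U c →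
      IsPlot U c' → (∀ x ∈ U, q (R.proj (c x).right) = q (R.proj (c' x).right)) → ∀ x ∈ U,
      ∀ w : E, dlog (fun y => R.orbitRatio G (c y).right (c' y).right) x w =
        χ.at U (fun y => (c y).right) x ![w] - χ.at U (fun y => (c' y).right) x ![w] :=
    fun hc hc' h x hx w => by
      rw [hχ (smooth_right.comp_plot hc), hχ (smooth_right.comp_plot hc')]
      exact hR.dlog_orbitRatio hG hq L hη hηG hβ hmom (smooth_right.comp_plot hc)
        (smooth_right.comp_plot hc') h hx w
  obtain ⟨ζ, hζ, hζθ⟩ := hk.exists_connection hpres.smooth_act θ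
    (fun E U c c' hc hc' h x hx w => by
      have hbase : ∀ y ∈ U, (c y).toBase = (c' y).toBase := fun y hy => (h y hy).1
      have hqe := fun y hy => q_right_eq_of_toBase_eq (hbase y hy)
      have hl := smooth_left.comp_plot hc
      have hl' := smooth_left.comp_plot hc'
      have hr := 𝒢'.P.ratio_smooth hl hl' hbase
      have hr' := hR.orbitRatio_smooth hG hq (smooth_right.comp_plot hc)
        (smooth_right.comp_plot hc') hqe
      have e1 := 𝒟₁.isConnection E U _ _ hl' hr x hx w
      rw [← 𝒟₁.nabla.at_congr (𝒢'.P.smooth_act E U _ _ hl' hr)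
        (fun y hy => (𝒢'.P.ratio_smul (hbase y hy)).symm) hx] at e1
      have e2 := dlog_mul hr hr' hx w
      have e3 : dlog (fun y => factor G (c y) (c' y)) x w = 0 :=
        (dlog_congr (hc.isOpen.mem_nhds hx) (fun y hy => (h y hy).2) w).trans (dlog_const 1 x w)
      rw [hdlog hc hc' hqe x hx w] at e2
      have e4 := e3.symm.trans e2
      rw [hθ hc, hθ hc']
      linarith)
    (fun E U c z hc hz x hx w => by
      rw [hθ (hpres.smooth_act E U c z hc hz), hθ hc]
      have := 𝒟₁.isConnection E U _ z (smooth_left.comp_plot hc) hz x hx w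
      change 𝒟₁.nabla.at U (fun y => z y • (c y).left) x ![w] +
        χ.at U (fun y => (c y).right) x ![w] = _
      rw [this]; ring)
  choose kinv hkinv using hk.subduction.surjective
  have hkproj : ∀ a, Q.proj a = (kinv a).toBase := fun a => by
    rw [← hk.proj_eq, hkinv]
  -- The section on the quotient is computed by any representatives; local smooth lifts will replace
  -- the arbitrary ones.
  have hv : ∀ {y₁ y₂ y₁' y₂' : 𝒢'.Y} {r₁ r₂ : Q.Tot} {p p' : 𝒢'.P.Tot}
      {x₁ x₂ : TensorCover q 𝒢' R}, k x₁ = r₁ → k x₂ = r₂ →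
      (Q.proj r₁).1 = (y₁, y₁') → (Q.proj r₂).1 = (y₂, y₂') →
      (𝒢'.P.proj p).1 = (y₁, y₂) → (𝒢'.P.proj p').1 = (y₁', y₂') →
      section₀ G (kinv r₁) (kinv r₂) p p' = section₀ G x₁ x₂ p p' := by
    intro y₁ y₂ y₁' y₂' r₁ r₂ p p' x₁ x₂ e₁ e₂ h₁ h₂ hp hp'
    have i₁ := (hk.eq_iff _ _).1 ((hkinv r₁).trans e₁.symm)
    have i₂ := (hk.eq_iff _ _).1 ((hkinv r₂).trans e₂.symm)
    rw [section₀_factor hR hq (hkproj r₁ ▸ h₁) (hkproj r₂ ▸ h₂) hp hp' i₁.1 i₂.1, i₁.2, i₂.2]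
    simp
  have hlift : ∀ {E : LCS.{u}} {U : Set E} {r : E → Q.Tot}, IsPlot U r → ∀ x ∈ U,
      ∃ (V : Set E) (c : E → TensorCover q 𝒢' R), x ∈ V ∧ V ⊆ U ∧ IsPlot V c ∧
        ∀ y ∈ V, k (c y) = r y := fun hr x hx => by
    obtain ⟨V, c, h1, h2, h3, h4⟩ := hk.subduction.lift _ _ _ hr x hx
    exact ⟨V, c, h1, h2, h3, fun y hy => (h4 hy).symm⟩
  have hlift₂ : ∀ {E : LCS.{u}} {U : Set E} {r₁ r₂ : E → Q.Tot}, IsPlot U r₁ → IsPlot U r₂ →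
      ∀ x ∈ U, ∃ (V : Set E) (c₁ c₂ : E → TensorCover q 𝒢' R), x ∈ V ∧ V ⊆ U ∧ IsPlot V c₁ ∧
        IsPlot V c₂ ∧ (∀ y ∈ V, k (c₁ y) = r₁ y) ∧ ∀ y ∈ V, k (c₂ y) = r₂ y :=
    fun hr₁ hr₂ x hx => by
      obtain ⟨V₁, c₁, h1, h2, h3, h4⟩ := hlift hr₁ x hx
      obtain ⟨V₂, c₂, i1, i2, i3, i4⟩ := hlift hr₂ x hx
      have hV := h3.isOpen.inter i3.isOpen
      exact ⟨V₁ ∩ V₂, c₁, c₂, ⟨h1, i1⟩, inter_subset_left.trans h2, h3.mono hV inter_subset_left,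
        i3.mono hV inter_subset_right, fun y hy => h4 y hy.1, fun y hy => i4 y hy.2⟩
  have htb : ∀ {a : Q.Tot} {x : TensorCover q 𝒢' R}, k x = a → x.toBase = Q.proj a :=
    fun {a x} h => by rw [← h, hk.proj_eq]
  refine ⟨{ R := Q, v := fun r₁ r₂ => section₀ G (kinv r₁) (kinv r₂), v_smul := ?_, v_smooth := ?_,
            δv_eq := ?_, η := ζ, isConnection := hζ, v_parallel := ?_, curvature := ?_ }⟩
  · intro y₁ y₂ y₁' y₂' r₁ r₂ p p' h₁ h₂ hp hp' a₁ a₂ b b'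
    rw [hv (x₁ := act a₁ (kinv r₁)) (x₂ := act a₂ (kinv r₂)) (y₁ := y₁) (y₂ := y₂) (y₁' := y₁')
      (y₂' := y₂') (by rw [hk.act_eq, hkinv]) (by rw [hk.act_eq, hkinv]) (by rw [Q.proj_smul, h₁])
      (by rw [Q.proj_smul, h₂]) (by rw [𝒢'.P.proj_smul, hp]) (by rw [𝒢'.P.proj_smul, hp'])]
    rw [hkproj] at h₁ h₂
    unfold section₀
    rw [← mul_assoc, ← idSection_smul h₁ h₂ hp hp']
    rfl
  · intro E U y₁ y₂ y₁' y₂' r₁ r₂ p p' hr₁ hr₂ hp hp' b₁ b₂ b b'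
    refine IsCircleSmoothOn.of_local fun x hx => ?_
    obtain ⟨V, c₁, c₂, hxV, hVU, hc₁, hc₂, e₁, e₂⟩ := hlift₂ hr₁ hr₂ x hx
    have b₁' : ∀ y ∈ V, (c₁ y).toBase.1 = (y₁ y, y₁' y) := fun y hy => by
      rw [htb (e₁ y hy), b₁ y (hVU hy)]
    have b₂' : ∀ y ∈ V, (c₂ y).toBase.1 = (y₂ y, y₂' y) := fun y hy => by
      rw [htb (e₂ y hy), b₂ y (hVU hy)]
    have hV := hc₁.isOpen
    refine ⟨V, fun y => section₀ G (c₁ y) (c₂ y) (p y) (p' y), hV, hxV, ?_, fun y hy =>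
      (hv (e₁ y hy) (e₂ y hy) (b₁ y (hVU hy)) (b₂ y (hVU hy)) (b y (hVU hy))
        (b' y (hVU hy))).symm⟩
    exact (idSection_smooth (smooth_left.comp_plot hc₁) (smooth_left.comp_plot hc₂)
      (hp.mono hV hVU) (hp'.mono hV hVU) b₁' b₂' (fun y hy => b y (hVU hy))
      (fun y hy => b' y (hVU hy))).mul hV
      (hR.orbitRatio_smooth hG hq (smooth_right.comp_plot hc₁) (smooth_right.comp_plot hc₂)
        fun y hy => q_right_eq_of_proj (b₁' y hy) (b₂' y hy) (b y (hVU hy)))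
  · intro y₁ y₂ y₃ y₁' y₂' y₃' r₁ r₂ r₃ p₂₃ p₁₃ p₁₂ p₂₃' p₁₃' p₁₂' b₁ b₂ b₃ h₂₃ h₁₃ h₁₂ h₂₃' h₁₃' h₁₂'
    rw [hkproj] at b₁ b₂ b₃
    have e := idSection_cocycle b₁ b₂ b₃ h₂₃ h₁₃ h₁₂ h₂₃' h₁₃' h₁₂'
    have e' := hR.orbitRatio_trans hq (q_right_eq_of_proj b₁ b₂ h₁₂) (q_right_eq_of_proj b₂ b₃ h₂₃)
    rw [← e]
    simp only [section₀, mul_inv]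
    rw [← e']
    have : ∀ a b c d f : Circle, a * d * (b * (f * d)⁻¹) * (c * f) = a * b * c := fun a b c d f => by
      rw [← mul_one (a * b * c), ← mul_inv_cancel (f * d)]
      simp only [mul_comm, mul_left_comm, mul_assoc]
    exact this _ _ _ _ _
  · intro E U y₁ y₂ y₁' y₂' r₁ r₂ p p' hr₁ hr₂ hp hp' b₁ b₂ b b' x hx w
    obtain ⟨V, c₁, c₂, hxV, hVU, hc₁, hc₂, e₁, e₂⟩ := hlift₂ hr₁ hr₂ x hx
    have b₁' : ∀ y ∈ V, (c₁ y).toBase.1 = (y₁ y, y₁' y) := fun y hy => by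
      rw [htb (e₁ y hy), b₁ y (hVU hy)]
    have b₂' : ∀ y ∈ V, (c₂ y).toBase.1 = (y₂ y, y₂' y) := fun y hy => by
      rw [htb (e₂ y hy), b₂ y (hVU hy)]
    have hV := hc₁.isOpen
    have hqe := fun y (hy : y ∈ V) => q_right_eq_of_proj (b₁' y hy) (b₂' y hy) (b y (hVU hy))
    rw [dlog_congr (hV.mem_nhds hxV) (z' := fun y => section₀ G (c₁ y) (c₂ y) (p y) (p' y))
      fun y hy => hv (e₁ y hy) (e₂ y hy) (b₁ y (hVU hy)) (b₂ y (hVU hy)) (b y (hVU hy))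
        (b' y (hVU hy))]
    have s1 := idSection_smooth (smooth_left.comp_plot hc₁) (smooth_left.comp_plot hc₂)
      (hp.mono hV hVU) (hp'.mono hV hVU) b₁' b₂' (fun y hy => b y (hVU hy))
      (fun y hy => b' y (hVU hy))
    have s2 := hR.orbitRatio_smooth hG hq (smooth_right.comp_plot hc₁)
      (smooth_right.comp_plot hc₂) hqe
    have d1 := dlog_idSection 𝒟₁ (smooth_left.comp_plot hc₁) (smooth_left.comp_plot hc₂)
      (hp.mono hV hVU) (hp'.mono hV hVU) b₁' b₂' (fun y hy => b y (hVU hy))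
      (fun y hy => b' y (hVU hy)) hxV w
    rw [𝒟₁.nabla.at_mono hp (hp.mono hV hVU) hVU (eqOn_refl _ _) hxV,
      𝒟₁.nabla.at_mono hp' (hp'.mono hV hVU) hVU (eqOn_refl _ _) hxV] at d1
    unfold section₀
    rw [dlog_mul s1 s2 hxV, d1, hdlog hc₁ hc₂ hqe x hxV w,
      hζθ E U V r₁ c₁ hr₁ hc₁ hVU (fun y hy => (e₁ y hy).symm) x hxV,
      hζθ E U V r₂ c₂ hr₂ hc₂ hVU (fun y hy => (e₂ y hy).symm) x hxV, hθ hc₁, hθ hc₂, ← hn]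
    ring
  · intro E U r hr x hx w
    obtain ⟨V, c, hxV, hVU, hc, e⟩ := hlift hr x hx
    have hN := hc.isOpen.mem_nhds hxV
    have hl := smooth_left.comp_plot hc
    have hrt := smooth_right.comp_plot hc
    have hm := R.smooth_proj.comp_plot hrt
    have e0 : extD (ζ.at U r) x w = extD (θ.at V c) x w := extD_congr hN
      (fun y hy w => hζθ E U V r c hr hc hVU (fun y hy => (e y hy).symm) y hy w) w
    have e1 : extD ((𝒟₁.nabla.pullback _ (smooth_left (R := R) (q := q))).at V c) x w =
        extD (𝒟₁.nabla.at V fun y => (c y).left) x w :=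
      extD_congr hN (fun y hy w => SmoothForm.pullback_at _ _ _ hc _ _) w
    have e2 : extD ((χ.pullback _ (smooth_right (𝒢' := 𝒢') (q := q))).at V c) x w =
        extD (χ.at V fun y => (c y).right) x w :=
      extD_congr hN (fun y hy w => SmoothForm.pullback_at _ _ _ hc _ _) w
    have e3 : extD ((β.pullback _ R.smooth_proj).at V fun y => (c y).right) x w =
        extD (β.at V fun y => R.proj (c y).right) x w :=
      extD_congr hN (fun y hy w => SmoothForm.pullback_at _ _ _ hrt _ _) w
    have e4 : extD (χ.at V fun y => (c y).right) x w =
        - extD (β.at V fun y => R.proj (c y).right) x w := by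
      rw [SmoothForm.extD_add _ _ hrt hxV, SmoothForm.extD_neg _ hrt hxV, e3,
        hflat E V _ hrt x hxV, zero_add]
    have e5 := 𝒟₁.δcurv E V _ hl x hxV w
    -- Taking −dβ = f₂ − f₁ at the second component y' is what closes the sum: f₁(y') − f₁(y) +
    -- f₂(y') − f₁(y') = f₂(y') − f₁(y).
    have e6 := hcurv E V _ _ (𝒢'.smooth_snd.comp_plot hl) hm
      (fun y hy => by rw [← 𝒢'.π_fst]; exact (c y).π_left) x hxV w
    have hb₁ : EqOn (fun y => 𝒢'.fst (c y).left) (fun y => (Q.proj (r y)).1.1) V := fun y hy => by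
      simp only [fst, ← htb (e y hy)]
    have hb₂ : EqOn (fun y => 𝒢'.snd (c y).left) (fun y => (Q.proj (r y)).1.2) V := fun y hy => by
      simp only [snd, ← htb (e y hy)]
    have hQ := Q.smooth_proj.comp_plot hr
    have hQ₁ : IsPlot U (fun y => (Q.proj (r y)).1.1) := hQ.1
    have hQ₂ : IsPlot U (fun y => (Q.proj (r y)).1.2) := hQ.2
    rw [e0, SmoothForm.extD_add _ _ hc hxV, e1, e2, e4, ← e5,
      ← 𝒟₂.curv.at_mono hQ₂ (𝒢'.smooth_snd.comp_plot hl) hVU hb₂ hxV,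
      ← 𝒟₁.curv.at_mono hQ₁ (𝒢'.smooth_fst.comp_plot hl) hVU hb₁ hxV]
    simp only [Function.comp_def]
    linarith

end Tensor

end BundleGerbe

/-! ### The two implications for reductions. -/

theorem mainTheorem3
    (G : Type u) [Group G] [SmoothSpace G] (hG : IsLieGrp G) (L : LieAlg G)
    (M : Type u) [SmoothSpace M] [MulAction G M] (hM : IsLCManifold M)
    (M' : Type u) [SmoothSpace M'] (hM' : IsLCManifold M')
    (q : M → M') (hq : IsPrincipalQuotient G q)
    (Ξ : SmoothForm 1 M L.𝔤) (hΞ : IsGConnection L Ξ)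
    (𝒢 : BundleGerbe M) [BundleGerbe.StronglyEquivariant G 𝒢]
    (𝒟 : 𝒢.ConnCurv) (h𝒟 : 𝒟.IsInvariant G)
    (𝒢' : BundleGerbe M') (qY : 𝒢.Y → 𝒢'.Y) (qP : 𝒢.P.Tot → 𝒢'.P.Tot)
    (hquot : BundleGerbe.IsQuotient G q 𝒢 𝒢' qY qP)
    (lam₁ lam₂ : 𝒢.Y → (L.𝔤 →ₗ[ℝ] ℝ))
    (hlam₁ : BundleGerbe.IsAdmissible L 𝒟 lam₁) (hlam₂ : BundleGerbe.IsAdmissible L 𝒟 lam₂)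
    (𝒟₁ 𝒟₂ : 𝒢'.ConnCurv)
    (h₁ : BundleGerbe.IsReduction L qY qP Ξ 𝒟 lam₁ 𝒟₁)
    (h₂ : BundleGerbe.IsReduction L qY qP Ξ 𝒟 lam₂ 𝒟₂) :
    𝒟₁.nabla = 𝒟₂.nabla ∧
      (Nonempty (BundleGerbe.StableIso 𝒟₁ 𝒟₂) ↔
        ∃ (𝓡 : EquivariantFlatTBundle G M) (μ : M → (L.𝔤 →ₗ[ℝ] ℝ)),
          𝓡.IsMoment L μ ∧ ∀ y : 𝒢.Y, lam₂ y - lam₁ y = μ (𝒢.π y)) := by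
  obtain ⟨μ, hμ⟩ := hlam₁.exists_moment hlam₂
  have hn := BundleGerbe.IsReduction.nabla_unique hquot h₁ h₂ hμ
  refine ⟨hn, fun ⟨S⟩ => ?_, fun ⟨𝓡, μ, hmom, hμ⟩ => ?_⟩
  · have hμ' := hlam₁.isLocallyConstantMoment hlam₂ hμ
    obtain ⟨𝓡, h𝓡⟩ := S.exists_equivariantFlatTBundle hn hq (L := L) (hμ'.form Ξ)
      (hμ'.form_isInvariant hG hq.smoothAction hΞ) fun E U y m hy hm hym x hx w =>
        BundleGerbe.IsReduction.curv_sub hG hq hquot hlam₁ h₁ h₂ hμ hμ' hy hm hym hx w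
    exact ⟨𝓡, μ, fun r X => by rw [h𝓡, hμ'.form_moment hΞ], hμ⟩
  -- Here μ is the moment supplied with `𝓡`; admissibility alone makes it locally constant and
  -- equivariant, so ⟨Ξ|μ⟩ is again available.
  · have hμ' := hlam₁.isLocallyConstantMoment hlam₂ hμ
    exact BundleGerbe.nonempty_stableIso hn 𝓡.equivariant hG hq L 𝓡.isConnection 𝓡.invariant
      𝓡.flat (hμ'.form_isInvariant hG hq.smoothAction hΞ)
      (fun r X => by rw [← hmom, hμ'.form_moment hΞ]) fun E U y m hy hm hym x hx w =>
        BundleGerbe.IsReduction.curv_sub hG hq hquot hlam₁ h₁ h₂ hμ hμ' hy hm hym hx w
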